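/- Let $c\in C^1([0,\pi])$ with $c(\xi)>c_0>0$ on $[0,\pi]$ and $\int_0^\pi \frac{d\xi}{\sqrt{c(\xi)}}\le\pi$. Let $P\in C^2([0,+\infty))$ with $P(t)>p_0>0$ for all $t\ge 0$, let $M\in W^{2,2}(0,K)$ for every $K>0$, and put $N(t)=1+\int_0^tM(s)\,ds$. For $f\in L^2(0,T)$ consider the viscoelastic string with time-varying traction $$w_{tt}=P(t)\,(c(\xi)w_\xi)_\xi+\int_0^tM(t-s)P(s)\,(c(\xi)w_\xi)_\xi(s)\,ds,\qquad 0<\xi<\pi,\ 0<t<T,$$ $$w(\xi,0)=0,\quad w_t(\xi,0)=0,\quad w(0,t)=\frac{f(t)}{c(0)P(t)},\quad w(\pi,t)=0 .$$ A solution is a function $w\in C([0,T];L^2(0,\pi))$ with $w(0)=0$ such that for every $\phi\in H^2(0,\pi)\cap H^1_0(0,\pi)$ and every $t\in[0,T]$ $$\frac{d}{dt}\int_0^\pi w(\xi,t)\phi(\xi)\,d\xi=\int_0^tN(t-s)\Big(P(s)\int_0^\pi w(\xi,s)\,(c\phi')'(\xi)\,d\xi+\phi'(0)f(s)\Big)ds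 .$$ Let $T$ and $T_0\le T$ satisfy $$\int_0^{T_0}\sqrt{P(T-s)}\,ds=\pi .$$ Then for every $W\in L^2(0,\pi)$ there exists a control $f\in L^2(0,T)$ for which this problem has a unique solution $w$ on $[0,T]$, and $w(\cdot,T)=W$. -/

import Mathlib

open MeasureTheory Set

noncomputable section

/-- The real Hilbert space `L²(0,L)`. -/
abbrev L2Interval (L : ℝ) : Type := Lp ℝ 2 (volume.restrict (Ioo (0 : ℝ) L))

/-- `g` is (the `C¹` representative of) an element of the Sobolev space `W^{2,2}(0,L)`, with first
derivative `g₁` and second derivative `g₂`: both `g` and `g₁` are absolutely continuous on `[0,L]`,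
with derivatives `g₁` and `g₂`, and `g₂` is square integrable. -/
structure IsW22On (L : ℝ) (g g₁ g₂ : ℝ → ℝ) : Prop where
  eq_integral : ∀ x ∈ Icc 0 L, g x = g 0 + ∫ y in (0 : ℝ)..x, g₁ y
  deriv_eq_integral : ∀ x ∈ Icc 0 L, g₁ x = g₁ 0 + ∫ y in (0 : ℝ)..x, g₂ y
  memLp : MemLp g₂ 2 (volume.restrict (Ioo 0 L))

/-- `g ∈ W^{2,2}(0,K)` for every `K > 0`. -/
def IsW22Loc (g : ℝ → ℝ) : Prop :=
  ∃ g₁ g₂ : ℝ → ℝ, ∀ K : ℝ, 0 < K → IsW22On K g g₁ g₂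

/-- The integrated relaxation kernel `N(t) = 1 + ∫₀ᵗ M(s) ds`. -/
def integratedKernel (M : ℝ → ℝ) (t : ℝ) : ℝ := 1 + ∫ s in (0 : ℝ)..t, M s

/-- `φ` belongs to `H²(0,π) ∩ H¹₀(0,π)`, with derivatives `φ₁` and `φ₂`. -/
structure IsDomA (φ φ₁ φ₂ : ℝ → ℝ) : Prop where
  isW22On : IsW22On Real.pi φ φ₁ φ₂
  left : φ 0 = 0
  right : φ Real.pi = 0

/-- `Aφ = (c φ')' = c' φ' + c φ''`, for `φ` with derivatives `φ₁` and `φ₂`. -/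
def opA (c φ₁ φ₂ : ℝ → ℝ) (ξ : ℝ) : ℝ :=
  derivWithin c (Icc 0 Real.pi) ξ * φ₁ ξ + c ξ * φ₂ ξ

/-- `w ∈ C([0,T]; L²(0,π))` is the (weak, transposition) solution on `[0,T]` of
`w_tt = P(t) (c w_ξ)_ξ + ∫₀ᵗ M(t-s) P(s) (c w_ξ)_ξ(s) ds`, `w(·,0) = 0`, `w_t(·,0) = 0`,
`w(0,t) = u(t)`, `w(π,t) = 0`.

Integrating in time, with zero initial velocity, the equation is
`w_t = ∫₀ᵗ N(t-s) P(s) (c w_ξ)_ξ(s) ds`; multiplying by `φ ∈ H² ∩ H¹₀` and integrating by parts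
twice in `ξ` with the boundary values of `w` gives the identity below. -/
structure IsStringSolution (c P M : ℝ → ℝ) (T : ℝ) (u : ℝ → ℝ)
    (w : ℝ → L2Interval Real.pi) : Prop where
  continuousOn : ContinuousOn w (Icc 0 T)
  initial : w 0 = 0
  weak : ∀ φ φ₁ φ₂ : ℝ → ℝ, IsDomA φ φ₁ φ₂ → ∀ t ∈ Icc 0 T,
    HasDerivWithinAt (fun τ => ∫ ξ in (0 : ℝ)..Real.pi, w τ ξ * φ ξ)
      (∫ s in (0 : ℝ)..t, integratedKernel M (t - s) * P s *
        ((∫ ξ in (0 : ℝ)..Real.pi, w s ξ * opA c φ₁ φ₂ ξ) + c 0 * u s * φ₁ 0))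
      (Icc 0 T) t

end

open Filter Topology Function BoundedContinuousFunction

noncomputable section

/-! The control is read off from a wave built backwards from the target, with no moment problem.
Write the equation as w_t = v_ξ, v = c ∫₀ᵗ N(t-s) P(s) w_ξ(s) ds. The optical distance x = ∫₀^ξ
c^(-1/2) and an optical time θ with dθ = √P dt turn the principal part into a wave of speed one. Let
L be the optical length of the string and normalize θ = L at t = T. The hypotheses give ∫ c^(-1/2) ≤
π ≤ ∫₀ᵀ √P, so θ ≤ 0 at t = 0. A wave that vanishes for θ ≤ x therefore has zero initial state, and
vanishes at the far end up to time T, for free. It only has to take the target value on the line θ =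
L; its trace at x = 0 is the control.

With s = θ - x such a wave solves integral equations along the characteristics. The left-going part
starts from zero on the front s = 0; the right-going part starts from the final line x + s = L,
where the target prescribes the difference of the two. The relaxation kernel and the derivative of
√c enter as sources. In a weighted sup norm the linear part contracts by 1/2, which gives existence
(`exists_isWaveSolution`). A weight containing the data h itself gives the bound |h(θ - x)| + ∫|h|,
up to a constant (`IsWaveSolution.abs_le`, `exists_isNormalWave`). Both terms are controlled in L²,
so state and trace depend Lipschitz continuously on the target in L² (`exists_isStringWave`), and
continuous targets extend by density to all of L² (`exists_string_control`).

Uniqueness (`eq_zero_of_homogeneous_weak`) needs no eigenfunctions. If d solves the homogeneous weak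
equation, put z₀ = d(t₀) and A z_(n+1) = -z_n. The pairings ⟨d(t), z_k⟩ are iterated Volterra
integrals, so they decay factorially in k. At t = t₀ the even ones are the numbers ‖z_n‖², which
form a log-convex sequence. The two are compatible only if z₁ = 0, and then d(t₀) = 0. -/

/-! ### Differentiation of parametric integrals and inverses of primitives. -/

lemma continuous_integral_variable_limits {X : Type*} [TopologicalSpace X]
    {f : X → ℝ → ℝ} (hf : Continuous (uncurry f)) {a b : X → ℝ} (ha : Continuous a)
    (hb : Continuous b) : Continuous fun x => ∫ t in a x..b x, f x t := by
  have h : ∀ x, ∫ t in a x..b x, f x t = (∫ t in (0 : ℝ)..b x, f x t) - ∫ t in (0 : ℝ)..a x, f x t := by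
    intro x
    have hc : Continuous (f x) := by fun_prop
    rw [intervalIntegral.integral_interval_sub_left (hc.intervalIntegrable _ _)
      (hc.intervalIntegrable _ _)]
  simp_rw [h]
  fun_prop

/-- Leibniz rule with fixed limits. -/
lemma hasDerivAt_integral_param {Φ Φ' : ℝ → ℝ → ℝ} (hΦ : Continuous (uncurry Φ))
    (hΦ' : Continuous (uncurry Φ')) (hd : ∀ x s, HasDerivAt (fun x => Φ x s) (Φ' x s) x)
    (a b x₀ : ℝ) :
    HasDerivAt (fun x => ∫ s in a..b, Φ x s) (∫ s in a..b, Φ' x₀ s) x₀ := by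
  obtain ⟨C, hC⟩ := ((isCompact_Icc (a := x₀ - 1) (b := x₀ + 1)).prod
    (isCompact_uIcc (a := a) (b := b))).exists_bound_of_continuousOn hΦ'.continuousOn
  refine (intervalIntegral.hasDerivAt_integral_of_dominated_loc_of_deriv_le
    (F := Φ) (F' := Φ') (bound := fun _ => C) (s := Icc (x₀ - 1) (x₀ + 1))
    (Icc_mem_nhds (by linarith) (by linarith)) ?_ ?_ ?_ ?_ (by simp) ?_).2
  · refine Eventually.of_forall fun x => ?_
    have : Continuous (Φ x) := by fun_prop
    exact this.aestronglyMeasurable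
  · have : Continuous (Φ x₀) := by fun_prop
    exact this.intervalIntegrable _ _
  · have : Continuous (Φ' x₀) := by fun_prop
    exact this.aestronglyMeasurable
  · refine Eventually.of_forall fun t ht x hx => hC (x, t) ⟨hx, uIoc_subset_uIcc ht⟩
  · exact Eventually.of_forall fun t _ x _ => hd x t

/-- Leibniz rule with a variable upper limit. -/
lemma hasDerivAt_integral_param_limit {Φ Φ' : ℝ → ℝ → ℝ} (hΦ : Continuous (uncurry Φ))
    (hΦ' : Continuous (uncurry Φ')) (hd : ∀ x s, HasDerivAt (fun x => Φ x s) (Φ' x s) x)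
    {S : ℝ → ℝ} {S' x₀ : ℝ} (hS : HasDerivAt S S' x₀) (a : ℝ) :
    HasDerivAt (fun x => ∫ s in a..S x, Φ x s)
      (S' * Φ x₀ (S x₀) + ∫ s in a..S x₀, Φ' x₀ s) x₀ := by
  have hc : ∀ x, Continuous (Φ x) := fun x => by fun_prop
  have h1 := hasDerivAt_integral_param hΦ hΦ' hd a (S x₀) x₀
  have h2 : HasDerivAt (fun x => ∫ s in S x₀..S x, Φ x₀ s) (S' * Φ x₀ (S x₀)) x₀ := by
    have := (intervalIntegral.integral_hasDerivAt_right ((hc x₀).intervalIntegrable (S x₀) (S x₀))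
      (hc x₀).aestronglyMeasurable.stronglyMeasurableAtFilter (hc x₀).continuousAt).comp x₀ hS
    simpa [mul_comm, Function.comp_def] using this
  -- Moving the limit and the parameter together costs an integral of an o(1) function over an
  -- interval of length O(x - x₀), hence o(x - x₀).
  have h3 : HasDerivAt (fun x => ∫ s in S x₀..S x, (Φ x s - Φ x₀ s)) 0 x₀ := by
    rw [hasDerivAt_iff_isLittleO]
    simp only [intervalIntegral.integral_same, sub_zero, smul_zero]
    refine Asymptotics.IsLittleO.trans_isBigO (g := fun x => S x - S x₀) ?_ hS.isBigO_sub
    rw [Asymptotics.isLittleO_iff]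
    intro ε hε
    have hu : Continuous (fun q : ℝ × ℝ => Φ q.1 q.2 - Φ x₀ q.2) := by fun_prop
    have hz : ∀ᶠ q in 𝓝 (x₀, S x₀), ‖Φ q.1 q.2 - Φ x₀ q.2‖ < ε := by
      have := hu.norm.continuousAt (x := (x₀, S x₀))
      refine this.eventually (gt_mem_nhds ?_)
      simpa using hε
    obtain ⟨δ, hδ, hball⟩ := Metric.eventually_nhds_iff.1 hz
    have hS' : ∀ᶠ x in 𝓝 x₀, dist (S x) (S x₀) < δ :=
      hS.continuousAt.eventually (Metric.ball_mem_nhds _ hδ)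
    filter_upwards [hS', Metric.ball_mem_nhds x₀ hδ] with x hx hx'
    have := intervalIntegral.norm_integral_le_of_norm_le_const (a := S x₀) (b := S x)
      (f := fun s => Φ x s - Φ x₀ s) (C := ε) (fun s hs => ?_)
    · simpa [Real.norm_eq_abs] using this
    · refine (hball (y := (x, s)) ?_).le
      rw [Prod.dist_eq]
      refine max_lt hx' (lt_of_le_of_lt ?_ hx)
      have := abs_sub_left_of_mem_uIcc (uIoc_subset_uIcc hs)
      simpa [Real.dist_eq] using this
  have := (h1.add h2).add h3
  refine (this.congr_deriv (by ring)).congr_of_eventuallyEq (Eventually.of_forall fun x => ?_)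
  simp only [Pi.add_apply]
  rw [intervalIntegral.integral_sub ((hc x).intervalIntegrable _ _)
    ((hc x₀).intervalIntegrable _ _), add_assoc, add_sub_cancel,
    intervalIntegral.integral_add_adjacent_intervals ((hc x).intervalIntegrable _ _)
      ((hc x).intervalIntegrable _ _)]

lemma hasDerivAt_integral_right {g : ℝ → ℝ} (hg : Continuous g) (a x : ℝ) :
    HasDerivAt (fun x => ∫ t in a..x, g t) (g x) x :=
  intervalIntegral.integral_hasDerivAt_right (hg.intervalIntegrable _ _)
    hg.aestronglyMeasurable.stronglyMeasurableAtFilter hg.continuousAt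

/-- A continuous function bounded below by a positive constant has a primitive which is a
diffeomorphism of the line. -/
lemma exists_inverse_of_deriv_ge {X g : ℝ → ℝ} (hX : ∀ x, HasDerivAt X (g x) x) {m : ℝ}
    (hm : 0 < m) (hg : ∀ x, m ≤ g x) :
    ∃ Y : ℝ → ℝ, (∀ x, Y (X x) = x) ∧ (∀ y, X (Y y) = y) ∧ StrictMono X ∧ StrictMono Y ∧
      ∀ y, HasDerivAt Y (g (Y y))⁻¹ y := by
  have hmono : StrictMono X :=
    strictMono_of_hasDerivAt_pos hX fun x => hm.trans_le (hg x)
  have hcont : Continuous X := continuous_iff_continuousAt.2 fun x => (hX x).continuousAt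
  have hle : ∀ x y, x ≤ y → m * (y - x) ≤ X y - X x := fun x y hxy =>
    (convex_univ (𝕜 := ℝ)).mul_sub_le_image_sub_of_le_deriv (D := univ) hcont.continuousOn
      (fun x _ => (hX x).differentiableAt.differentiableWithinAt)
      (fun x _ => by rw [(hX x).deriv]; exact hg x) x (mem_univ _) y (mem_univ _) hxy
  have hsurj : Surjective X := by
    refine hcont.surjective ?_ ?_
    · refine tendsto_atTop_mono' _ ?_ (tendsto_atTop_add_const_left _ (X 0)
        (tendsto_id.const_mul_atTop hm))
      filter_upwards [eventually_ge_atTop 0] with x hx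
      have := hle 0 x hx
      simp only [id]; linarith
    · refine tendsto_atBot_mono' _ ?_ (tendsto_atBot_add_const_left _ (X 0)
        (tendsto_id.const_mul_atBot hm))
      filter_upwards [eventually_le_atBot 0] with x hx
      have := hle x 0 hx
      simp only [id]; linarith
  let e := hmono.orderIsoOfSurjective X hsurj
  have hl : ∀ x, e.symm (X x) = x := fun x => e.symm_apply_apply x
  have hr : ∀ y, X (e.symm y) = y := fun y => e.apply_symm_apply y
  refine ⟨e.symm, hl, hr, hmono, e.symm.strictMono, fun y => ?_⟩
  exact HasDerivAt.of_local_left_inverse e.symm.continuous.continuousAt (hX _)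
    (hm.trans_le (hg _)).ne' (Eventually.of_forall hr)

/-! ### Extension of the coefficients from an interval to the line. -/

/-- The projection of the line onto `[0, R]`. -/
def clampTo (R x : ℝ) : ℝ := max 0 (min R x)

lemma clampTo_mem {R : ℝ} (hR : 0 ≤ R) (x : ℝ) : clampTo R x ∈ Icc 0 R :=
  ⟨le_max_left _ _, max_le hR (min_le_left _ _)⟩

lemma clampTo_of_mem {R x : ℝ} (hx : x ∈ Icc 0 R) : clampTo R x = x := by
  simp [clampTo, hx.1, hx.2]

@[fun_prop]
lemma continuous_clampTo (R : ℝ) : Continuous (clampTo R) := by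
  unfold clampTo; fun_prop

lemma ContinuousOn.continuous_comp_clampTo {R : ℝ} (hR : 0 ≤ R) {g : ℝ → ℝ}
    (hg : ContinuousOn g (Icc 0 R)) : Continuous fun x => g (clampTo R x) :=
  hg.comp_continuous (continuous_clampTo R) (clampTo_mem hR)

lemma exists_C1_extension {R : ℝ} (hR : 0 ≤ R) {g g₁ : ℝ → ℝ} (hg₁ : ContinuousOn g₁ (Icc 0 R))
    (hg : ∀ x ∈ Icc 0 R, g x = g 0 + ∫ y in (0 : ℝ)..x, g₁ y) :
    ∃ f f₁ : ℝ → ℝ, Continuous f₁ ∧ (∀ x, HasDerivAt f (f₁ x) x) ∧ EqOn f g (Icc 0 R) ∧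
      EqOn f₁ g₁ (Icc 0 R) := by
  have hc := hg₁.continuous_comp_clampTo hR
  refine ⟨fun x => g 0 + ∫ y in (0 : ℝ)..x, g₁ (clampTo R y), fun x => g₁ (clampTo R x), hc,
    fun x => (hasDerivAt_integral_right hc 0 x).const_add _, fun x hx => ?_,
    fun x hx => by simp [clampTo_of_mem hx]⟩
  simp only
  rw [hg x hx]
  congr 1
  refine intervalIntegral.integral_congr fun y hy => ?_
  rw [uIcc_of_le hx.1] at hy
  simp [clampTo_of_mem (⟨hy.1, hy.2.trans hx.2⟩ : y ∈ Icc 0 R)]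

/-- A positive `C¹` function on `[0, R]` extends to a `C¹` function on the line with positive
lower and upper bounds. -/
lemma exists_pos_C1_extension {R : ℝ} (hR : 0 < R) {g : ℝ → ℝ} (hg : ContDiffOn ℝ 1 g (Icc 0 R))
    (hpos : ∀ x ∈ Icc 0 R, 0 < g x) :
    ∃ f f₁ : ℝ → ℝ, ∃ m B : ℝ, 0 < m ∧ Continuous f₁ ∧ (∀ x, HasDerivAt f (f₁ x) x) ∧
      EqOn f g (Icc 0 R) ∧ ∀ x, m ≤ f x ∧ f x ≤ B := by
  have hd : ContinuousOn (derivWithin g (Icc 0 R)) (Icc 0 R) :=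
    hg.continuousOn_derivWithin (uniqueDiffOn_Icc hR) le_rfl
  set q : ℝ → ℝ := fun x => derivWithin g (Icc 0 R) x / g x
  have hq : ContinuousOn q (Icc 0 R) := hd.div hg.continuousOn fun x hx => (hpos x hx).ne'
  -- The logarithmic derivative `q`, continued by constants and cut off at distance 1 from [0, R].
  -- Its primitive is bounded, so the exponential of the primitive is bounded above and away from
  -- zero.
  set κ : ℝ → ℝ := fun x => q (clampTo R x) * max 0 (1 - |x - clampTo R x|)
  have hκ : Continuous κ := (hq.continuous_comp_clampTo hR.le).mul (by fun_prop)
  have hsupp : HasCompactSupport κ := by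
    refine HasCompactSupport.intro (isCompact_Icc (a := -1) (b := R + 1)) fun x hx => ?_
    have : 1 ≤ |x - clampTo R x| := by
      rw [mem_Icc, not_and_or, not_le, not_le] at hx
      have hm := clampTo_mem hR.le x
      rcases hx with h | h
      · rw [abs_of_nonpos (by linarith [hm.1])]; linarith [hm.1]
      · rw [abs_of_nonneg (by linarith [hm.2])]; linarith [hm.2]
    simp only [κ, max_eq_left (by linarith : 1 - |x - clampTo R x| ≤ 0), mul_zero]
  have hint : Integrable κ := hκ.integrable_of_hasCompactSupport hsupp
  set K := ∫ x, |κ x|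
  have hK : ∀ x, |∫ y in (0 : ℝ)..x, κ y| ≤ K := fun x =>
    (intervalIntegral.norm_integral_le_integral_norm_uIoc).trans
      (setIntegral_le_integral hint.norm (Eventually.of_forall fun _ => norm_nonneg _))
  have hg0 : 0 < g 0 := hpos 0 ⟨le_rfl, hR.le⟩
  have hder : ∀ x, HasDerivAt (fun x => g 0 * Real.exp (∫ y in (0 : ℝ)..x, κ y))
      (g 0 * (Real.exp (∫ y in (0 : ℝ)..x, κ y) * κ x)) x := fun x =>
    ((hasDerivAt_integral_right hκ 0 x).exp).const_mul _
  refine ⟨_, _, g 0 * Real.exp (-K), g 0 * Real.exp K, by positivity, ?_, hder, ?_, fun x => ?_⟩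
  · have : Continuous fun x => ∫ y in (0 : ℝ)..x, κ y :=
      continuous_iff_continuousAt.2 fun x => (hasDerivAt_integral_right hκ 0 x).continuousAt
    fun_prop
  · intro x hx
    have hlog : ∫ y in (0 : ℝ)..x, κ y = Real.log (g x) - Real.log (g 0) := by
      refine intervalIntegral.integral_eq_sub_of_hasDerivAt_of_le hx.1
        (f := fun y => Real.log (g y)) ?_ ?_ (hκ.intervalIntegrable _ _)
      · exact (hg.continuousOn.mono (Icc_subset_Icc_right hx.2)).log fun y hy =>
          (hpos y ⟨hy.1, hy.2.trans hx.2⟩).ne'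
      · intro y hy
        have hy' : y ∈ Icc 0 R := ⟨hy.1.le, hy.2.le.trans hx.2⟩
        have h1 : HasDerivAt g (derivWithin g (Icc 0 R) y) y :=
          ((hg.differentiableOn one_ne_zero y hy').hasDerivWithinAt).hasDerivAt
            (Icc_mem_nhds hy.1 (hy.2.trans_le hx.2))
        refine (h1.log (hpos y hy').ne').congr_deriv ?_
        simp [κ, q, clampTo_of_mem hy']
    simp only [hlog, Real.exp_sub, Real.exp_log (hpos x hx), Real.exp_log hg0]
    field_simp
  · have := abs_le.1 (hK x)
    constructor
    · gcongr; exact this.1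
    · gcongr; exact this.2

/-! ### Weighted estimates for the equations along the characteristics. -/

lemma abs_integral_exp_mul_abs {μ : ℝ} (hμ : μ ≠ 0) (z : ℝ) :
    |∫ σ in (0 : ℝ)..z, Real.exp (μ * |σ|)| = |(Real.exp (μ * |z|) - 1) / μ| := by
  have key : ∀ z : ℝ, 0 ≤ z →
      ∫ σ in (0 : ℝ)..z, Real.exp (μ * |σ|) = (Real.exp (μ * |z|) - 1) / μ := by
    intro z hz
    have : ∫ σ in (0 : ℝ)..z, Real.exp (μ * |σ|) = ∫ σ in (0 : ℝ)..z, Real.exp (μ * σ) := by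
      refine intervalIntegral.integral_congr fun σ hσ => ?_
      rw [uIcc_of_le hz] at hσ
      simp only [abs_of_nonneg hσ.1]
    rw [this, abs_of_nonneg hz, intervalIntegral.integral_comp_mul_left (fun x => Real.exp x) hμ, integral_exp]
    simp [div_eq_inv_mul]
  rcases le_total 0 z with hz | hz
  · rw [key z hz]
  · have h1 := intervalIntegral.integral_comp_neg (a := 0) (b := -z)
      (fun σ => Real.exp (μ * |σ|))
    simp only [abs_neg, neg_neg, neg_zero] at h1
    rw [intervalIntegral.integral_symm, abs_neg, ← h1, key (-z) (by linarith), abs_neg]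

lemma abs_integral_exp_mul_abs_le {μ : ℝ} (hμ : 0 < μ) (z : ℝ) :
    |∫ σ in (0 : ℝ)..z, Real.exp (μ * |σ|)| ≤ Real.exp (μ * |z|) / μ := by
  rw [abs_integral_exp_mul_abs hμ.ne', abs_of_nonneg]
  · gcongr; linarith
  · have : 1 ≤ Real.exp (μ * |z|) := Real.one_le_exp (by positivity)
    exact div_nonneg (by linarith) hμ.le

lemma abs_integral_exp_neg_mul_abs_le {κ : ℝ} (hκ : 0 < κ) (s : ℝ) :
    |∫ σ in (0 : ℝ)..s, Real.exp (-κ * |s - σ|)| ≤ 1 / κ := by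
  have h1 := intervalIntegral.integral_comp_sub_left (a := 0) (b := s)
    (fun σ => Real.exp (-κ * |σ|)) s
  simp only [sub_self, sub_zero] at h1
  rw [h1, abs_integral_exp_mul_abs (by linarith), div_neg, abs_neg, abs_div, abs_of_pos hκ]
  gcongr
  have : Real.exp (-κ * |s|) ≤ 1 := Real.exp_le_one_iff.2 (by have := abs_nonneg s; nlinarith)
  rw [abs_of_nonpos (by linarith)]
  have := Real.exp_pos (-κ * |s|)
  linarith

lemma abs_sub_of_mem_uIcc_zero {s σ : ℝ} (hσ : σ ∈ uIcc 0 s) : |s - σ| = |s| - |σ| := by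
  rcases le_total 0 s with hs | hs
  · rw [uIcc_of_le hs] at hσ
    rw [abs_of_nonneg hs, abs_of_nonneg hσ.1, abs_of_nonneg (by linarith [hσ.2])]
  · rw [uIcc_of_ge hs] at hσ
    rw [abs_of_nonpos hs, abs_of_nonpos hσ.2, abs_of_nonpos (by linarith [hσ.1])]
    ring

lemma abs_integral_le_of_abs_le {f g : ℝ → ℝ} (hg : Continuous g) {a b : ℝ}
    (h : ∀ x ∈ uIcc a b, |f x| ≤ g x) : |∫ x in a..b, f x| ≤ |∫ x in a..b, g x| := by
  refine intervalIntegral.norm_integral_le_abs_of_norm_le (μ := volume) (f := f) (g := g) ?_ (hg.intervalIntegrable (μ := volume) a b)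
  filter_upwards [ae_restrict_mem measurableSet_uIoc] with x hx
  exact h x (uIoc_subset_uIcc hx)

/-- The wave travelling to the left generated by the source `G`, vanishing on `s = 0`; `s` is the
coordinate which is constant along the right characteristics. -/
def leftWave (G : ℝ → ℝ → ℝ) (s x : ℝ) : ℝ := 1 / 2 * ∫ σ in (0 : ℝ)..s, G σ (x + (s - σ) / 2)

/-- The wave travelling to the right generated by the source `G`, with
`leftWave - rightWave = h` on the line `x + s = L`. -/
def rightWave (L : ℝ) (h : ℝ → ℝ) (G : ℝ → ℝ → ℝ) (s x : ℝ) : ℝ :=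
  leftWave G s (L - s) - h s - ∫ y in x..(L - s), G s y

/-- The right hand side of the integral equations along the characteristics. -/
def waveMap (L : ℝ) (A B : ℝ → ℝ → ℝ) (k : ℝ → ℝ → ℝ → ℝ) (h : ℝ → ℝ) (G Q : ℝ → ℝ → ℝ)
    (s x : ℝ) : ℝ :=
  A s x * leftWave G s x + B s x * rightWave L h G s x + ∫ σ in (0 : ℝ)..s, k s x σ * Q σ x

/-- The exponential in the distance to the final line x + s = L makes integration from that line
small, the one in |s| does the same for integration from the front s = 0. The rate 24C exceeds 8C
because the second factor must absorb the growth of the first along the paths of integration. `η` is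
|h| in the a priori estimate and 0 in the existence proof; `H` bounds its integral. -/
def waveWeight (L C : ℝ) (η : ℝ → ℝ) (H s x : ℝ) : ℝ :=
  (η s + 16 * C * H * Real.exp (24 * C * |s|)) * Real.exp (8 * C * |x + s - L|)

@[fun_prop]
lemma continuous_leftWave {G : ℝ → ℝ → ℝ} (hG : Continuous (uncurry G)) :
    Continuous (uncurry (leftWave G)) := by
  have : Continuous fun q : ℝ × ℝ => ∫ σ in (0 : ℝ)..q.1, G σ (q.2 + (q.1 - σ) / 2) :=
    continuous_integral_variable_limits (by fun_prop) (by fun_prop) (by fun_prop)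
  exact this.const_mul _

lemma continuous_rightWave {L : ℝ} {h : ℝ → ℝ} (hh : Continuous h) {G : ℝ → ℝ → ℝ}
    (hG : Continuous (uncurry G)) : Continuous (uncurry (rightWave L h G)) := by
  have h1 : Continuous fun q : ℝ × ℝ => ∫ y in q.2..(L - q.1), G q.1 y :=
    continuous_integral_variable_limits (by fun_prop) (by fun_prop) (by fun_prop)
  have h2 : Continuous fun q : ℝ × ℝ => leftWave G q.1 (L - q.1) :=
    (continuous_leftWave hG).comp (by fun_prop : Continuous fun q : ℝ × ℝ => (q.1, L - q.1))
  exact (h2.sub (by fun_prop)).sub h1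

lemma continuous_waveMap {L : ℝ} {A B : ℝ → ℝ → ℝ} {k : ℝ → ℝ → ℝ → ℝ} {h : ℝ → ℝ}
    {G Q : ℝ → ℝ → ℝ} (hA : Continuous (uncurry A)) (hB : Continuous (uncurry B))
    (hk : Continuous fun q : ℝ × ℝ × ℝ => k q.1 q.2.1 q.2.2) (hh : Continuous h)
    (hG : Continuous (uncurry G)) (hQ : Continuous (uncurry Q)) :
    Continuous (uncurry (waveMap L A B k h G Q)) := by
  have h1 : Continuous fun q : ℝ × ℝ => ∫ σ in (0 : ℝ)..q.1, k q.1 q.2 σ * Q σ q.2 := by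
    refine continuous_integral_variable_limits ?_ (by fun_prop) (by fun_prop)
    exact (hk.comp (by fun_prop : Continuous fun q : (ℝ × ℝ) × ℝ => (q.1.1, q.1.2, q.2))).mul
      (hQ.comp (by fun_prop : Continuous fun q : (ℝ × ℝ) × ℝ => (q.2, q.1.2)))
  exact ((hA.mul (continuous_leftWave hG)).add (hB.mul (continuous_rightWave hh hG))).add h1

/-- Between 0 and s one has |s - σ| = |s| - |σ|, so the surplus rate 24C - 8C leaves a decaying
exponential of integral at most 1/(16C). This cancels the factor 16C, and each of the two terms of
the weight contributes `H`. -/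
lemma abs_integral_weight_le {C : ℝ} (hC : 0 < C) {η : ℝ → ℝ} (hη : Continuous η)
    (hη0 : ∀ s, 0 ≤ η s) {H s : ℝ} (hH0 : 0 ≤ H) (hH : |∫ σ in (0 : ℝ)..s, η σ| ≤ H) :
    |∫ σ in (0 : ℝ)..s, (η σ + 16 * C * H * Real.exp (24 * C * |σ|)) *
      Real.exp (8 * C * |s - σ|)| ≤ 2 * H * Real.exp (24 * C * |s|) := by
  have h1 : ∀ σ ∈ uIcc 0 s, |(η σ + 16 * C * H * Real.exp (24 * C * |σ|)) *
      Real.exp (8 * C * |s - σ|)| ≤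
      Real.exp (24 * C * |s|) * (η σ + 16 * C * H * Real.exp (-(16 * C) * |s - σ|)) := by
    intro σ hσ
    have e := abs_sub_of_mem_uIcc_zero hσ
    have hnn : 0 ≤ |s| - |σ| := e ▸ abs_nonneg _
    rw [abs_of_nonneg (mul_nonneg (add_nonneg (hη0 σ) (by positivity)) (by positivity)), add_mul,
      mul_add]
    have e1 : Real.exp (8 * C * |s - σ|) ≤ Real.exp (24 * C * |s|) := by
      rw [e]
      apply Real.exp_le_exp.2
      have := abs_nonneg σ
      have := abs_nonneg s
      nlinarith
    have e2 : Real.exp (24 * C * |σ|) * Real.exp (8 * C * |s - σ|) =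
        Real.exp (24 * C * |s|) * Real.exp (-(16 * C) * |s - σ|) := by
      rw [← Real.exp_add, ← Real.exp_add, e]
      congr 1; ring
    have := mul_le_mul_of_nonneg_left e1 (hη0 σ)
    have e3 : 16 * C * H * Real.exp (24 * C * |σ|) * Real.exp (8 * C * |s - σ|) =
      Real.exp (24 * C * |s|) * (16 * C * H * Real.exp (-(16 * C) * |s - σ|)) := by
      rw [mul_assoc, e2]; ring
    rw [e3]; linarith
  refine (abs_integral_le_of_abs_le (by fun_prop) h1).trans ?_
  rw [intervalIntegral.integral_const_mul, intervalIntegral.integral_add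
    (hη.intervalIntegrable _ _) (Continuous.intervalIntegrable (by fun_prop) _ _),
    intervalIntegral.integral_const_mul, abs_mul, abs_of_pos (Real.exp_pos _)]
  have h2 := abs_integral_exp_neg_mul_abs_le (κ := 16 * C) (by positivity) s
  have h3 : |16 * C * H * ∫ σ in (0 : ℝ)..s, Real.exp (-(16 * C) * |s - σ|)| ≤ H := by
    rw [abs_mul, abs_of_nonneg (by positivity)]
    calc _ ≤ 16 * C * H * (1 / (16 * C)) := by gcongr
      _ = H := by field_simp
  calc _ ≤ Real.exp (24 * C * |s|) * (H + H) := by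
        gcongr; exact (abs_add_le _ _).trans (add_le_add hH h3)
    _ = _ := by ring

section estimates

variable {L C : ℝ} {η : ℝ → ℝ} {H m : ℝ} {J : Set ℝ}

lemma waveWeight_mul_nonneg (hC : 0 < C) (hη0 : ∀ s, 0 ≤ η s) (hH0 : 0 ≤ H) (s : ℝ) :
    0 ≤ η s + 16 * C * H * Real.exp (24 * C * |s|) :=
  add_nonneg (hη0 s) (by positivity)

/-- Treats the left characteristic and the memory integral at fixed x together: on both paths the
distance to the final line grows by at most |s - σ|, the growth allowed in `abs_integral_weight_le`.
-/
lemma abs_integral_path_le (hC : 0 < C) (hη : Continuous η) (hη0 : ∀ s, 0 ≤ η s) (hH0 : 0 ≤ H)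
    (hJ : J.OrdConnected) (h0 : (0 : ℝ) ∈ J) (hm : 0 ≤ m) {s : ℝ} (hs : s ∈ J)
    (hH : |∫ σ in (0 : ℝ)..s, η σ| ≤ H) {G : ℝ → ℝ → ℝ}
    (hG : ∀ s ∈ J, ∀ x, |G s x| ≤ m * waveWeight L C η H s x) {k : ℝ → ℝ} {K : ℝ} (hK : 0 ≤ K)
    (hk : ∀ σ ∈ J, |k σ| ≤ K) {x : ℝ} {γ : ℝ → ℝ}
    (hγ : ∀ σ, |γ σ + σ - L| ≤ |x + s - L| + |s - σ|) :
    |∫ σ in (0 : ℝ)..s, k σ * G σ (γ σ)| ≤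
      K * m * Real.exp (8 * C * |x + s - L|) * (2 * H * Real.exp (24 * C * |s|)) := by
  have h1 : ∀ σ ∈ uIcc 0 s, |k σ * G σ (γ σ)| ≤ K * m * Real.exp (8 * C * |x + s - L|) *
      ((η σ + 16 * C * H * Real.exp (24 * C * |σ|)) * Real.exp (8 * C * |s - σ|)) := by
    intro σ hσ
    have hσJ : σ ∈ J := hJ.uIcc_subset h0 hs hσ
    have hw := waveWeight_mul_nonneg hC hη0 hH0 σ
    rw [abs_mul]
    calc _ ≤ K * (m * waveWeight L C η H σ (γ σ)) :=
          mul_le_mul (hk σ hσJ) (hG σ hσJ _) (abs_nonneg _) hK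
      _ ≤ K * (m * ((η σ + 16 * C * H * Real.exp (24 * C * |σ|)) *
          Real.exp (8 * C * (|x + s - L| + |s - σ|)))) := by
          unfold waveWeight
          gcongr
          exact hγ σ
      _ = _ := by rw [mul_add, Real.exp_add]; ring
  refine (abs_integral_le_of_abs_le (by fun_prop) h1).trans ?_
  rw [intervalIntegral.integral_const_mul, abs_mul, abs_of_nonneg (by positivity)]
  gcongr
  exact abs_integral_weight_le hC hη hη0 hH0 hH

lemma abs_leftWave_le (hC : 0 < C) (hη : Continuous η) (hη0 : ∀ s, 0 ≤ η s) (hH0 : 0 ≤ H)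
    (hJ : J.OrdConnected) (h0 : (0 : ℝ) ∈ J) (hm : 0 ≤ m) {s : ℝ} (hs : s ∈ J)
    (hH : |∫ σ in (0 : ℝ)..s, η σ| ≤ H) {G : ℝ → ℝ → ℝ}
    (hG : ∀ s ∈ J, ∀ x, |G s x| ≤ m * waveWeight L C η H s x) (x : ℝ) :
    |leftWave G s x| ≤ m * Real.exp (8 * C * |x + s - L|) * (H * Real.exp (24 * C * |s|)) := by
  have := abs_integral_path_le hC hη hη0 hH0 hJ h0 hm hs hH hG (k := fun _ => 1) (K := 1)
    zero_le_one (fun _ _ => by simp) (x := x) (γ := fun σ => x + (s - σ) / 2) (fun σ => by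
      have e : x + (s - σ) / 2 + σ - L = (x + s - L) - (s - σ) / 2 := by ring
      rw [e]
      refine (abs_sub _ _).trans ?_
      rw [abs_div]
      have := abs_nonneg (s - σ)
      norm_num)
  simp only [one_mul] at this
  rw [leftWave, abs_mul, abs_of_pos (by norm_num : (0 : ℝ) < 1 / 2)]
  linarith

/-- The integral in `y` ends on the final line, where the spatial exponent is zero; integrating the
weight away from there gains the factor 1/(8C). -/
lemma abs_rightWave_zero_le (hC : 0 < C) (hη : Continuous η) (hη0 : ∀ s, 0 ≤ η s) (hH0 : 0 ≤ H)
    (hJ : J.OrdConnected) (h0 : (0 : ℝ) ∈ J) (hm : 0 ≤ m) {s : ℝ} (hs : s ∈ J)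
    (hH : |∫ σ in (0 : ℝ)..s, η σ| ≤ H) {G : ℝ → ℝ → ℝ}
    (hG : ∀ s ∈ J, ∀ x, |G s x| ≤ m * waveWeight L C η H s x) (x : ℝ) :
    |rightWave L (fun _ => 0) G s x| ≤
      m * Real.exp (8 * C * |x + s - L|) * (H * Real.exp (24 * C * |s|)) +
      m * (η s + 16 * C * H * Real.exp (24 * C * |s|)) *
        (Real.exp (8 * C * |x + s - L|) / (8 * C)) := by
  have hw := waveWeight_mul_nonneg hC hη0 hH0 s
  have h1 := abs_leftWave_le hC hη hη0 hH0 hJ h0 hm hs hH hG (L - s)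
  have e0 : L - s + s - L = 0 := by ring
  rw [e0] at h1
  have h2 : |∫ y in x..(L - s), G s y| ≤ m * (η s + 16 * C * H * Real.exp (24 * C * |s|)) *
      (Real.exp (8 * C * |x + s - L|) / (8 * C)) := by
    have h3 : ∀ y ∈ uIcc x (L - s), |G s y| ≤ m * (η s + 16 * C * H * Real.exp (24 * C * |s|)) *
        Real.exp (8 * C * |y + (s - L)|) := fun y _ => by
      have := hG s hs y
      rw [waveWeight, ← mul_assoc] at this
      rwa [← add_sub_assoc]
    refine (abs_integral_le_of_abs_le (by fun_prop) h3).trans ?_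
    rw [intervalIntegral.integral_const_mul, abs_mul, abs_of_nonneg (by positivity)]
    gcongr
    rw [intervalIntegral.integral_comp_add_right (fun y => Real.exp (8 * C * |y|)),
      show L - s + (s - L) = 0 by ring, intervalIntegral.integral_symm, abs_neg,
      show x + (s - L) = x + s - L by ring]
    exact abs_integral_exp_mul_abs_le (by positivity) _
  have h4 : Real.exp (8 * C * |0|) ≤ Real.exp (8 * C * |x + s - L|) := by
    simp only [abs_zero]; gcongr; exact abs_nonneg _
  rw [rightWave, sub_zero]
  refine (abs_sub _ _).trans (add_le_add (h1.trans ?_) h2)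
  gcongr

/-- The contraction estimate. Relative to the part of the weight without `η`, the left wave costs
1/16, the right wave 1/16 + 1/8 and the memory 1/8, in total 3/8; the part with `η` costs only 1/8.
The value at s uses only times between 0 and s, so bounds on an order connected `J` containing 0
suffice. -/
lemma abs_waveMap_zero_le (hC : 0 < C) (hη : Continuous η) (hη0 : ∀ s, 0 ≤ η s) (hH0 : 0 ≤ H)
    (hJ : J.OrdConnected) (h0 : (0 : ℝ) ∈ J) (hm : 0 ≤ m)
    (hH : ∀ s ∈ J, |∫ σ in (0 : ℝ)..s, η σ| ≤ H) {A B : ℝ → ℝ → ℝ} {k : ℝ → ℝ → ℝ → ℝ}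
    (hA : ∀ s x, |A s x| ≤ C) (hB : ∀ s x, |B s x| ≤ C) (hk : ∀ s x σ, |k s x σ| ≤ C)
    {G Q : ℝ → ℝ → ℝ} (hG : ∀ s ∈ J, ∀ x, |G s x| ≤ m * waveWeight L C η H s x)
    (hQ : ∀ s ∈ J, ∀ x, |Q s x| ≤ m * waveWeight L C η H s x) :
    ∀ s ∈ J, ∀ x, |waveMap L A B k (fun _ => 0) G Q s x| ≤ m / 2 * waveWeight L C η H s x := by
  intro s hs x
  have h1 := abs_leftWave_le hC hη hη0 hH0 hJ h0 hm hs (hH s hs) hG x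
  have h2 := abs_rightWave_zero_le hC hη hη0 hH0 hJ h0 hm hs (hH s hs) hG x
  have h3 := abs_integral_path_le hC hη hη0 hH0 hJ h0 hm hs (hH s hs) hQ (k := k s x)
    hC.le (fun σ _ => hk s x σ) (x := x) (γ := fun _ => x) (fun σ => by
      have e : x + σ - L = (x + s - L) - (s - σ) := by ring
      rw [e]
      exact abs_sub _ _)
  have h4 := mul_le_mul (hA s x) h1 (abs_nonneg _) hC.le
  have h5 := mul_le_mul (hB s x) h2 (abs_nonneg _) hC.le
  rw [← abs_mul] at h4 h5
  have h6 : |waveMap L A B k (fun _ => 0) G Q s x| ≤ _ :=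
    (abs_add_three _ _ _).trans (add_le_add (add_le_add h4 h5) h3)
  refine h6.trans ?_
  set E := Real.exp (8 * C * |x + s - L|)
  set F := Real.exp (24 * C * |s|)
  have hE : 0 ≤ E := (Real.exp_pos _).le
  have hη' := hη0 s
  have e : C * (m * (η s + 16 * C * H * F) * (E / (8 * C))) =
      m * (η s + 16 * C * H * F) * E / 8 := by field_simp
  rw [waveWeight, mul_add C (_ * _), e]
  have : 0 ≤ m * η s * E := by positivity
  have : 0 ≤ C * (m * E * (H * F)) := by positivity
  nlinarith

end estimates

/-! ### Solutions of the integral equations: a priori bound and existence. -/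

/-- The coefficients of a `waveMap` are continuous and bounded by `C`. -/
structure IsWaveCoeff (C : ℝ) (A B : ℝ → ℝ → ℝ) (k : ℝ → ℝ → ℝ → ℝ) : Prop where
  contA : Continuous (uncurry A)
  contB : Continuous (uncurry B)
  contk : Continuous fun q : ℝ × ℝ × ℝ => k q.1 q.2.1 q.2.2
  leA : ∀ s x, |A s x| ≤ C
  leB : ∀ s x, |B s x| ≤ C
  lek : ∀ s x σ, |k s x σ| ≤ C

lemma leftWave_sub {G G' : ℝ → ℝ → ℝ} (hG : Continuous (uncurry G)) (hG' : Continuous (uncurry G'))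
    (s x : ℝ) :
    leftWave (fun s x => G s x - G' s x) s x = leftWave G s x - leftWave G' s x := by
  unfold leftWave
  rw [intervalIntegral.integral_sub (Continuous.intervalIntegrable (by fun_prop) _ _)
    (Continuous.intervalIntegrable (by fun_prop) _ _)]
  ring

lemma rightWave_sub {L : ℝ} {h h' : ℝ → ℝ} {G G' : ℝ → ℝ → ℝ} (hG : Continuous (uncurry G))
    (hG' : Continuous (uncurry G')) (s x : ℝ) :
    rightWave L (fun s => h s - h' s) (fun s x => G s x - G' s x) s x =
      rightWave L h G s x - rightWave L h' G' s x := by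
  unfold rightWave
  rw [intervalIntegral.integral_sub (Continuous.intervalIntegrable (by fun_prop) _ _)
    (Continuous.intervalIntegrable (by fun_prop) _ _), leftWave_sub hG hG']
  ring

lemma waveMap_sub {C L : ℝ} {A B : ℝ → ℝ → ℝ} {k : ℝ → ℝ → ℝ → ℝ} {h h' : ℝ → ℝ}
    {G Q G' Q' : ℝ → ℝ → ℝ} (hc : IsWaveCoeff C A B k) (hG : Continuous (uncurry G))
    (hG' : Continuous (uncurry G')) (hQ : Continuous (uncurry Q)) (hQ' : Continuous (uncurry Q'))
    (s x : ℝ) :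
    waveMap L A B k (fun s => h s - h' s) (fun s x => G s x - G' s x)
      (fun s x => Q s x - Q' s x) s x = waveMap L A B k h G Q s x - waveMap L A B k h' G' Q' s x := by
  have hk : Continuous (k s x) := hc.contk.comp (by fun_prop : Continuous fun σ : ℝ => (s, x, σ))
  unfold waveMap
  rw [leftWave_sub hG hG', rightWave_sub hG hG']
  simp only [mul_sub]
  rw [intervalIntegral.integral_sub (Continuous.intervalIntegrable (by fun_prop) _ _)
    (Continuous.intervalIntegrable (by fun_prop) _ _)]
  ring

lemma waveMap_eq_zero_sub (L : ℝ) (A B : ℝ → ℝ → ℝ) (k : ℝ → ℝ → ℝ → ℝ) (h : ℝ → ℝ)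
    (G Q : ℝ → ℝ → ℝ) (s x : ℝ) :
    waveMap L A B k h G Q s x = waveMap L A B k (fun _ => 0) G Q s x - B s x * h s := by
  unfold waveMap rightWave
  ring

/-- `(G, Q)` is a solution, of at most exponential growth, of the integral equations along the
characteristics. -/
structure IsWaveSolution (L C : ℝ) (A₁ B₁ : ℝ → ℝ → ℝ) (k₁ : ℝ → ℝ → ℝ → ℝ) (A₂ B₂ : ℝ → ℝ → ℝ)
    (k₂ : ℝ → ℝ → ℝ → ℝ) (h : ℝ → ℝ) (G Q : ℝ → ℝ → ℝ) : Prop where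
  contG : Continuous (uncurry G)
  contQ : Continuous (uncurry Q)
  eqG : ∀ s x, G s x = waveMap L A₁ B₁ k₁ h G Q s x
  eqQ : ∀ s x, Q s x = waveMap L A₂ B₂ k₂ h G Q s x
  growth : ∃ m, 0 ≤ m ∧ ∀ s x, |G s x| ≤ m * waveWeight L C (fun _ => 0) 1 s x ∧
    |Q s x| ≤ m * waveWeight L C (fun _ => 0) 1 s x

variable {L C : ℝ} {A₁ B₁ A₂ B₂ : ℝ → ℝ → ℝ} {k₁ k₂ : ℝ → ℝ → ℝ → ℝ} {h h' : ℝ → ℝ}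
  {G Q G' Q' : ℝ → ℝ → ℝ}

lemma waveWeight_pos (hC : 0 < C) {η : ℝ → ℝ} (hη : ∀ s, 0 ≤ η s) {H : ℝ} (hH : 0 < H) (s x : ℝ) :
    0 < waveWeight L C η H s x :=
  mul_pos (add_pos_of_nonneg_of_pos (hη s) (by positivity)) (Real.exp_pos _)

lemma IsWaveSolution.sub (hc₁ : IsWaveCoeff C A₁ B₁ k₁) (hc₂ : IsWaveCoeff C A₂ B₂ k₂)
    (hs : IsWaveSolution L C A₁ B₁ k₁ A₂ B₂ k₂ h G Q)
    (hs' : IsWaveSolution L C A₁ B₁ k₁ A₂ B₂ k₂ h' G' Q') :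
    IsWaveSolution L C A₁ B₁ k₁ A₂ B₂ k₂ (fun s => h s - h' s) (fun s x => G s x - G' s x)
      (fun s x => Q s x - Q' s x) where
  contG := hs.contG.sub hs'.contG
  contQ := hs.contQ.sub hs'.contQ
  eqG s x := by
    rw [waveMap_sub hc₁ hs.contG hs'.contG hs.contQ hs'.contQ, ← hs.eqG, ← hs'.eqG]
  eqQ s x := by
    rw [waveMap_sub hc₂ hs.contG hs'.contG hs.contQ hs'.contQ, ← hs.eqQ, ← hs'.eqQ]
  growth := by
    obtain ⟨m, hm, h1⟩ := hs.growth
    obtain ⟨m', hm', h2⟩ := hs'.growth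
    refine ⟨m + m', by positivity, fun s x => ?_⟩
    rw [add_mul]
    exact ⟨(abs_sub _ _).trans (add_le_add (h1 s x).1 (h2 s x).1),
      (abs_sub _ _).trans (add_le_add (h1 s x).2 (h2 s x).2)⟩

/-- One use of the equations sends a bound `m` to m/2 + C, because |B h| is at most C times a weight
that dominates |h|. Iteration tends to the fixed point 2C. The field `growth` supplies a starting
bound, and H > 0 is what allows it to be compared with the new weight. -/
lemma IsWaveSolution.abs_le_aux (hC : 0 < C) (hc₁ : IsWaveCoeff C A₁ B₁ k₁)
    (hc₂ : IsWaveCoeff C A₂ B₂ k₂) (hs : IsWaveSolution L C A₁ B₁ k₁ A₂ B₂ k₂ h G Q)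
    (hh : Continuous h) {J : Set ℝ} (hJ : J.OrdConnected) (h0 : (0 : ℝ) ∈ J) {H : ℝ} (hH0 : 0 < H)
    (hH : ∀ s ∈ J, |(∫ σ in (0 : ℝ)..s, |h σ|)| ≤ H) :
    ∀ s ∈ J, ∀ x, |G s x| ≤ 2 * C * waveWeight L C (fun s => |h s|) H s x ∧
      |Q s x| ≤ 2 * C * waveWeight L C (fun s => |h s|) H s x := by
  obtain ⟨m, hm, hg⟩ := hs.growth
  have hpos : ∀ s x, 0 < waveWeight L C (fun s => |h s|) H s x := fun s x =>
    waveWeight_pos hC (fun _ => abs_nonneg _) hH0 s x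
  have hstep : ∀ n : ℕ, ∀ s ∈ J, ∀ x,
      |G s x| ≤ (2 * C + m / H * (1 / 2) ^ n) * waveWeight L C (fun s => |h s|) H s x ∧
      |Q s x| ≤ (2 * C + m / H * (1 / 2) ^ n) * waveWeight L C (fun s => |h s|) H s x := by
    intro n
    induction n with
    | zero =>
      intro s _ x
      have h1 : m * waveWeight L C (fun _ => 0) 1 s x ≤
          (2 * C + m / H * (1 / 2) ^ 0) * waveWeight L C (fun s => |h s|) H s x := by
        have : m * waveWeight L C (fun _ => 0) 1 s x ≤
            m / H * waveWeight L C (fun s => |h s|) H s x := by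
          rw [div_mul_eq_mul_div, le_div_iff₀ hH0, mul_assoc]
          gcongr
          unfold waveWeight
          rw [mul_right_comm]
          gcongr
          have := abs_nonneg (h s)
          linarith
        have h2 := mul_pos hC (hpos s x)
        rw [pow_zero, mul_one, add_mul]
        linarith
      exact ⟨(hg s x).1.trans h1, (hg s x).2.trans h1⟩
    | succ n ih =>
      have hm' : 0 ≤ 2 * C + m / H * (1 / 2) ^ n := by positivity
      have e : ∀ s x, (2 * C + m / H * (1 / 2) ^ n) / 2 * waveWeight L C (fun s => |h s|) H s x +
          C * waveWeight L C (fun s => |h s|) H s x =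
          (2 * C + m / H * (1 / 2) ^ (n + 1)) * waveWeight L C (fun s => |h s|) H s x := by
        intro s x; rw [pow_succ]; ring
      have hb : ∀ {B : ℝ → ℝ → ℝ}, (∀ s x, |B s x| ≤ C) → ∀ s x,
          |B s x * h s| ≤ C * waveWeight L C (fun s => |h s|) H s x := by
        intro B hB s x
        rw [abs_mul]
        gcongr
        · exact hB s x
        · have e1 : 1 ≤ Real.exp (8 * C * |x + s - L|) := Real.one_le_exp (by positivity)
          unfold waveWeight
          have e2 : 0 ≤ 16 * C * H * Real.exp (24 * C * |s|) := by positivity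
          have := abs_nonneg (h s)
          nlinarith
      intro s hsJ x
      have g1 := abs_waveMap_zero_le hC hh.abs (fun _ => abs_nonneg _) hH0.le hJ h0 hm' hH hc₁.leA
        hc₁.leB hc₁.lek (fun s hs x => (ih s hs x).1) (fun s hs x => (ih s hs x).2) s hsJ x
      have g2 := abs_waveMap_zero_le hC hh.abs (fun _ => abs_nonneg _) hH0.le hJ h0 hm' hH hc₂.leA
        hc₂.leB hc₂.lek (fun s hs x => (ih s hs x).1) (fun s hs x => (ih s hs x).2) s hsJ x
      rw [← e, hs.eqG, hs.eqQ, waveMap_eq_zero_sub, waveMap_eq_zero_sub L A₂]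
      exact ⟨(abs_sub _ _).trans (add_le_add g1 (hb hc₁.leB s x)),
        (abs_sub _ _).trans (add_le_add g2 (hb hc₂.leB s x))⟩
  intro s hsJ x
  have hlim : Tendsto (fun n : ℕ => (2 * C + m / H * (1 / 2) ^ n) *
      waveWeight L C (fun s => |h s|) H s x) atTop
      (𝓝 ((2 * C + m / H * 0) * waveWeight L C (fun s => |h s|) H s x)) :=
    (((tendsto_pow_atTop_nhds_zero_of_lt_one (by norm_num) (by norm_num)).const_mul _).const_add
      _).mul_const _
  rw [mul_zero, add_zero] at hlim
  exact ⟨ge_of_tendsto' hlim fun n => (hstep n s hsJ x).1,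
    ge_of_tendsto' hlim fun n => (hstep n s hsJ x).2⟩

/-- A priori estimate for the solutions of the equations along the characteristics. -/
lemma IsWaveSolution.abs_le (hC : 0 < C) (hc₁ : IsWaveCoeff C A₁ B₁ k₁)
    (hc₂ : IsWaveCoeff C A₂ B₂ k₂) (hs : IsWaveSolution L C A₁ B₁ k₁ A₂ B₂ k₂ h G Q)
    (hh : Continuous h) {J : Set ℝ} (hJ : J.OrdConnected) (h0 : (0 : ℝ) ∈ J) {H : ℝ} (hH0 : 0 ≤ H)
    (hH : ∀ s ∈ J, |(∫ σ in (0 : ℝ)..s, |h σ|)| ≤ H) :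
    ∀ s ∈ J, ∀ x, |G s x| ≤ 2 * C * waveWeight L C (fun s => |h s|) H s x ∧
      |Q s x| ≤ 2 * C * waveWeight L C (fun s => |h s|) H s x := by
  intro s hsJ x
  -- The weight is continuous in its parameter `H`, so H = 0 is reached as a limit. That case is
  -- needed ahead of the front.
  have hlim : Tendsto (fun ε : ℝ => 2 * C * waveWeight L C (fun s => |h s|) (H + ε) s x)
      (𝓝[>] 0) (𝓝 (2 * C * waveWeight L C (fun s => |h s|) (H + 0) s x)) := by
    have : Continuous fun ε : ℝ => 2 * C * waveWeight L C (fun s => |h s|) (H + ε) s x := by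
      unfold waveWeight; fun_prop
    exact this.continuousAt.mono_left nhdsWithin_le_nhds
  rw [add_zero] at hlim
  have hev : ∀ᶠ ε : ℝ in 𝓝[>] 0, |G s x| ≤ 2 * C * waveWeight L C (fun s => |h s|) (H + ε) s x ∧
      |Q s x| ≤ 2 * C * waveWeight L C (fun s => |h s|) (H + ε) s x := by
    filter_upwards [self_mem_nhdsWithin] with ε hε
    have hε' : 0 < ε := hε
    exact hs.abs_le_aux hC hc₁ hc₂ hh hJ h0 (by positivity)
      (fun s hs => (hH s hs).trans (by linarith)) s hsJ x
  exact ⟨ge_of_tendsto hlim (hev.mono fun _ h => h.1), ge_of_tendsto hlim (hev.mono fun _ h => h.2)⟩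

/-- Banach's fixed point theorem for the two unknowns divided by the weight, in the bounded
continuous functions on the plane; by `abs_waveMap_zero_le` the linear part has Lipschitz constant
1/2. -/
lemma exists_isWaveSolution (hC : 0 < C) (hc₁ : IsWaveCoeff C A₁ B₁ k₁)
    (hc₂ : IsWaveCoeff C A₂ B₂ k₂) (hh : Continuous h) {D : ℝ} (hD : ∀ s, |h s| ≤ D) :
    ∃ G Q, IsWaveSolution L C A₁ B₁ k₁ A₂ B₂ k₂ h G Q := by
  set ω : ℝ → ℝ → ℝ := waveWeight L C (fun _ => 0) 1 with hω
  have hpos : ∀ s x, 0 < ω s x := fun s x => waveWeight_pos hC (fun _ => le_rfl) one_pos s x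
  have hcω : Continuous (uncurry ω) := by
    simp only [hω, waveWeight, uncurry_def]; fun_prop
  have hD0 : 0 ≤ D := (abs_nonneg _).trans (hD 0)
  have hzero : ∀ {A B : ℝ → ℝ → ℝ} {k : ℝ → ℝ → ℝ → ℝ}, IsWaveCoeff C A B k →
      ∀ {m : ℝ}, 0 ≤ m → ∀ {G Q : ℝ → ℝ → ℝ}, (∀ s x, |G s x| ≤ m * ω s x) →
      (∀ s x, |Q s x| ≤ m * ω s x) → ∀ s x,
      |waveMap L A B k (fun _ => 0) G Q s x| ≤ m / 2 * ω s x := by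
    intro A B k hc m hm G Q hG hQ s x
    exact abs_waveMap_zero_le hC continuous_const (fun _ => le_rfl) zero_le_one ordConnected_univ
      (mem_univ _) hm (fun s _ => by simp) hc.leA hc.leB hc.lek (fun s _ x => hG s x)
      (fun s _ x => hQ s x) s (mem_univ _) x
  have hbound : ∀ {A B : ℝ → ℝ → ℝ} {k : ℝ → ℝ → ℝ → ℝ}, IsWaveCoeff C A B k →
      ∀ {m : ℝ}, 0 ≤ m → ∀ {G Q : ℝ → ℝ → ℝ}, (∀ s x, |G s x| ≤ m * ω s x) →
      (∀ s x, |Q s x| ≤ m * ω s x) → ∀ s x,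
      |waveMap L A B k h G Q s x| ≤ (m / 2 + D) * ω s x := by
    intro A B k hc m hm G Q hG hQ s x
    have e1 : 16 * C ≤ ω s x := by
      have h1 : 1 ≤ Real.exp (8 * C * |x + s - L|) := Real.one_le_exp (by positivity)
      have h2 : 1 ≤ Real.exp (24 * C * |s|) := Real.one_le_exp (by positivity)
      simp only [hω, waveWeight, zero_add, mul_one]
      calc 16 * C = 16 * C * 1 * 1 := by ring
        _ ≤ _ := by gcongr
    have e2 : |B s x * h s| ≤ D * ω s x := by
      rw [abs_mul, mul_comm]
      exact mul_le_mul (hD s) ((hc.leB s x).trans (by linarith)) (abs_nonneg _) hD0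
    rw [waveMap_eq_zero_sub, add_mul]
    exact (abs_sub _ _).trans (add_le_add (hzero hc hm hG hQ s x) e2)
  have hfield : ∀ u : ℝ × ℝ →ᵇ ℝ, Continuous (uncurry fun s x => ω s x * u (s, x)) := fun u => by
    fun_prop
  have hnorm : ∀ {m : ℝ} (u : ℝ × ℝ →ᵇ ℝ), ‖u‖ ≤ m → ∀ s x, |ω s x * u (s, x)| ≤ m * ω s x := by
    intro m u hu s x
    rw [abs_mul, abs_of_pos (hpos s x), mul_comm]
    have h1 := u.norm_coe_le_norm (s, x)
    exact mul_le_mul_of_nonneg_right (h1.trans hu) (hpos s x).le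
  let T : ∀ (A B : ℝ → ℝ → ℝ) (k : ℝ → ℝ → ℝ → ℝ), IsWaveCoeff C A B k →
      (ℝ × ℝ →ᵇ ℝ) × (ℝ × ℝ →ᵇ ℝ) → (ℝ × ℝ →ᵇ ℝ) := fun A B k hc u =>
    BoundedContinuousFunction.ofNormedAddCommGroup
      (fun q => (ω q.1 q.2)⁻¹ * waveMap L A B k h (fun s x => ω s x * u.1 (s, x))
        (fun s x => ω s x * u.2 (s, x)) q.1 q.2)
      (by
        have h1 := continuous_waveMap (L := L) hc.contA hc.contB hc.contk hh (hfield u.1)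
          (hfield u.2)
        exact (hcω.inv₀ fun q => (hpos q.1 q.2).ne').mul h1)
      (‖u‖ / 2 + D)
      (fun q => by
        have h1 := hbound hc (norm_nonneg u) (hnorm u.1 (norm_fst_le u)) (hnorm u.2 (norm_snd_le u))
          q.1 q.2
        rw [Real.norm_eq_abs, abs_mul, abs_of_pos (inv_pos.2 (hpos q.1 q.2)),
          inv_mul_le_iff₀ (hpos q.1 q.2)]
        linarith)
  have hTv : ∀ (A B : ℝ → ℝ → ℝ) (k : ℝ → ℝ → ℝ → ℝ) (hc : IsWaveCoeff C A B k)
      (u : (ℝ × ℝ →ᵇ ℝ) × (ℝ × ℝ →ᵇ ℝ)) (q : ℝ × ℝ), T A B k hc u q =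
      (ω q.1 q.2)⁻¹ * waveMap L A B k h (fun s x => ω s x * u.1 (s, x))
        (fun s x => ω s x * u.2 (s, x)) q.1 q.2 := fun _ _ _ _ _ _ => rfl
  have hT : ∀ (A B : ℝ → ℝ → ℝ) (k : ℝ → ℝ → ℝ → ℝ) (hc : IsWaveCoeff C A B k)
      (u v : (ℝ × ℝ →ᵇ ℝ) × (ℝ × ℝ →ᵇ ℝ)), dist (T A B k hc u) (T A B k hc v) ≤ 1 / 2 * dist u v := by
    intro A B k hc u v
    rw [BoundedContinuousFunction.dist_le (by positivity)]
    intro q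
    have h1 := hzero hc (norm_nonneg (u - v)) (hnorm (u - v).1 (norm_fst_le _))
      (hnorm (u - v).2 (norm_snd_le _)) q.1 q.2
    have h2 := waveMap_sub (L := L) (h := h) (h' := h) hc (hfield u.1) (hfield v.1) (hfield u.2)
      (hfield v.2) q.1 q.2
    simp only [sub_self, ← mul_sub] at h2
    simp only [Prod.fst_sub, Prod.snd_sub, BoundedContinuousFunction.sub_apply] at h1
    rw [h2] at h1
    rw [hTv A B k hc, hTv A B k hc, Real.dist_eq, ← mul_sub, abs_mul, abs_of_pos (inv_pos.2 (hpos q.1 q.2)),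
      inv_mul_le_iff₀ (hpos q.1 q.2), dist_eq_norm]
    linarith
  let F : (ℝ × ℝ →ᵇ ℝ) × (ℝ × ℝ →ᵇ ℝ) → (ℝ × ℝ →ᵇ ℝ) × (ℝ × ℝ →ᵇ ℝ) := fun u =>
    (T A₁ B₁ k₁ hc₁ u, T A₂ B₂ k₂ hc₂ u)
  have hF : ContractingWith (1 / 2) F := by
    refine ⟨by norm_num, LipschitzWith.of_dist_le_mul fun u v => ?_⟩
    rw [Prod.dist_eq]
    have e : ((1 / 2 : NNReal) : ℝ) = 1 / 2 := by norm_num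
    rw [e]
    exact max_le (hT A₁ B₁ k₁ hc₁ u v) (hT A₂ B₂ k₂ hc₂ u v)
  obtain ⟨u, hu⟩ : ∃ u, F u = u := ⟨_, hF.fixedPoint_isFixedPt⟩
  have e1 : ∀ s x, u.1 (s, x) = (ω s x)⁻¹ * waveMap L A₁ B₁ k₁ h (fun s x => ω s x * u.1 (s, x))
        (fun s x => ω s x * u.2 (s, x)) s x := fun s x => by
    conv_lhs => rw [← hu]
    rfl
  have e2 : ∀ s x, u.2 (s, x) = (ω s x)⁻¹ * waveMap L A₂ B₂ k₂ h (fun s x => ω s x * u.1 (s, x))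
        (fun s x => ω s x * u.2 (s, x)) s x := fun s x => by
    conv_lhs => rw [← hu]
    rfl
  refine ⟨fun s x => ω s x * u.1 (s, x), fun s x => ω s x * u.2 (s, x), hfield _, hfield _,
    fun s x => ?_, fun s x => ?_, ‖u‖, norm_nonneg _,
    fun s x => ⟨hnorm u.1 (norm_fst_le u) s x, hnorm u.2 (norm_snd_le u) s x⟩⟩
  · rw [e1 s x, mul_inv_cancel_left₀ (hpos s x).ne']
  · rw [e2 s x, mul_inv_cancel_left₀ (hpos s x).ne']

/-! ### Differential relations satisfied by the waves, integrated in time. -/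

lemma hasDerivAt_integral_left_limit {Φ Φ' : ℝ → ℝ → ℝ} (hΦ : Continuous (uncurry Φ))
    (hΦ' : Continuous (uncurry Φ')) (hd : ∀ x s, HasDerivAt (fun x => Φ x s) (Φ' x s) x)
    (τ x : ℝ) :
    HasDerivAt (fun x => ∫ s in x..τ, Φ x s) ((∫ s in x..τ, Φ' x s) - Φ x x) x := by
  have h := (hasDerivAt_integral_param_limit hΦ hΦ' hd (hasDerivAt_id x) τ).neg
  refine (h.congr_deriv ?_).congr_of_eventuallyEq (Eventually.of_forall fun y => ?_)
  · rw [intervalIntegral.integral_symm τ x]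
    simp only [id]; ring
  · simp only [Pi.neg_apply, id]
    rw [intervalIntegral.integral_symm]

section waves

variable {L : ℝ} {h : ℝ → ℝ} {G : ℝ → ℝ → ℝ}

lemma hasDerivAt_integral_limits {g : ℝ → ℝ} (hg : Continuous g) {a b : ℝ → ℝ} {a' b' x : ℝ}
    (ha : HasDerivAt a a' x) (hb : HasDerivAt b b' x) :
    HasDerivAt (fun x => ∫ t in a x..b x, g t) (g (b x) * b' - g (a x) * a') x := by
  have e : ∀ x, ∫ t in a x..b x, g t = (∫ t in (0 : ℝ)..b x, g t) - ∫ t in (0 : ℝ)..a x, g t :=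
    fun x => by
      rw [intervalIntegral.integral_interval_sub_left (hg.intervalIntegrable _ _)
        (hg.intervalIntegrable _ _)]
  simp_rw [e]
  exact ((hasDerivAt_integral_right hg 0 _).comp x hb).sub
    ((hasDerivAt_integral_right hg 0 _).comp x ha)

/-- This is r_θ + r_x = G integrated in θ = s + x from the front to τ. The waves need not be
differentiable in θ, but their time integrals are differentiable in x. -/
lemma hasDerivAt_integral_rightWave (hh : Continuous h) (hG : Continuous (uncurry G)) (τ x : ℝ) :
    HasDerivAt (fun x => ∫ σ in (0 : ℝ)..(τ - x), rightWave L h G σ x)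
      (-rightWave L h G (τ - x) x + ∫ σ in (0 : ℝ)..(τ - x), G σ x) x := by
  have hc := continuous_rightWave (L := L) hh hG
  have := hasDerivAt_integral_param_limit (Φ := fun x σ => rightWave L h G σ x)
    (Φ' := fun x σ => G σ x) (by fun_prop) (by fun_prop) (fun x s => ?_)
    ((hasDerivAt_id x).const_sub τ) 0
  · simpa using this
  · have h1 := hasDerivAt_integral_limits (g := G s) (by fun_prop) (hasDerivAt_id x)
      (hasDerivAt_const x (L - s))
    simp only [id] at h1
    have h2 := h1.const_sub (leftWave G s (L - s) - h s)
    refine h2.congr_deriv (by ring)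

/-- `G` is only continuous, so `leftWave` cannot be differentiated in x under the integral. In the
double integral x occurs only in the limits of integration. -/
lemma integral_leftWave (hG : Continuous (uncurry G)) (s x : ℝ) :
    ∫ σ in (0 : ℝ)..s, leftWave G σ x =
      ∫ σ in (0 : ℝ)..s, ∫ y in x..(x + (s - σ) / 2), G σ y := by
  have hder : ∀ s, HasDerivAt (fun s => ∫ σ in (0 : ℝ)..s, ∫ y in x..(x + (s - σ) / 2), G σ y)
      (leftWave G s x) s := by
    intro s
    have := hasDerivAt_integral_param_limit
      (Φ := fun s σ => ∫ y in x..(x + (s - σ) / 2), G σ y)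
      (Φ' := fun s σ => 1 / 2 * G σ (x + (s - σ) / 2))
      (continuous_integral_variable_limits (X := ℝ × ℝ) (f := fun q y => G q.2 y) (by fun_prop)
        (by fun_prop) (by fun_prop)) (by fun_prop) (fun s σ => ?_) (hasDerivAt_id s) 0
    · refine this.congr_deriv ?_
      simp [leftWave]
    · have h2 : HasDerivAt (fun s => x + (s - σ) / 2) (1 / 2) s :=
        (((hasDerivAt_id s).sub_const σ).div_const 2).const_add x
      refine (hasDerivAt_integral_limits (g := G σ) (by fun_prop) (hasDerivAt_const s x)
        h2).congr_deriv (by ring)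
  have hc : Continuous fun σ => leftWave G σ x :=
    (continuous_leftWave hG).comp (by fun_prop : Continuous fun σ : ℝ => (σ, x))
  rw [intervalIntegral.integral_eq_sub_of_hasDerivAt (fun s _ => hder s)
    (hc.intervalIntegrable _ _)]
  simp

lemma hasDerivAt_integral_leftWave (hG : Continuous (uncurry G)) (τ x : ℝ) :
    HasDerivAt (fun x => ∫ σ in (0 : ℝ)..(τ - x), leftWave G σ x)
      (leftWave G (τ - x) x - ∫ σ in (0 : ℝ)..(τ - x), G σ x) x := by
  simp_rw [integral_leftWave hG]
  have := hasDerivAt_integral_param_limit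
    (Φ := fun x σ => ∫ y in x..(x + (τ - x - σ) / 2), G σ y)
    (Φ' := fun x σ => 1 / 2 * G σ (x + (τ - x - σ) / 2) - G σ x)
    (continuous_integral_variable_limits (X := ℝ × ℝ) (f := fun q y => G q.2 y) (by fun_prop)
      (by fun_prop) (by fun_prop)) (by fun_prop) (fun x σ => ?_)
      ((hasDerivAt_id x).const_sub τ) 0
  · refine this.congr_deriv ?_
    rw [intervalIntegral.integral_sub (Continuous.intervalIntegrable (by fun_prop) _ _)
      (Continuous.intervalIntegrable (by fun_prop) _ _)]
    simp [leftWave]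
  · have h2 : HasDerivAt (fun x => x + (τ - x - σ) / 2) (1 / 2) x :=
      ((hasDerivAt_id x).add ((((hasDerivAt_id x).const_sub τ).sub_const σ).div_const
        2)).congr_deriv (by norm_num)
    refine (hasDerivAt_integral_limits (g := G σ) (by fun_prop) (hasDerivAt_id x)
      h2).congr_deriv (by simp only [id]; ring)

end waves

/-- Differentiation in space of the weighted integrals in time of a wave. -/
lemma hasDerivAt_integral_weight_mul {y p G Q : ℝ → ℝ → ℝ} (hy : Continuous (uncurry y))
    (hp : Continuous (uncurry p)) (hGc : Continuous (uncurry G)) (hQc : Continuous (uncurry Q))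
    (hD : ∀ τ x, HasDerivAt (fun x => ∫ θ in x..τ, y θ x) (p τ x - ∫ θ in x..τ, G θ x) x)
    {ρ ρ₁ : ℝ → ℝ → ℝ} (hρ : Continuous (uncurry ρ)) (hρ₁ : Continuous (uncurry ρ₁))
    (hρd : ∀ τ σ, HasDerivAt (fun τ => ρ τ σ) (ρ₁ τ σ) τ) {β x τ : ℝ}
    (hG : ∀ θ ∈ uIcc x τ,
      G θ x = -β * y θ x - ρ θ θ * Q θ x - ∫ σ in x..θ, ρ₁ θ σ * Q σ x)
    (hQ : ∀ θ ∈ uIcc x τ, Q θ x = p θ x + ∫ σ in x..θ, ρ θ σ * Q σ x)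
    {ν ν' : ℝ → ℝ} (hν'c : Continuous ν') (hν : ∀ θ, HasDerivAt ν (ν' θ) θ) {a : ℝ}
    (ha : ν τ = a) (hν' : ∀ θ, ν' θ = a * ρ τ θ) :
    HasDerivAt (fun x => ∫ θ in x..τ, ν θ * y θ x)
      (β * (∫ θ in x..τ, ν θ * y θ x) + a * p τ x) x := by
  have hνc : Continuous ν := continuous_iff_continuousAt.2 fun θ => (hν θ).continuousAt
  set Y : ℝ → ℝ → ℝ := fun θ x => ∫ σ in x..θ, y σ x
  have hYc : Continuous (uncurry Y) :=
    continuous_integral_variable_limits (X := ℝ × ℝ) (f := fun q σ => y σ q.2) (by fun_prop)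
      (by fun_prop) (by fun_prop)
  have hDc : Continuous (uncurry fun τ x => p τ x - ∫ θ in x..τ, G θ x) :=
    hp.sub (continuous_integral_variable_limits (X := ℝ × ℝ) (f := fun q θ => G θ q.2)
      (by fun_prop) (by fun_prop) (by fun_prop))
  have hYd : ∀ x θ, HasDerivAt (fun θ => Y θ x) (y θ x) θ := fun x θ =>
    hasDerivAt_integral_right (g := fun σ => y σ x) (by fun_prop) x θ
  -- Integration by parts moves the weight off `y` onto its time integral `Y`, which is
  -- differentiable in x.
  have hparts : ∀ x, ∫ θ in x..τ, ν θ * y θ x = a * Y τ x - ∫ θ in x..τ, ν' θ * Y θ x := by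
    intro x
    rw [intervalIntegral.integral_mul_deriv_eq_deriv_mul (fun θ _ => hν θ) (fun θ _ => hYd x θ)
      (hν'c.intervalIntegrable _ _) (Continuous.intervalIntegrable (by fun_prop) _ _), ha]
    simp [Y]
  -- The relation for `G` reads G = -βy - ∂_θ ∫ρQ. Hence the x-derivative of `Y` given by `hD`
  -- becomes Q + βY, formally y_x - βy = Q_θ.
  have hval : ∀ θ ∈ uIcc x τ, p θ x - ∫ σ in x..θ, G σ x = Q θ x + β * Y θ x := by
    intro θ hθ
    have hsub : uIcc x θ ⊆ uIcc x τ := uIcc_subset_uIcc_left hθ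
    have h1 : ∫ σ in x..θ, G σ x = ∫ σ in x..θ, (-β * y σ x -
        (ρ σ σ * Q σ x + ∫ σ' in x..σ, ρ₁ σ σ' * Q σ' x)) :=
      intervalIntegral.integral_congr fun σ hσ => by simp only [hG σ (hsub hσ)]; ring
    have hc1 : Continuous fun σ => ρ σ σ * Q σ x + ∫ σ' in x..σ, ρ₁ σ σ' * Q σ' x := by fun_prop
    have hder : ∀ τ, HasDerivAt (fun τ => ∫ σ in x..τ, ρ τ σ * Q σ x)
        (ρ τ τ * Q τ x + ∫ σ' in x..τ, ρ₁ τ σ' * Q σ' x) τ := by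
      intro τ
      have := hasDerivAt_integral_param_limit (Φ := fun τ σ => ρ τ σ * Q σ x)
        (Φ' := fun τ σ => ρ₁ τ σ * Q σ x) (by fun_prop) (by fun_prop)
        (fun τ σ => (hρd τ σ).mul_const _) (hasDerivAt_id τ) x
      simpa using this
    rw [h1, intervalIntegral.integral_sub (Continuous.intervalIntegrable (by fun_prop) _ _)
      (hc1.intervalIntegrable _ _), intervalIntegral.integral_const_mul,
      intervalIntegral.integral_eq_sub_of_hasDerivAt (fun τ _ => hder τ)
        (hc1.intervalIntegrable _ _), hQ θ hθ]
    simp only [intervalIntegral.integral_same, Y]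
    ring
  simp_rw [hparts]
  have h1 := (hD τ x).const_mul a
  have h2 := hasDerivAt_integral_left_limit (Φ := fun x θ => ν' θ * Y θ x)
    (Φ' := fun x θ => ν' θ * (p θ x - ∫ σ in x..θ, G σ x)) (by fun_prop)
    ((hν'c.comp continuous_snd).mul (hDc.comp continuous_swap))
    (fun x θ => (hD θ x).const_mul _) τ x
  refine (h1.sub h2).congr_deriv ?_
  have h3 : ∫ θ in x..τ, ν' θ * (p θ x - ∫ σ in x..θ, G σ x) =
      ∫ θ in x..τ, (a * (ρ τ θ * Q θ x) + β * (ν' θ * Y θ x)) :=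
    intervalIntegral.integral_congr fun θ hθ => by
      simp only [hval θ hθ]
      rw [mul_add, hν' θ]
      ring
  -- Since ν' = aρ, the terms in `Q` add up to a(Q - ∫ρQ), and the Volterra relation identifies this
  -- with a p.
  have h4 : p τ x = Q τ x - ∫ σ in x..τ, ρ τ σ * Q σ x := by
    rw [hQ τ right_mem_uIcc]; ring
  rw [h3, hval τ right_mem_uIcc, intervalIntegral.integral_add
    (Continuous.intervalIntegrable (by fun_prop) _ _)
    (Continuous.intervalIntegrable (by fun_prop) _ _), intervalIntegral.integral_const_mul,
    intervalIntegral.integral_const_mul, h4]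
  simp only [Y, intervalIntegral.integral_same]
  ring

/-! ### Absolutely continuous functions, L² pairings and the operator A. -/

/-- `f` is absolutely continuous on `[0, L]` with derivative `f'`. -/
structure IsPrimOn (L : ℝ) (f f' : ℝ → ℝ) : Prop where
  integrable : IntervalIntegrable f' volume 0 L
  eq_integral : ∀ x ∈ Icc 0 L, f x = f 0 + ∫ y in (0 : ℝ)..x, f' y

namespace IsPrimOn

variable {L : ℝ} {f f' g g' : ℝ → ℝ}

lemma integrable_of_mem (hf : IsPrimOn L f f') {x : ℝ} (hx : x ∈ Icc 0 L) :
    IntervalIntegrable f' volume 0 x :=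
  hf.integrable.mono_set (by
    rw [uIcc_of_le hx.1, uIcc_of_le (hx.1.trans hx.2)]; exact Icc_subset_Icc_right hx.2)

lemma mono (hf : IsPrimOn L f f') {x : ℝ} (hx : x ∈ Icc 0 L) : IsPrimOn x f f' :=
  ⟨hf.integrable_of_mem hx, fun y hy => hf.eq_integral y ⟨hy.1, hy.2.trans hx.2⟩⟩

lemma absolutelyContinuous (hf : IsPrimOn L f f') :
    AbsolutelyContinuousOnInterval (fun x => f 0 + ∫ y in (0 : ℝ)..x, f' y) 0 L := by
  have h1 := hf.integrable.absolutelyContinuousOnInterval_intervalIntegral (c := 0) left_mem_uIcc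
  have h0 : AbsolutelyContinuousOnInterval (fun _ : ℝ => f 0) 0 L :=
    ((LipschitzWith.const (f 0)).lipschitzOnWith (s := uIcc 0 L)).absolutelyContinuousOnInterval
  exact h0.add h1

lemma continuousOn (hL : 0 ≤ L) (hf : IsPrimOn L f f') : ContinuousOn f (Icc 0 L) := by
  have := hf.absolutelyContinuous.continuousOn
  rw [uIcc_of_le hL] at this
  exact this.congr hf.eq_integral

lemma ae_deriv (hf : IsPrimOn L f f') :
    ∀ᵐ x, x ∈ uIoc 0 L → deriv (fun x => f 0 + ∫ y in (0 : ℝ)..x, f' y) x = f' x := by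
  filter_upwards [hf.integrable.ae_hasDerivAt_integral] with x hx hxL
  exact ((hx (uIoc_subset_uIcc hxL) 0 left_mem_uIcc).const_add (f 0)).deriv

/-- Integration by parts. -/
lemma integral_add_eq (hL : 0 ≤ L) (hf : IsPrimOn L f f') (hg : IsPrimOn L g g') :
    ∫ x in (0 : ℝ)..L, (f' x * g x + f x * g' x) = f L * g L - f 0 * g 0 := by
  have h := hf.absolutelyContinuous.integral_deriv_mul_eq_sub hg.absolutelyContinuous
  simp only [← hf.eq_integral L ⟨hL, le_rfl⟩, ← hg.eq_integral L ⟨hL, le_rfl⟩,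
    intervalIntegral.integral_same, add_zero] at h
  rw [← h]
  refine intervalIntegral.integral_congr_ae ?_
  filter_upwards [hf.ae_deriv, hg.ae_deriv] with x hx1 hx2 hx
  have hxL : x ∈ Icc 0 L := by
    rw [uIoc_of_le hL] at hx
    exact ⟨hx.1.le, hx.2⟩
  rw [hx1 hx, hx2 hx, ← hf.eq_integral x hxL, ← hg.eq_integral x hxL]

lemma integrable_mul_continuousOn (hL : 0 ≤ L) (hf : IntervalIntegrable f volume 0 L)
    (hg : ContinuousOn g (Icc 0 L)) : IntervalIntegrable (fun x => f x * g x) volume 0 L :=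
  hf.mul_continuousOn (by rwa [uIcc_of_le hL])

lemma integrable_continuousOn_mul (hL : 0 ≤ L) (hf : IntervalIntegrable f volume 0 L)
    (hg : ContinuousOn g (Icc 0 L)) : IntervalIntegrable (fun x => g x * f x) volume 0 L :=
  hf.continuousOn_mul (by rwa [uIcc_of_le hL])

lemma integral_deriv_mul (hL : 0 ≤ L) (hf : IsPrimOn L f f') (hg : IsPrimOn L g g') :
    ∫ x in (0 : ℝ)..L, f' x * g x = f L * g L - f 0 * g 0 - ∫ x in (0 : ℝ)..L, f x * g' x := by
  rw [← hf.integral_add_eq hL hg, intervalIntegral.integral_add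
    (integrable_mul_continuousOn hL hf.integrable (hg.continuousOn hL))
    (integrable_continuousOn_mul hL hg.integrable (hf.continuousOn hL))]
  ring

lemma mul (hL : 0 ≤ L) (hf : IsPrimOn L f f') (hg : IsPrimOn L g g') :
    IsPrimOn L (fun x => f x * g x) (fun x => f' x * g x + f x * g' x) :=
  ⟨(integrable_mul_continuousOn hL hf.integrable (hg.continuousOn hL)).add
    (integrable_continuousOn_mul hL hg.integrable (hf.continuousOn hL)), fun x hx => by
    rw [(hf.mono hx).integral_add_eq hx.1 (hg.mono hx)]; ring⟩

lemma of_contDiffOn (hL : 0 < L) (hf : ContDiffOn ℝ 1 f (Icc 0 L)) :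
    IsPrimOn L f (derivWithin f (Icc 0 L)) := by
  have hd : ContinuousOn (derivWithin f (Icc 0 L)) (Icc 0 L) :=
    hf.continuousOn_derivWithin (uniqueDiffOn_Icc hL) le_rfl
  have hint : ∀ x ∈ Icc 0 L, IntervalIntegrable (derivWithin f (Icc 0 L)) volume 0 x :=
    fun x hx => ContinuousOn.intervalIntegrable_of_Icc hx.1 (hd.mono (Icc_subset_Icc_right hx.2))
  refine ⟨hint L ⟨hL.le, le_rfl⟩, fun x hx => ?_⟩
  rw [intervalIntegral.integral_eq_sub_of_hasDerivAt_of_le hx.1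
    (hf.continuousOn.mono (Icc_subset_Icc_right hx.2)) (fun y hy => ?_) (hint x hx)]
  · ring
  · exact ((hf.differentiableOn one_ne_zero y
      ⟨hy.1.le, hy.2.le.trans hx.2⟩).hasDerivWithinAt).hasDerivAt
      (Icc_mem_nhds hy.1 (hy.2.trans_le hx.2))

end IsPrimOn

lemma memLp_continuousOn_mul {L : ℝ} {f g : ℝ → ℝ} (hg : ContinuousOn g (Icc 0 L))
    (hf : MemLp f 2 (volume.restrict (Ioo 0 L))) :
    MemLp (fun x => g x * f x) 2 (volume.restrict (Ioo 0 L)) := by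
  obtain ⟨C, hC⟩ := isCompact_Icc.exists_bound_of_continuousOn hg
  refine hf.of_le_mul (c := C) ?_ ?_
  · exact ((hg.mono Ioo_subset_Icc_self).aestronglyMeasurable measurableSet_Ioo).mul
      hf.aestronglyMeasurable
  · filter_upwards [ae_restrict_mem measurableSet_Ioo] with x hx
    rw [norm_mul]
    gcongr
    exact hC x (Ioo_subset_Icc_self hx)

lemma memLp_of_continuousOn {L : ℝ} {g : ℝ → ℝ} (hg : ContinuousOn g (Icc 0 L)) :
    MemLp g 2 (volume.restrict (Ioo 0 L)) := by
  simpa using memLp_continuousOn_mul hg (memLp_const (1 : ℝ))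

lemma MeasureTheory.MemLp.intervalIntegrable_zero {L : ℝ} (hL : 0 ≤ L) {f : ℝ → ℝ}
    (hf : MemLp f 2 (volume.restrict (Ioo 0 L))) : IntervalIntegrable f volume 0 L := by
  rw [intervalIntegrable_iff_integrableOn_Ioo_of_le hL]
  exact hf.integrable (by norm_num)

lemma integral_congr_ae_Ioo {L : ℝ} (hL : 0 ≤ L) {f g : ℝ → ℝ}
    (h : f =ᵐ[volume.restrict (Ioo 0 L)] g) : ∫ x in (0 : ℝ)..L, f x = ∫ x in (0 : ℝ)..L, g x := by
  rw [intervalIntegral.integral_of_le hL, intervalIntegral.integral_of_le hL,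
    integral_Ioc_eq_integral_Ioo, integral_Ioc_eq_integral_Ioo]
  exact integral_congr_ae h

lemma integral_mul_eq_inner {L : ℝ} (hL : 0 ≤ L) (f : L2Interval L) {φ : ℝ → ℝ}
    (hφ : MemLp φ 2 (volume.restrict (Ioo 0 L))) :
    ∫ ξ in (0 : ℝ)..L, f ξ * φ ξ = inner ℝ f hφ.toLp := by
  rw [L2.inner_def, intervalIntegral.integral_of_le hL, integral_Ioc_eq_integral_Ioo]
  refine integral_congr_ae ?_
  filter_upwards [hφ.coeFn_toLp] with x hx
  rw [hx]
  simp [mul_comm]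

namespace IsDomA

variable {c φ φ₁ φ₂ ψ ψ₁ ψ₂ : ℝ → ℝ}

lemma isPrimOn₁ (h : IsDomA φ φ₁ φ₂) : IsPrimOn Real.pi φ₁ φ₂ :=
  ⟨h.isW22On.memLp.intervalIntegrable_zero Real.pi_pos.le, h.isW22On.deriv_eq_integral⟩

lemma continuousOn₁ (h : IsDomA φ φ₁ φ₂) : ContinuousOn φ₁ (Icc 0 Real.pi) :=
  h.isPrimOn₁.continuousOn Real.pi_pos.le

lemma isPrimOn (h : IsDomA φ φ₁ φ₂) : IsPrimOn Real.pi φ φ₁ :=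
  ⟨ContinuousOn.intervalIntegrable_of_Icc Real.pi_pos.le h.continuousOn₁, h.isW22On.eq_integral⟩

lemma continuousOn (h : IsDomA φ φ₁ φ₂) : ContinuousOn φ (Icc 0 Real.pi) :=
  h.isPrimOn.continuousOn Real.pi_pos.le

lemma isPrimOn_flux (hc : ContDiffOn ℝ 1 c (Icc 0 Real.pi)) (h : IsDomA φ φ₁ φ₂) :
    IsPrimOn Real.pi (fun ξ => c ξ * φ₁ ξ) (opA c φ₁ φ₂) :=
  (IsPrimOn.of_contDiffOn Real.pi_pos hc).mul Real.pi_pos.le h.isPrimOn₁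

lemma memLp (h : IsDomA φ φ₁ φ₂) : MemLp φ 2 (volume.restrict (Ioo 0 Real.pi)) :=
  memLp_of_continuousOn h.continuousOn

lemma memLp_opA (hc : ContDiffOn ℝ 1 c (Icc 0 Real.pi)) (h : IsDomA φ φ₁ φ₂) :
    MemLp (opA c φ₁ φ₂) 2 (volume.restrict (Ioo 0 Real.pi)) :=
  (memLp_of_continuousOn ((hc.continuousOn_derivWithin (uniqueDiffOn_Icc Real.pi_pos)
    le_rfl).mul h.continuousOn₁)).add (memLp_continuousOn_mul hc.continuousOn h.isW22On.memLp)

/-- Green's identity. -/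
lemma integral_opA_mul (hc : ContDiffOn ℝ 1 c (Icc 0 Real.pi)) (hφ : IsDomA φ φ₁ φ₂)
    (hψ : IsDomA ψ ψ₁ ψ₂) :
    ∫ ξ in (0 : ℝ)..Real.pi, opA c φ₁ φ₂ ξ * ψ ξ = ∫ ξ in (0 : ℝ)..Real.pi, φ ξ * opA c ψ₁ ψ₂ ξ := by
  have h1 := (hφ.isPrimOn_flux hc).integral_deriv_mul Real.pi_pos.le hψ.isPrimOn
  have h2 := (hψ.isPrimOn_flux hc).integral_deriv_mul Real.pi_pos.le hφ.isPrimOn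
  simp only [hφ.left, hφ.right, hψ.left, hψ.right, mul_zero, sub_zero, zero_sub] at h1 h2
  rw [h1]
  simp_rw [mul_comm (φ _)]
  rw [h2]
  congr 1
  exact intervalIntegral.integral_congr fun ξ _ => by ring

end IsDomA

/-- Solvability of `Aφ = -ψ`. -/
lemma exists_isDomA_opA_eq {c : ℝ → ℝ} (hc : ContDiffOn ℝ 1 c (Icc 0 Real.pi))
    (hcpos : ∀ ξ ∈ Icc 0 Real.pi, 0 < c ξ) {ψ : ℝ → ℝ}
    (hψ : MemLp ψ 2 (volume.restrict (Ioo 0 Real.pi))) :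
    ∃ φ φ₁ φ₂, IsDomA φ φ₁ φ₂ ∧ ∀ ξ ∈ Icc 0 Real.pi, opA c φ₁ φ₂ ξ = -ψ ξ := by
  have hπ := Real.pi_pos.le
  have hinv : ContDiffOn ℝ 1 (fun ξ => (c ξ)⁻¹) (Icc 0 Real.pi) :=
    hc.inv fun ξ hξ => (hcpos ξ hξ).ne'
  have hci : IntervalIntegrable (fun ξ => (c ξ)⁻¹) volume 0 Real.pi :=
    ContinuousOn.intervalIntegrable_of_Icc hπ hinv.continuousOn
  have hpos : 0 < ∫ ξ in (0 : ℝ)..Real.pi, (c ξ)⁻¹ :=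
    intervalIntegral.intervalIntegral_pos_of_pos_on hci
      (fun ξ hξ => inv_pos.2 (hcpos ξ (Ioo_subset_Icc_self hξ))) Real.pi_pos
  set I : ℝ → ℝ := fun ξ => ∫ y in (0 : ℝ)..ξ, ψ y
  -- `κ` is the value of cφ' at 0; it is determined by φ(π) = 0.
  set κ := (∫ ξ in (0 : ℝ)..Real.pi, I ξ * (c ξ)⁻¹) / ∫ ξ in (0 : ℝ)..Real.pi, (c ξ)⁻¹ with hκ
  have hψi := hψ.intervalIntegrable_zero hπ
  have hq : IsPrimOn Real.pi (fun ξ => κ - I ξ) (fun ξ => -ψ ξ) :=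
    ⟨hψi.neg, fun x _ => by simp [I, sub_eq_add_neg]⟩
  have hqc := hq.continuousOn hπ
  have hIc : ContinuousOn I (Icc 0 Real.pi) := by
    refine (continuousOn_const (c := κ)).sub hqc |>.congr fun x _ => by simp
  have hI := IsPrimOn.of_contDiffOn Real.pi_pos hinv
  have hφ₁ := hq.mul hπ hI
  have hφ₁c := hφ₁.continuousOn hπ
  have hdinv : ∀ ξ ∈ Icc 0 Real.pi, derivWithin (fun ξ => (c ξ)⁻¹) (Icc 0 Real.pi) ξ =
      -derivWithin c (Icc 0 Real.pi) ξ / c ξ ^ 2 := fun ξ hξ =>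
    ((hc.differentiableOn one_ne_zero ξ hξ).hasDerivWithinAt.fun_inv (hcpos ξ hξ).ne').derivWithin
      (uniqueDiffOn_Icc Real.pi_pos ξ hξ)
  refine ⟨fun ξ => ∫ y in (0 : ℝ)..ξ, (κ - I y) * (c y)⁻¹, fun ξ => (κ - I ξ) * (c ξ)⁻¹,
    fun ξ => -ψ ξ * (c ξ)⁻¹ + (κ - I ξ) * derivWithin (fun ξ => (c ξ)⁻¹) (Icc 0 Real.pi) ξ,
    ⟨⟨fun x _ => by simp, hφ₁.eq_integral, ?_⟩, by simp, ?_⟩, fun ξ hξ => ?_⟩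
  · refine MemLp.add ?_ (memLp_of_continuousOn (hqc.mul
      (hinv.continuousOn_derivWithin (uniqueDiffOn_Icc Real.pi_pos) le_rfl)))
    have := memLp_continuousOn_mul hinv.continuousOn hψ.neg
    exact this.congr_norm (by
      exact (hψ.aestronglyMeasurable.neg.mul ((hinv.continuousOn.mono
        Ioo_subset_Icc_self).aestronglyMeasurable measurableSet_Ioo)))
      (Eventually.of_forall fun x => by simp [mul_comm])
  · simp only [sub_mul]
    have hIi : IntervalIntegrable (fun ξ => I ξ * (c ξ)⁻¹) volume 0 Real.pi :=
      ContinuousOn.intervalIntegrable_of_Icc hπ (hIc.mul hinv.continuousOn)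
    rw [intervalIntegral.integral_sub (hci.const_mul κ) hIi,
      intervalIntegral.integral_const_mul, hκ, div_mul_cancel₀ _ hpos.ne', sub_self]
  · have hne := (hcpos ξ hξ).ne'
    simp only [opA, hdinv ξ hξ]
    field_simp
    ring

/-! ### Uniqueness of weak solutions. -/

/-- A log-convex sequence with factorial decay vanishes. -/
lemma eq_zero_of_logConvex_of_le_factorial {a : ℕ → ℝ} (h0 : ∀ n, 0 ≤ a n)
    (hconv : ∀ n, a (n + 1) ^ 2 ≤ a n * a (n + 2)) {A B : ℝ}
    (hle : ∀ n, a n ≤ A * B ^ n / n.factorial) : a 1 = 0 := by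
  by_contra hne
  have h1 : 0 < a 1 := lt_of_le_of_ne (h0 1) (Ne.symm hne)
  have ha0 : 0 < a 0 := by
    refine lt_of_le_of_ne (h0 0) fun h => ?_
    have := hconv 0
    rw [← h, zero_mul] at this
    have : 0 < a 1 ^ 2 := by positivity
    simp only [zero_add] at *
    linarith
  -- By log-convexity the successive ratios never fall below the first one, `q` > 0, so the sequence
  -- dominates a geometric one. This is incompatible with factorial decay.
  set q := a 1 / a 0
  have hq : 0 < q := div_pos h1 ha0
  have hstep : ∀ n, 0 < a n ∧ q * a n ≤ a (n + 1) := by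
    intro n
    induction n with
    | zero => exact ⟨ha0, by simp [q, div_mul_cancel₀ _ ha0.ne']⟩
    | succ n ih =>
      obtain ⟨hn, hqn⟩ := ih
      have hn1 : 0 < a (n + 1) := lt_of_lt_of_le (by positivity) hqn
      refine ⟨hn1, ?_⟩
      have := hconv n
      have h3 : q * a (n + 1) * a n ≤ a (n + 1 + 1) * a n := by
        calc q * a (n + 1) * a n = a (n + 1) * (q * a n) := by ring
          _ ≤ a (n + 1) * a (n + 1) := by gcongr
          _ ≤ _ := by rw [← sq, mul_comm (a (n + 1 + 1))]; exact this
      exact le_of_mul_le_mul_right h3 hn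
  have hpow : ∀ n, q ^ n * a 0 ≤ a n := by
    intro n
    induction n with
    | zero => simp
    | succ n ih =>
      calc q ^ (n + 1) * a 0 = q * (q ^ n * a 0) := by ring
        _ ≤ q * a n := by gcongr
        _ ≤ _ := (hstep n).2
  have hlim : Tendsto (fun n : ℕ => A * ((B / q) ^ n / n.factorial)) atTop (𝓝 (A * 0)) :=
    (FloorSemiring.tendsto_pow_div_factorial_atTop (B / q)).const_mul A
  rw [mul_zero] at hlim
  have : a 0 ≤ 0 := by
    refine ge_of_tendsto' hlim fun n => ?_
    have h4 := (hpow n).trans (hle n)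
    rw [div_pow, div_div, mul_comm (q ^ n), ← div_div]
    have hqn : 0 < q ^ n := by positivity
    rw [← mul_div_assoc, ← mul_div_assoc]
    rw [le_div_iff₀ hqn]
    linarith
  linarith

section uniqueness

variable {c P M u : ℝ → ℝ} {T : ℝ} {w w' : ℝ → L2Interval Real.pi}

/-- An iterated sequence of solutions of `A z (n+1) = -z n`. -/
lemma exists_chain (hc : ContDiffOn ℝ 1 c (Icc 0 Real.pi)) (hcpos : ∀ ξ ∈ Icc 0 Real.pi, 0 < c ξ)
    {ψ : ℝ → ℝ} (hψ : MemLp ψ 2 (volume.restrict (Ioo 0 Real.pi))) :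
    ∃ z z₁ z₂ : ℕ → ℝ → ℝ, z 0 = ψ ∧ (∀ n, MemLp (z n) 2 (volume.restrict (Ioo 0 Real.pi))) ∧
      (∀ n, IsDomA (z (n + 1)) (z₁ (n + 1)) (z₂ (n + 1))) ∧
      ∀ n, ∀ ξ ∈ Icc 0 Real.pi, opA c (z₁ (n + 1)) (z₂ (n + 1)) ξ = -z n ξ := by
  choose F F₁ F₂ hF hA using fun ψ : {ψ : ℝ → ℝ // MemLp ψ 2 (volume.restrict (Ioo 0 Real.pi))} =>
    exists_isDomA_opA_eq hc hcpos ψ.2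
  let S : ℕ → {ψ : ℝ → ℝ // MemLp ψ 2 (volume.restrict (Ioo 0 Real.pi))} := fun n =>
    (fun ψ => ⟨F ψ, (hF ψ).memLp⟩)^[n] ⟨ψ, hψ⟩
  have hS : ∀ n, (S (n + 1)).1 = F (S n) := fun n => by
    simp only [S, Function.iterate_succ_apply']
  -- The function with index n + 1 is built from `S n`, so its derivatives carry the index shift n -
  -- 1; their value at n = 0 is never used.
  refine ⟨fun n => (S n).1, fun n => F₁ (S (n - 1)), fun n => F₂ (S (n - 1)), rfl, fun n => (S n).2,
    fun n => ?_, fun n => ?_⟩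
  · simp only [hS, Nat.add_sub_cancel]; exact hF (S n)
  · simp only [Nat.add_sub_cancel]; exact hA (S n)

lemma abs_integral_mul_le {f : L2Interval Real.pi} {φ : ℝ → ℝ}
    (hφ : MemLp φ 2 (volume.restrict (Ioo 0 Real.pi))) :
    |∫ ξ in (0 : ℝ)..Real.pi, f ξ * φ ξ| ≤ ‖f‖ * ‖hφ.toLp‖ := by
  rw [integral_mul_eq_inner Real.pi_pos.le f hφ]
  exact abs_real_inner_le_norm _ _

lemma continuousOn_integral_mul {d : ℝ → L2Interval Real.pi} {s : Set ℝ} (hd : ContinuousOn d s)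
    {φ : ℝ → ℝ} (hφ : MemLp φ 2 (volume.restrict (Ioo 0 Real.pi))) :
    ContinuousOn (fun t => ∫ ξ in (0 : ℝ)..Real.pi, d t ξ * φ ξ) s := by
  simp_rw [integral_mul_eq_inner Real.pi_pos.le _ hφ]
  exact hd.inner continuousOn_const

lemma continuousOn_kernel {N : ℝ → ℝ} (hN : ContinuousOn N (Icc 0 T))
    (hP : ContinuousOn P (Icc 0 T)) {t : ℝ} (ht : t ∈ Icc 0 T) :
    ContinuousOn (fun s => N (t - s) * P s) (Icc 0 t) :=
  (hN.comp (by fun_prop) fun s hs => ⟨by linarith [hs.2], by linarith [hs.1, ht.2]⟩).mul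
    (hP.mono (Icc_subset_Icc_right ht.2))

/-- A solution of the homogeneous weak equation vanishes. -/
lemma eq_zero_of_homogeneous_weak (hc : ContDiffOn ℝ 1 c (Icc 0 Real.pi))
    (hcpos : ∀ ξ ∈ Icc 0 Real.pi, 0 < c ξ) {N : ℝ → ℝ} (hN : ContinuousOn N (Icc 0 T))
    (hP : ContinuousOn P (Icc 0 T)) {d : ℝ → L2Interval Real.pi} (hd : ContinuousOn d (Icc 0 T))
    (hd0 : d 0 = 0)
    (hweak : ∀ φ φ₁ φ₂ : ℝ → ℝ, IsDomA φ φ₁ φ₂ → ∀ t ∈ Icc 0 T,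
      HasDerivWithinAt (fun τ => ∫ ξ in (0 : ℝ)..Real.pi, d τ ξ * φ ξ)
        (∫ s in (0 : ℝ)..t, N (t - s) * P s * ∫ ξ in (0 : ℝ)..Real.pi, d s ξ * opA c φ₁ φ₂ ξ)
        (Icc 0 T) t) :
    ∀ t ∈ Icc 0 T, d t = 0 := by
  intro t₀ ht₀
  have hT : 0 ≤ T := ht₀.1.trans ht₀.2
  have hπ := Real.pi_pos.le
  obtain ⟨D, hD⟩ := isCompact_Icc.exists_bound_of_continuousOn hd
  obtain ⟨C₁, hC₁⟩ := isCompact_Icc.exists_bound_of_continuousOn hN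
  obtain ⟨C₂, hC₂⟩ := isCompact_Icc.exists_bound_of_continuousOn hP
  have h0T : (0 : ℝ) ∈ Icc 0 T := ⟨le_rfl, hT⟩
  have hD0 : 0 ≤ D := (norm_nonneg _).trans (hD 0 h0T)
  have hC₁0 : 0 ≤ C₁ := (norm_nonneg _).trans (hC₁ 0 h0T)
  have hC₂0 : 0 ≤ C₂ := (norm_nonneg _).trans (hC₂ 0 h0T)
  obtain ⟨z, z₁, z₂, hz0, hzL, hzD, hzA⟩ := exists_chain hc hcpos (Lp.memLp (d t₀))
  set C := C₁ * C₂
  have hC0 : 0 ≤ C := by positivity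
  have hK : ∀ t ∈ Icc 0 T, ∀ s ∈ Icc 0 t, |N (t - s) * P s| ≤ C := by
    intro t ht s hs
    rw [abs_mul]
    exact mul_le_mul (hC₁ _ ⟨by linarith [hs.2], by linarith [hs.1, ht.2]⟩)
      (hC₂ _ ⟨hs.1, hs.2.trans ht.2⟩) (abs_nonneg _) hC₁0
  -- Testing the weak equation with z (k + 1) replaces Aφ by -z k, so g (k + 1) is obtained from g k
  -- by two integrations in time.
  set g : ℕ → ℝ → ℝ := fun k t => ∫ ξ in (0 : ℝ)..Real.pi, d t ξ * z k ξ
  have hgc : ∀ k, ContinuousOn (g k) (Icc 0 T) := fun k => continuousOn_integral_mul hd (hzL k)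
  have hgd : ∀ k, ∀ t ∈ Icc 0 T, HasDerivWithinAt (g (k + 1))
      (-∫ s in (0 : ℝ)..t, N (t - s) * P s * g k s) (Icc 0 T) t := by
    intro k t ht
    refine (hweak _ _ _ (hzD k) t ht).congr_deriv ?_
    rw [← intervalIntegral.integral_neg]
    refine intervalIntegral.integral_congr fun s _ => ?_
    simp only [g]
    rw [← mul_neg, ← intervalIntegral.integral_neg]
    congr 1
    refine intervalIntegral.integral_congr fun ξ hξ => ?_
    rw [uIcc_of_le hπ] at hξ
    simp only [hzA k ξ hξ, mul_neg]
  have hg0 : ∀ k, g k 0 = 0 := by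
    intro k
    simp only [g]
    rw [integral_mul_eq_inner hπ _ (hzL k), hd0, inner_zero_left]
  have hbound : ∀ k, ∀ t ∈ Icc 0 T, |g k t| ≤ D * D * (C * T * t) ^ k / k.factorial := by
    intro k
    induction k with
    | zero =>
      intro t ht
      simp only [pow_zero, Nat.factorial_zero, Nat.cast_one, mul_one, div_one]
      refine (abs_integral_mul_le (hzL 0)).trans
        (mul_le_mul (hD t ht) ?_ (norm_nonneg _) hD0)
      have : (hzL 0).toLp = d t₀ := by
        refine Lp.ext ((hzL 0).coeFn_toLp.trans ?_)
        rw [hz0]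
      rw [this]
      exact hD t₀ ht₀
    | succ k ih =>
      -- The comparison function is the claimed bound at k + 1. In its derivative, `C` comes from
      -- the kernel and `T` from the length of the inner time integral.
      refine image_norm_le_of_norm_deriv_right_le_deriv_boundary
        (f' := fun t => -∫ s in (0 : ℝ)..t, N (t - s) * P s * g k s)
        (B' := fun t => C * T * (D * D * (C * T * t) ^ k / k.factorial)) (hgc (k + 1))
        (fun t ht => ?_) ?_ (fun t => ?_) (fun t ht => ?_)
      · exact (hgd k t ⟨ht.1, ht.2.le⟩).mono_of_mem_nhdsWithin (Icc_mem_nhdsGE_of_mem ht)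
      · rw [hg0]; simp
      · have h1 : HasDerivAt (fun t => C * T * t) (C * T) t := by
          simpa using (hasDerivAt_id t).const_mul (C * T)
        refine (((h1.pow (k + 1)).const_mul (D * D)).div_const _).congr_deriv ?_
        rw [Nat.factorial_succ]
        have : (k.factorial : ℝ) ≠ 0 := by positivity
        have : (k + 1 : ℝ) ≠ 0 := by positivity
        push_cast
        field_simp
      · have htT : t ∈ Icc 0 T := ⟨ht.1, ht.2.le⟩
        have h1 : ∀ s ∈ uIoc 0 t, ‖N (t - s) * P s * g k s‖ ≤
            C * (D * D * (C * T * t) ^ k / k.factorial) := by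
          intro s hs
          rw [uIoc_of_le ht.1] at hs
          have hsT : s ∈ Icc 0 T := ⟨hs.1.le, hs.2.trans ht.2.le⟩
          rw [norm_mul]
          refine mul_le_mul (hK t htT s ⟨hs.1.le, hs.2⟩) ((ih s hsT).trans ?_) (norm_nonneg _) hC0
          have := hs.1.le
          have := hs.2
          gcongr
        have h2 := intervalIntegral.norm_integral_le_of_norm_le_const h1
        rw [norm_neg]
        refine h2.trans ?_
        rw [sub_zero, abs_of_nonneg ht.1]
        have h3 : 0 ≤ C * (D * D * (C * T * t) ^ k / k.factorial) := by
          have := ht.1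
          positivity
        calc _ ≤ C * (D * D * (C * T * t) ^ k / k.factorial) * T := by gcongr; exact ht.2.le
          _ = _ := by ring
  -- the Hankel structure of the moments
  set I : ℕ → ℕ → ℝ := fun i j => ∫ ξ in (0 : ℝ)..Real.pi, z i ξ * z j ξ
  have hshift : ∀ i j, I i (j + 1) = I (i + 1) j := by
    intro i j
    have h1 := (hzD i).integral_opA_mul hc (hzD j)
    have h2 : I i (j + 1) = -∫ ξ in (0 : ℝ)..Real.pi, opA c (z₁ (i + 1)) (z₂ (i + 1)) ξ * z (j + 1) ξ := by
      rw [← intervalIntegral.integral_neg]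
      refine intervalIntegral.integral_congr fun ξ hξ => ?_
      rw [uIcc_of_le hπ] at hξ
      simp only [hzA i ξ hξ]; ring
    have h3 : I (i + 1) j = -∫ ξ in (0 : ℝ)..Real.pi, z (i + 1) ξ * opA c (z₁ (j + 1)) (z₂ (j + 1)) ξ := by
      rw [← intervalIntegral.integral_neg]
      refine intervalIntegral.integral_congr fun ξ hξ => ?_
      rw [uIcc_of_le hπ] at hξ
      simp only [hzA j ξ hξ]; ring
    rw [h2, h3, h1]
  have hmom : ∀ i j, I i j = I 0 (i + j) := by
    intro i
    induction i with
    | zero => intro j; rw [zero_add]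
    | succ i ih => intro j; rw [← hshift, ih]; congr 1; ring
  have hIinner : ∀ i j, I i j = inner ℝ (hzL i).toLp (hzL j).toLp := by
    intro i j
    rw [← integral_mul_eq_inner hπ]
    refine integral_congr_ae_Ioo hπ ?_
    filter_upwards [(hzL i).coeFn_toLp] with ξ hξ
    rw [hξ]
  have hI0 : ∀ k, I 0 k = g k t₀ := fun k => by simp only [I, g, hz0]
  have hsq : ∀ n, I n n = I 0 (2 * n) := fun n => by rw [hmom, two_mul]
  -- ‖z n‖² = I 0 (2n) = g (2n) t₀ decays factorially, and Cauchy-Schwarz with I (n+1) (n+1) = I n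
  -- (n+2) makes it log-convex.
  have hzero : I 1 1 = 0 := by
    refine eq_zero_of_logConvex_of_le_factorial (a := fun n => I n n) (A := D * D)
      (B := (C * T * t₀) ^ 2) (fun n => ?_) (fun n => ?_) (fun n => ?_)
    · simp only [hIinner]; exact real_inner_self_nonneg
    · have h1 : I (n + 1) (n + 1) = I n (n + 2) := (hshift n (n + 1)).symm
      simp only [h1]
      simp only [hIinner, sq]
      exact real_inner_mul_inner_self_le _ _
    · simp only [hsq, hI0]
      refine (le_abs_self _).trans ((hbound (2 * n) t₀ ht₀).trans ?_)
      rw [pow_mul]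
      have h4 : (n.factorial : ℝ) ≤ (2 * n).factorial := by
        exact_mod_cast Nat.factorial_le (by omega)
      gcongr
  have hz1 : (hzL 1).toLp = 0 := by
    rw [hIinner] at hzero
    exact inner_self_eq_zero.1 hzero
  have hz1' : z 1 =ᵐ[volume.restrict (Ioo 0 Real.pi)] 0 :=
    (hzL 1).coeFn_toLp.symm.trans (by rw [hz1]; exact Lp.coeFn_zero _ _ _)
  -- d t₀ = -A z₁ with z₁ = 0 almost everywhere, and A is symmetric, so d t₀ is orthogonal to the
  -- whole domain of A.
  have horth : ∀ φ φ₁ φ₂ : ℝ → ℝ, IsDomA φ φ₁ φ₂ → ∫ ξ in (0 : ℝ)..Real.pi, d t₀ ξ * φ ξ = 0 := by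
    intro φ φ₁ φ₂ hφ
    have h1 := (hzD 0).integral_opA_mul hc hφ
    have h2 : ∫ ξ in (0 : ℝ)..Real.pi, z (0 + 1) ξ * opA c φ₁ φ₂ ξ = ∫ ξ in (0 : ℝ)..Real.pi, (0 : ℝ) := by
      refine integral_congr_ae_Ioo hπ ?_
      filter_upwards [hz1'] with ξ hξ
      simp [hξ]
    have h3 : ∫ ξ in (0 : ℝ)..Real.pi, d t₀ ξ * φ ξ =
        -∫ ξ in (0 : ℝ)..Real.pi, opA c (z₁ (0 + 1)) (z₂ (0 + 1)) ξ * φ ξ := by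
      rw [← intervalIntegral.integral_neg]
      refine intervalIntegral.integral_congr fun ξ hξ => ?_
      rw [uIcc_of_le hπ] at hξ
      simp only [hzA 0 ξ hξ, hz0]; ring
    rw [h3, h1, h2]; simp
  have hmem : MemLp (d t₀) 2 (volume.restrict (Ioo 0 Real.pi)) := Lp.memLp _
  have hloc : LocallyIntegrableOn (d t₀) (Ioo 0 Real.pi) volume :=
    IntegrableOn.locallyIntegrableOn (hmem.integrable (by norm_num))
  have hae := isOpen_Ioo.ae_eq_zero_of_integral_contDiff_smul_eq_zero hloc (fun g hg hgc hgs => ?_)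
  · refine Lp.ext ?_
    refine EventuallyEq.trans ?_ (Lp.coeFn_zero _ _ _).symm
    rw [EventuallyEq, ae_restrict_iff' measurableSet_Ioo]
    exact hae
  · have hg1 : ContDiff ℝ 1 (deriv g) := by
      have : ContDiff ℝ (1 + 1) g := hg.of_le (by norm_cast)
      exact (contDiff_succ_iff_deriv.1 this).2.2
    have hdg : ∀ x, HasDerivAt g (deriv g x) x := fun x =>
      (hg.differentiable (by simp) x).hasDerivAt
    have hdg1 : ∀ x, HasDerivAt (deriv g) (deriv (deriv g) x) x := fun x =>
      (hg1.differentiable one_ne_zero x).hasDerivAt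
    have hc2 : Continuous (deriv (deriv g)) := hg1.continuous_deriv le_rfl
    have hdom : IsDomA g (deriv g) (deriv (deriv g)) := by
      refine ⟨⟨fun x _ => ?_, fun x _ => ?_, memLp_of_continuousOn hc2.continuousOn⟩,
        image_eq_zero_of_notMem_tsupport fun h => lt_irrefl _ (hgs h).1,
        image_eq_zero_of_notMem_tsupport fun h => lt_irrefl _ (hgs h).2⟩
      · rw [intervalIntegral.integral_eq_sub_of_hasDerivAt (fun y _ => hdg y)
          (hg1.continuous.intervalIntegrable _ _)]; ring
      · rw [intervalIntegral.integral_eq_sub_of_hasDerivAt (fun y _ => hdg1 y)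
          (hc2.intervalIntegrable _ _)]; ring
    have h1 := horth _ _ _ hdom
    rw [intervalIntegral.integral_of_le hπ, integral_Ioc_eq_integral_Ioo] at h1
    refine (setIntegral_eq_integral_of_forall_compl_eq_zero (s := Ioo 0 Real.pi) ?_).symm.trans ?_
    rotate_left
    · simpa only [smul_eq_mul, mul_comm] using h1
    · intro x hx
      rw [image_eq_zero_of_notMem_tsupport fun h => hx (hgs h), zero_smul]

lemma IsStringSolution.unique (hc : ContDiffOn ℝ 1 c (Icc 0 Real.pi))
    (hcpos : ∀ ξ ∈ Icc 0 Real.pi, 0 < c ξ) (hN : ContinuousOn (integratedKernel M) (Icc 0 T))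
    (hP : ContinuousOn P (Icc 0 T)) (hu : IntervalIntegrable u volume 0 T)
    (hw : IsStringSolution c P M T u w) (hw' : IsStringSolution c P M T u w') :
    ∀ t ∈ Icc 0 T, w' t = w t := by
  have hπ := Real.pi_pos.le
  suffices h : ∀ t ∈ Icc 0 T, w' t - w t = 0 from fun t ht => sub_eq_zero.1 (h t ht)
  have hpair : ∀ {φ : ℝ → ℝ}, MemLp φ 2 (volume.restrict (Ioo 0 Real.pi)) → ∀ t,
      ∫ ξ in (0 : ℝ)..Real.pi, (w' t - w t : L2Interval Real.pi) ξ * φ ξ =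
      (∫ ξ in (0 : ℝ)..Real.pi, w' t ξ * φ ξ) - ∫ ξ in (0 : ℝ)..Real.pi, w t ξ * φ ξ := by
    intro φ hφ t
    simp only [integral_mul_eq_inner hπ _ hφ, inner_sub_left]
  refine eq_zero_of_homogeneous_weak hc hcpos hN hP (hw'.continuousOn.sub hw.continuousOn)
    (by rw [hw.initial, hw'.initial, sub_zero]) fun φ φ₁ φ₂ hφ t ht => ?_
  have h1 := (hw'.weak φ φ₁ φ₂ hφ t ht).sub (hw.weak φ φ₁ φ₂ hφ t ht)
  refine (h1.congr (fun τ _ => hpair hφ.memLp τ) (hpair hφ.memLp t)).congr_deriv ?_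
  have hk := continuousOn_kernel hN hP ht
  have hint : ∀ {w : ℝ → L2Interval Real.pi}, ContinuousOn w (Icc 0 T) →
      IntervalIntegrable (fun s => integratedKernel M (t - s) * P s *
        ((∫ ξ in (0 : ℝ)..Real.pi, w s ξ * opA c φ₁ φ₂ ξ) + c 0 * u s * φ₁ 0)) volume 0 t := by
    intro w hw
    refine IsPrimOn.integrable_continuousOn_mul ht.1 (IntervalIntegrable.add ?_ ?_) hk
    · exact ContinuousOn.intervalIntegrable_of_Icc ht.1
        ((continuousOn_integral_mul hw (hφ.memLp_opA hc)).mono (Icc_subset_Icc_right ht.2))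
    · refine ((hu.mono_set ?_).const_mul (c 0)).mul_const (φ₁ 0)
      rw [uIcc_of_le ht.1, uIcc_of_le (ht.1.trans ht.2)]
      exact Icc_subset_Icc_right ht.2
  rw [← intervalIntegral.integral_sub (hint hw'.continuousOn) (hint hw.continuousOn)]
  refine intervalIntegral.integral_congr fun s _ => ?_
  simp only [hpair (hφ.memLp_opA hc)]
  ring

end uniqueness

/-! ### Waves in normalized coordinates with a prescribed final profile. -/

/-- Continuous functions vanishing outside `(0, L)`. -/
structure IsProfile (L : ℝ) (h : ℝ → ℝ) : Prop where
  cont : Continuous h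
  left : ∀ s ≤ 0, h s = 0
  right : ∀ s, L ≤ s → h s = 0

lemma IsProfile.exists_bound {L : ℝ} {h : ℝ → ℝ} (hh : IsProfile L h) : ∃ D, ∀ s, |h s| ≤ D := by
  have hs : HasCompactSupport h := by
    refine HasCompactSupport.intro (isCompact_Icc (a := 0) (b := L)) fun s hs => ?_
    rw [mem_Icc, not_and_or, not_le, not_le] at hs
    exact hs.elim (fun h => hh.left s h.le) (fun h => hh.right s h.le)
  exact hs.exists_bound_of_continuous hh.cont

lemma IsProfile.sub {L : ℝ} {h h' : ℝ → ℝ} (hh : IsProfile L h) (hh' : IsProfile L h') :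
    IsProfile L fun s => h s - h' s :=
  ⟨hh.cont.sub hh'.cont, fun s hs => by rw [hh.left s hs, hh'.left s hs, sub_zero],
    fun s hs => by rw [hh.right s hs, hh'.right s hs, sub_zero]⟩

/-- In the normalized coordinates (time `θ`, space `x`, unit speed) `y` and `p` form a
wave entering the string along `θ = x` and with profile `h (L - x) / 2` at time `L`. -/
structure IsNormalWave (L : ℝ) (β : ℝ → ℝ) (ρ : ℝ → ℝ → ℝ) (h : ℝ → ℝ) (y p : ℝ → ℝ → ℝ) :
    Prop where
  cont_y : Continuous (uncurry y)
  cont_p : Continuous (uncurry p)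
  zero_y : ∀ θ x, θ ≤ x → y θ x = 0
  zero_p : ∀ θ x, θ ≤ x → p θ x = 0
  final : ∀ x, y L x = h (L - x) / 2
  deriv_p : ∀ τ x, HasDerivAt (fun x => ∫ θ in x..τ, p θ x) (y τ x) x
  deriv_y : ∀ x ∈ Icc 0 L, ∀ τ ≤ L, ∀ (ν ν' : ℝ → ℝ) (a : ℝ), Continuous ν' →
    (∀ θ, HasDerivAt ν (ν' θ) θ) → ν τ = a → (∀ θ, ν' θ = a * ρ τ θ) →
    HasDerivAt (fun x => ∫ θ in x..τ, ν θ * y θ x)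
      (β x * (∫ θ in x..τ, ν θ * y θ x) + a * p τ x) x

/-- Freezing the coefficients outside [0, L] supplies the global bounds that the fixed point
argument on the whole plane requires. The equations are only read off inside [0, L]. -/
lemma exists_isWaveCoeff {L : ℝ} (hL : 0 ≤ L) {A B : ℝ → ℝ → ℝ} {k : ℝ → ℝ → ℝ → ℝ}
    (hA : Continuous (uncurry A)) (hB : Continuous (uncurry B))
    (hk : Continuous fun q : ℝ × ℝ × ℝ => k q.1 q.2.1 q.2.2) :
    ∃ C₀, ∀ C, C₀ ≤ C → IsWaveCoeff C (fun s x => A (clampTo L s) (clampTo L x))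
      (fun s x => B (clampTo L s) (clampTo L x))
      (fun s x σ => k (clampTo L s) (clampTo L x) (clampTo L σ)) := by
  have hI : IsCompact (Icc 0 L) := isCompact_Icc
  obtain ⟨a, ha⟩ := (hI.prod hI).exists_bound_of_continuousOn hA.continuousOn
  obtain ⟨b, hb⟩ := (hI.prod hI).exists_bound_of_continuousOn hB.continuousOn
  obtain ⟨d, hd⟩ := (hI.prod (hI.prod hI)).exists_bound_of_continuousOn hk.continuousOn
  refine ⟨max a (max b d), fun C hC => ?_⟩
  have h1 := (le_max_left a (max b d)).trans hC
  have h2 := ((le_max_left b d).trans (le_max_right a _)).trans hC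
  have h3 := ((le_max_right b d).trans (le_max_right a _)).trans hC
  refine ⟨by fun_prop, by fun_prop, ?_, fun s x => ?_, fun s x => ?_, fun s x σ => ?_⟩
  · exact hk.comp (by fun_prop : Continuous fun q : ℝ × ℝ × ℝ =>
      (clampTo L q.1, clampTo L q.2.1, clampTo L q.2.2))
  · exact (ha (_, _) ⟨clampTo_mem hL s, clampTo_mem hL x⟩).trans h1
  · exact (hb (_, _) ⟨clampTo_mem hL s, clampTo_mem hL x⟩).trans h2
  · exact (hd (_, _, _) ⟨clampTo_mem hL s, clampTo_mem hL x, clampTo_mem hL σ⟩).trans h3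

lemma rightWave_eq_zero_sub (L : ℝ) (h : ℝ → ℝ) (G : ℝ → ℝ → ℝ) (s x : ℝ) :
    rightWave L h G s x = rightWave L (fun _ => 0) G s x - h s := by
  unfold rightWave; ring

section

variable {L C : ℝ} {A₁ B₁ A₂ B₂ : ℝ → ℝ → ℝ} {k₁ k₂ : ℝ → ℝ → ℝ → ℝ} {h : ℝ → ℝ}
  {G Q : ℝ → ℝ → ℝ}

/-- Nothing happens ahead of the front: on s ≤ 0 the data vanish, so the a priori estimate applies
with H = 0 and its weight is zero. -/
lemma IsWaveSolution.eq_zero (hC : 0 < C) (hc₁ : IsWaveCoeff C A₁ B₁ k₁)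
    (hc₂ : IsWaveCoeff C A₂ B₂ k₂) (hs : IsWaveSolution L C A₁ B₁ k₁ A₂ B₂ k₂ h G Q)
    (hh : IsProfile L h) {s : ℝ} (hs0 : s ≤ 0) (x : ℝ) : G s x = 0 ∧ Q s x = 0 := by
  have hz : ∀ s ∈ Iic (0 : ℝ), |(∫ σ in (0 : ℝ)..s, |h σ|)| ≤ 0 := by
    intro s hs
    have : ∫ σ in (0 : ℝ)..s, |h σ| = ∫ σ in (0 : ℝ)..s, (0 : ℝ) :=
      intervalIntegral.integral_congr fun σ hσ => by
        rw [uIcc_of_ge hs] at hσ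
        simp only [hh.left σ hσ.2, abs_zero]
    simp [this]
  have := hs.abs_le hC hc₁ hc₂ hh.cont ordConnected_Iic (mem_Iic.2 le_rfl) le_rfl hz s hs0 x
  simpa [waveWeight, hh.left s hs0] using this

lemma IsWaveSolution.waves_eq_zero (hC : 0 < C) (hc₁ : IsWaveCoeff C A₁ B₁ k₁)
    (hc₂ : IsWaveCoeff C A₂ B₂ k₂) (hs : IsWaveSolution L C A₁ B₁ k₁ A₂ B₂ k₂ h G Q)
    (hh : IsProfile L h) {s : ℝ} (hs0 : s ≤ 0) (x : ℝ) :
    leftWave G s x = 0 ∧ rightWave L h G s x = 0 := by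
  have h1 : ∀ x, leftWave G s x = 0 := by
    intro x
    have : ∫ σ in (0 : ℝ)..s, G σ (x + (s - σ) / 2) = ∫ σ in (0 : ℝ)..s, (0 : ℝ) :=
      intervalIntegral.integral_congr fun σ hσ => by
        rw [uIcc_of_ge hs0] at hσ
        exact (hs.eq_zero hC hc₁ hc₂ hh hσ.2 _).1
    rw [leftWave, this]; simp
  have h2 : ∫ y in x..(L - s), G s y = ∫ y in x..(L - s), (0 : ℝ) :=
    intervalIntegral.integral_congr fun y _ => (hs.eq_zero hC hc₁ hc₂ hh hs0 y).1
  exact ⟨h1 x, by rw [rightWave, h1, h2, hh.left s hs0]; simp⟩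

/-- The data enter through their value on the same characteristic and their L¹ norm only. Both are
controlled in L² along horizontal and vertical lines, which is what the passage to L² targets needs.
-/
lemma IsWaveSolution.abs_waves_le (hL : 0 ≤ L) (hC : 0 < C) (hc₁ : IsWaveCoeff C A₁ B₁ k₁)
    (hc₂ : IsWaveCoeff C A₂ B₂ k₂) (hs : IsWaveSolution L C A₁ B₁ k₁ A₂ B₂ k₂ h G Q)
    (hh : IsProfile L h) {s x : ℝ} (hsL : s ∈ Icc 0 L) (hx : x ∈ Icc 0 L) :
    |leftWave G s x - rightWave L h G s x| ≤
      (2 + Real.exp (8 * C * L) + 8 * C * Real.exp (8 * C * L) * Real.exp (24 * C * L)) *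
        (|h s| + ∫ σ in (0 : ℝ)..L, |h σ|) := by
  set H := ∫ σ in (0 : ℝ)..L, |h σ|
  have hH0 : 0 ≤ H := intervalIntegral.integral_nonneg hL fun _ _ => abs_nonneg _
  have hH : ∀ s ∈ Icc 0 L, |(∫ σ in (0 : ℝ)..s, |h σ|)| ≤ H := by
    intro s hs
    rw [abs_of_nonneg (intervalIntegral.integral_nonneg hs.1 fun _ _ => abs_nonneg _)]
    exact intervalIntegral.integral_mono_interval le_rfl hs.1 hs.2
      (Eventually.of_forall fun _ => abs_nonneg _) (hh.cont.abs.intervalIntegrable _ _)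
  have h0 : (0 : ℝ) ∈ Icc 0 L := ⟨le_rfl, hL⟩
  have hb := hs.abs_le hC hc₁ hc₂ hh.cont ordConnected_Icc h0 hH0 hH
  have h2C : 0 ≤ 2 * C := by positivity
  have h1 := abs_leftWave_le hC hh.cont.abs (fun _ => abs_nonneg _) hH0 ordConnected_Icc h0 h2C hsL
    (hH s hsL) (fun s hs x => (hb s hs x).1) x
  have h2 := abs_rightWave_zero_le hC hh.cont.abs (fun _ => abs_nonneg _) hH0 ordConnected_Icc h0
    h2C hsL (hH s hsL) (fun s hs x => (hb s hs x).1) x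
  have hE : Real.exp (8 * C * |x + s - L|) ≤ Real.exp (8 * C * L) := by
    gcongr
    rw [_root_.abs_le]
    constructor <;> linarith [hsL.1, hsL.2, hx.1, hx.2]
  have hF : Real.exp (24 * C * |s|) ≤ Real.exp (24 * C * L) := by
    gcongr
    rw [abs_of_nonneg hsL.1]
    exact hsL.2
  set E := Real.exp (8 * C * L)
  set F := Real.exp (24 * C * L)
  have hE0 : 0 < E := Real.exp_pos _
  have hF0 : 0 < F := Real.exp_pos _
  have h1' : |leftWave G s x| ≤ 2 * C * E * (H * F) := h1.trans (by gcongr)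
  have h2' : |rightWave L (fun _ => 0) G s x| ≤
      2 * C * E * (H * F) + 2 * C * (|h s| + 16 * C * H * F) * (E / (8 * C)) :=
    h2.trans (by gcongr)
  have e : 2 * C * (|h s| + 16 * C * H * F) * (E / (8 * C)) =
      (|h s| + 16 * C * H * F) * E / 4 := by field_simp; ring
  rw [e] at h2'
  rw [rightWave_eq_zero_sub]
  have h3 : |leftWave G s x - (rightWave L (fun _ => 0) G s x - h s)| ≤
      |leftWave G s x| + (|rightWave L (fun _ => 0) G s x| + |h s|) :=
    (abs_sub _ _).trans (add_le_add le_rfl (abs_sub _ _))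
  have hh0 := abs_nonneg (h s)
  have q1 : 0 ≤ |h s| * E := by positivity
  have q2 : 0 ≤ |h s| * (C * E * F) := by positivity
  have q3 : 0 ≤ H * E := by positivity
  nlinarith

end

/-- The wave is y = (l - r)/2, p = (l + r)/2, with l and r the left and right waves. The auxiliary
unknown `Q` is formally the time integral of y_x - βy, the stress without memory, and p = Q - ∫ρQ.
Linearity turns the a priori bound into the Lipschitz estimate. -/
lemma exists_isNormalWave {L : ℝ} (hL : 0 < L) {β : ℝ → ℝ} {ρ ρ₁ : ℝ → ℝ → ℝ} (hβ : Continuous β)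
    (hρ : Continuous (uncurry ρ)) (hρ₁ : Continuous (uncurry ρ₁))
    (hρd : ∀ τ σ, HasDerivAt (fun τ => ρ τ σ) (ρ₁ τ σ) τ) :
    ∃ (K : ℝ) (Y : (ℝ → ℝ) → ℝ → ℝ → ℝ), 0 ≤ K ∧ ∀ h, IsProfile L h →
      (∃ p, IsNormalWave L β ρ h (Y h) p) ∧
      ∀ h', IsProfile L h' → ∀ x ∈ Icc 0 L, ∀ θ ≤ L, |Y h θ x - Y h' θ x| ≤
        K * (|h (θ - x) - h' (θ - x)| + ∫ s in (0 : ℝ)..L, |h s - h' s|) := by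
  -- `A`, `B`, `k` come from G = -βy - ρ(θ,θ)Q - ∫ρ₁Q with θ = x + s, after inserting y = (l - r)/2
  -- and replacing the pointwise Q by (l + r)/2 + ∫ρQ.
  set A : ℝ → ℝ → ℝ := fun s x => -β x / 2 - ρ (x + s) (x + s) / 2
  set B : ℝ → ℝ → ℝ := fun s x => β x / 2 - ρ (x + s) (x + s) / 2
  set k : ℝ → ℝ → ℝ → ℝ := fun s x σ =>
    -(ρ (x + s) (x + s) * ρ (x + s) (x + σ) + ρ₁ (x + s) (x + σ))
  set k' : ℝ → ℝ → ℝ → ℝ := fun s x σ => ρ (x + s) (x + σ)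
  obtain ⟨C₁, hC₁⟩ := exists_isWaveCoeff hL.le (A := A) (B := B) (k := k) (by fun_prop)
    (by fun_prop) (by fun_prop)
  obtain ⟨C₂, hC₂⟩ := exists_isWaveCoeff hL.le (A := fun _ _ => 1 / 2) (B := fun _ _ => 1 / 2)
    (k := k') (by fun_prop) (by fun_prop) (by fun_prop)
  set C := max 1 (max C₁ C₂)
  have hC : 0 < C := lt_max_of_lt_left one_pos
  have hc₁ := hC₁ C ((le_max_left _ _).trans (le_max_right _ _))
  have hc₂ := hC₂ C ((le_max_right _ _).trans (le_max_right _ _))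
  have hex := fun (h : ℝ → ℝ) (hh : IsProfile L h) =>
    exists_isWaveSolution (L := L) hC hc₁ hc₂ hh.cont hh.exists_bound.choose_spec
  choose! G Q hGQ using hex
  set K := 2 + Real.exp (8 * C * L) + 8 * C * Real.exp (8 * C * L) * Real.exp (24 * C * L)
  have hK : 0 ≤ K := by positivity
  refine ⟨K, fun h θ x => (leftWave (G h) (θ - x) x - rightWave L h (G h) (θ - x) x) / 2, hK,
    fun h hh => ⟨?_, ?_⟩⟩
  · have hs := hGQ h hh
    have hcG := hs.contG
    have hcQ := hs.contQ
    have hcl := continuous_leftWave hcG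
    have hcr := continuous_rightWave (L := L) hh.cont hcG
    have hcl' : Continuous (uncurry fun θ x => leftWave (G h) (θ - x) x) := by fun_prop
    have hcr' : Continuous (uncurry fun θ x => rightWave L h (G h) (θ - x) x) := by fun_prop
    have hdl : ∀ τ x, HasDerivAt (fun x => ∫ θ in x..τ, leftWave (G h) (θ - x) x)
        (leftWave (G h) (τ - x) x - ∫ θ in x..τ, G h (θ - x) x) x := by
      intro τ x
      have e : ∀ (f : ℝ → ℝ → ℝ) x, ∫ θ in x..τ, f (θ - x) x = ∫ σ in (0 : ℝ)..(τ - x), f σ x :=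
        fun f x => by
          rw [intervalIntegral.integral_comp_sub_right (fun σ => f σ x), sub_self]
      simp_rw [e]
      exact hasDerivAt_integral_leftWave hcG τ x
    have hdr : ∀ τ x, HasDerivAt (fun x => ∫ θ in x..τ, rightWave L h (G h) (θ - x) x)
        (-rightWave L h (G h) (τ - x) x + ∫ θ in x..τ, G h (θ - x) x) x := by
      intro τ x
      have e : ∀ (f : ℝ → ℝ → ℝ) x, ∫ θ in x..τ, f (θ - x) x = ∫ σ in (0 : ℝ)..(τ - x), f σ x :=
        fun f x => by
          rw [intervalIntegral.integral_comp_sub_right (fun σ => f σ x), sub_self]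
      simp_rw [e]
      exact hasDerivAt_integral_rightWave hh.cont hcG τ x
    have hil : ∀ x τ, IntervalIntegrable (fun θ => leftWave (G h) (θ - x) x) volume x τ :=
      fun x τ => Continuous.intervalIntegrable (by fun_prop) _ _
    have hir : ∀ x τ, IntervalIntegrable (fun θ => rightWave L h (G h) (θ - x) x) volume x τ :=
      fun x τ => Continuous.intervalIntegrable (by fun_prop) _ _
    have hz := fun {s : ℝ} (h0 : s ≤ 0) (x : ℝ) => hs.waves_eq_zero hC hc₁ hc₂ hh h0 x
    have hz' := fun {s : ℝ} (h0 : s ≤ 0) (x : ℝ) => hs.eq_zero hC hc₁ hc₂ hh h0 x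
    refine ⟨fun θ x => (leftWave (G h) (θ - x) x + rightWave L h (G h) (θ - x) x) / 2,
      ?_, ?_, ?_, ?_, ?_, ?_, ?_⟩
    · fun_prop
    · fun_prop
    · intro θ x hθ
      simp only [hz (sub_nonpos.2 hθ) x, sub_zero, zero_div]
    · intro θ x hθ
      simp only [hz (sub_nonpos.2 hθ) x, add_zero, zero_div]
    · intro x
      have : rightWave L h (G h) (L - x) x = leftWave (G h) (L - x) x - h (L - x) := by
        simp [rightWave]
      simp only [this]; ring
    · intro τ x
      have := ((hdl τ x).add (hdr τ x)).div_const 2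
      refine (this.congr_deriv (by ring)).congr_of_eventuallyEq (Eventually.of_forall fun x => ?_)
      simp only [Pi.add_apply]
      rw [← intervalIntegral.integral_add (hil x τ) (hir x τ), intervalIntegral.integral_div]
    · intro x hx τ hτ ν ν' a hν'c hν ha hν'
      have hquad : ∀ θ ∈ uIcc x τ,
          (G h (θ - x) x = -β x * ((leftWave (G h) (θ - x) x - rightWave L h (G h) (θ - x) x) / 2)
            - ρ θ θ * Q h (θ - x) x - ∫ σ in x..θ, ρ₁ θ σ * Q h (σ - x) x) ∧
          (Q h (θ - x) x = (leftWave (G h) (θ - x) x + rightWave L h (G h) (θ - x) x) / 2 +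
            ∫ σ in x..θ, ρ θ σ * Q h (σ - x) x) := by
        intro θ hθ
        rcases le_total θ x with hle | hle
        · have hint : ∀ κ : ℝ → ℝ, ∫ σ in x..θ, κ σ * Q h (σ - x) x = 0 := by
            intro κ
            have : ∫ σ in x..θ, κ σ * Q h (σ - x) x = ∫ σ in x..θ, (0 : ℝ) :=
              intervalIntegral.integral_congr fun σ hσ => by
                rw [uIcc_of_ge hle] at hσ
                simp only [hz' (sub_nonpos.2 hσ.2) x, mul_zero]
            simp [this]
          have h0 := sub_nonpos.2 hle
          simp [hint, hz h0 x, hz' h0 x]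
        · have hθL : θ ≤ L := by
            rcases le_total x τ with hxτ | hxτ
            · rw [uIcc_of_le hxτ] at hθ; exact hθ.2.trans hτ
            · rw [uIcc_of_ge hxτ] at hθ; exact hθ.2.trans hx.2
          have hsm : θ - x ∈ Icc 0 L := ⟨by linarith, by linarith [hx.1]⟩
          have hint : ∀ κ : ℝ → ℝ, ∫ σ in x..θ, κ σ * Q h (σ - x) x =
              ∫ σ in (0 : ℝ)..(θ - x), κ (x + σ) * Q h σ x := by
            intro κ
            have := intervalIntegral.integral_comp_sub_right (a := x) (b := θ)
              (fun σ => κ (x + σ) * Q h σ x) x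
            simpa using this
          have hcl : ∀ κ : ℝ → ℝ, ∫ σ in (0 : ℝ)..(θ - x), κ (clampTo L σ) * Q h σ x =
              ∫ σ in (0 : ℝ)..(θ - x), κ σ * Q h σ x := fun κ =>
            intervalIntegral.integral_congr fun σ hσ => by
              rw [uIcc_of_le hsm.1] at hσ
              simp only [clampTo_of_mem (⟨hσ.1, hσ.2.trans hsm.2⟩ : σ ∈ Icc 0 L)]
          have eG := hs.eqG (θ - x) x
          have eQ := hs.eqQ (θ - x) x
          simp only [waveMap, clampTo_of_mem hsm, clampTo_of_mem hx] at eG eQ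
          rw [hcl (k (θ - x) x)] at eG
          rw [hcl (k' (θ - x) x)] at eQ
          simp only [A, B, k, k', add_sub_cancel] at eG eQ
          rw [hint, hint]
          have esplit : ∫ σ in (0 : ℝ)..(θ - x),
              -(ρ θ θ * ρ θ (x + σ) + ρ₁ θ (x + σ)) * Q h σ x =
              -(ρ θ θ * ∫ σ in (0 : ℝ)..(θ - x), ρ θ (x + σ) * Q h σ x) -
              ∫ σ in (0 : ℝ)..(θ - x), ρ₁ θ (x + σ) * Q h σ x := by
            rw [← intervalIntegral.integral_const_mul, ← intervalIntegral.integral_neg,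
              ← intervalIntegral.integral_sub (Continuous.intervalIntegrable (by fun_prop) _ _)
              (Continuous.intervalIntegrable (by fun_prop) _ _)]
            exact intervalIntegral.integral_congr fun σ _ => by ring
          rw [esplit] at eG
          refine ⟨?_, by linarith⟩
          rw [eG, eQ]
          ring
      refine hasDerivAt_integral_weight_mul
        (y := fun θ x => (leftWave (G h) (θ - x) x - rightWave L h (G h) (θ - x) x) / 2)
        (p := fun θ x => (leftWave (G h) (θ - x) x + rightWave L h (G h) (θ - x) x) / 2)
        (G := fun θ x => G h (θ - x) x)
        (Q := fun θ x => Q h (θ - x) x) (by fun_prop) (by fun_prop) (by fun_prop) (by fun_prop)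
        (fun τ x => ?_) hρ hρ₁ hρd (fun θ hθ => (hquad θ hθ).1) (fun θ hθ => (hquad θ hθ).2) hν'c
        hν ha hν'
      have := ((hdl τ x).sub (hdr τ x)).div_const 2
      refine (this.congr_deriv (by ring)).congr_of_eventuallyEq (Eventually.of_forall fun x => ?_)
      simp only [Pi.sub_apply]
      rw [← intervalIntegral.integral_sub (hil x τ) (hir x τ), intervalIntegral.integral_div]
  · intro h' hh' x hx θ hθ
    have hs := hGQ h hh
    have hs' := hGQ h' hh'
    have hH0 : 0 ≤ ∫ s in (0 : ℝ)..L, |h s - h' s| :=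
      intervalIntegral.integral_nonneg hL.le fun _ _ => abs_nonneg _
    rcases le_total θ x with hle | hle
    · have h0 := sub_nonpos.2 hle
      simp only [hs.waves_eq_zero hC hc₁ hc₂ hh h0 x, hs'.waves_eq_zero hC hc₁ hc₂ hh' h0 x,
        sub_zero, zero_div, abs_zero]
      positivity
    · have hsm : θ - x ∈ Icc 0 L := ⟨by linarith, by linarith [hx.1]⟩
      have h1 := (hs.sub hc₁ hc₂ hs').abs_waves_le hL.le hC hc₁ hc₂ (hh.sub hh') hsm hx
      rw [leftWave_sub hs.contG hs'.contG, rightWave_sub hs.contG hs'.contG] at h1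
      have e : (leftWave (G h) (θ - x) x - rightWave L h (G h) (θ - x) x) / 2 -
          (leftWave (G h') (θ - x) x - rightWave L h' (G h') (θ - x) x) / 2 =
          (leftWave (G h) (θ - x) x - leftWave (G h') (θ - x) x -
          (rightWave L h (G h) (θ - x) x - rightWave L h' (G h') (θ - x) x)) / 2 := by ring
      rw [e, abs_div, abs_two]
      have := abs_nonneg (leftWave (G h) (θ - x) x - leftWave (G h') (θ - x) x -
          (rightWave L h (G h) (θ - x) x - rightWave L h' (G h') (θ - x) x))
      linarith

/-! ### Return to the physical coordinates and L² bounds. -/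

lemma sq_integral_abs_le {L : ℝ} (hL : 0 < L) {D : ℝ → ℝ} (hD : Continuous D) :
    (∫ s in (0 : ℝ)..L, |D s|) ^ 2 ≤ L * ∫ s in (0 : ℝ)..L, D s ^ 2 := by
  set I := ∫ s in (0 : ℝ)..L, |D s|
  -- Cauchy-Schwarz, from the nonnegativity of the variance of |D|.
  have h1 : 0 ≤ ∫ s in (0 : ℝ)..L, (|D s| - I / L) ^ 2 :=
    intervalIntegral.integral_nonneg hL.le fun _ _ => sq_nonneg _
  have h2 : ∫ s in (0 : ℝ)..L, (|D s| - I / L) ^ 2 =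
      (∫ s in (0 : ℝ)..L, D s ^ 2) - 2 * (I / L) * I + (I / L) ^ 2 * L := by
    have e : ∀ s, (|D s| - I / L) ^ 2 = D s ^ 2 - 2 * (I / L) * |D s| + (I / L) ^ 2 := fun s => by
      rw [← sq_abs (D s)]; ring
    simp_rw [e]
    rw [intervalIntegral.integral_add (Continuous.intervalIntegrable (by fun_prop) _ _)
      (Continuous.intervalIntegrable (by fun_prop) _ _), intervalIntegral.integral_sub
      (Continuous.intervalIntegrable (by fun_prop) _ _)
      (Continuous.intervalIntegrable (by fun_prop) _ _), intervalIntegral.integral_const_mul]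
    simp [I, mul_comm]
  rw [h2] at h1
  have h3 := mul_nonneg hL.le h1
  have h4 : L * ((∫ s in (0 : ℝ)..L, D s ^ 2) - 2 * (I / L) * I + (I / L) ^ 2 * L) =
      L * (∫ s in (0 : ℝ)..L, D s ^ 2) - I ^ 2 := by field_simp; ring
  linarith

lemma IsProfile.integral_sq_le {L : ℝ} {D : ℝ → ℝ} (hD : IsProfile L D) {α γ : ℝ}
    (hαγ : α ≤ γ) : ∫ s in α..γ, D s ^ 2 ≤ ∫ s in (0 : ℝ)..L, D s ^ 2 := by
  have hc : Continuous fun s => D s ^ 2 := hD.cont.pow 2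
  have hi : ∀ a b, IntervalIntegrable (fun s => D s ^ 2) volume a b :=
    fun a b => hc.intervalIntegrable a b
  have hz : ∀ a b, a ≤ b → (b ≤ 0 ∨ L ≤ a) → ∫ s in a..b, D s ^ 2 = 0 := by
    intro a b hab h
    have : ∫ s in a..b, D s ^ 2 = ∫ s in a..b, (0 : ℝ) :=
      intervalIntegral.integral_congr fun s hs => by
        rw [uIcc_of_le hab] at hs
        rcases h with h | h
        · simp [hD.left s (hs.2.trans h)]
        · simp [hD.right s (h.trans hs.1)]
    simp [this]
  have h1 : ∫ s in α..γ, D s ^ 2 ≤ ∫ s in (min α 0)..(max γ L), D s ^ 2 :=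
    intervalIntegral.integral_mono_interval (min_le_left _ _) hαγ (le_max_left _ _)
      (Eventually.of_forall fun s => sq_nonneg _) (hi _ _)
  refine h1.trans_eq ?_
  rw [← intervalIntegral.integral_add_adjacent_intervals (hi (min α 0) 0) (hi 0 _),
    ← intervalIntegral.integral_add_adjacent_intervals (hi 0 L) (hi L _),
    hz _ _ (min_le_right _ _) (Or.inl le_rfl), hz _ _ (le_max_right _ _) (Or.inr le_rfl)]
  ring

/-- A solution of the string equation with continuous data, in integrated form. -/
structure IsStringWave (b a N : ℝ → ℝ) (T : ℝ) (W : ℝ → ℝ) (w v : ℝ → ℝ → ℝ) : Prop where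
  cont_w : Continuous (uncurry w)
  cont_v : Continuous (uncurry v)
  initial : ∀ ξ ∈ Icc 0 Real.pi, w 0 ξ = 0
  right : ∀ t ∈ Icc 0 T, w t Real.pi = 0
  final : ∀ ξ ∈ Icc 0 Real.pi, w T ξ = W ξ
  deriv_v : ∀ t ∈ Icc 0 T, ∀ ξ ∈ Ioo 0 Real.pi,
    HasDerivAt (fun ξ => ∫ s in (0 : ℝ)..t, v s ξ) (w t ξ) ξ
  deriv_w : ∀ t ∈ Icc 0 T, ∀ ξ ∈ Ioo 0 Real.pi,
    HasDerivAt (fun ξ => ∫ s in (0 : ℝ)..t, N (t - s) * a s ^ 2 * w s ξ) (v t ξ / b ξ ^ 2) ξ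

/-- Existence of waves with a prescribed continuous final state, with bounds in `L²`. -/
lemma exists_isStringWave {b b₁ a a₁ N m m₁ : ℝ → ℝ} {T β₀ β₁ α₀ : ℝ} (hT : 0 < T)
    (hb : ∀ ξ, HasDerivAt b (b₁ ξ) ξ) (hb₁ : Continuous b₁) (hβ₀ : 0 < β₀)
    (hbb : ∀ ξ, β₀ ≤ b ξ ∧ b ξ ≤ β₁) (ha : ∀ t, HasDerivAt a (a₁ t) t) (ha₁ : Continuous a₁)
    (hα₀ : 0 < α₀) (haa : ∀ t, α₀ ≤ a t) (hN : ∀ t, HasDerivAt N (m t) t)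
    (hm : ∀ t, HasDerivAt m (m₁ t) t) (hm₁ : Continuous m₁) (hN0 : N 0 = 1)
    (hlen : ∫ ξ in (0 : ℝ)..Real.pi, (b ξ)⁻¹ ≤ ∫ t in (0 : ℝ)..T, a t) :
    ∃ (K : ℝ) (Ω : (ℝ → ℝ) → ℝ → ℝ → ℝ), 0 ≤ K ∧ ∀ W, IsProfile Real.pi W →
      (∃ v, IsStringWave b a N T W (Ω W) v) ∧ ∀ W', IsProfile Real.pi W' →
        (∀ t ∈ Icc 0 T, ∫ ξ in (0 : ℝ)..Real.pi, (Ω W t ξ - Ω W' t ξ) ^ 2 ≤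
          K * ∫ ξ in (0 : ℝ)..Real.pi, (W ξ - W' ξ) ^ 2) ∧
        ∫ t in (0 : ℝ)..T, (Ω W t 0 - Ω W' t 0) ^ 2 ≤
          K * ∫ ξ in (0 : ℝ)..Real.pi, (W ξ - W' ξ) ^ 2 := by
  have hπ := Real.pi_pos
  have hbp : ∀ ξ, 0 < b ξ := fun ξ => hβ₀.trans_le (hbb ξ).1
  have hap : ∀ t, 0 < a t := fun t => hα₀.trans_le (haa t)
  have hβ₁ : 0 < β₁ := (hbp 0).trans_le (hbb 0).2
  have hbc : Continuous b := continuous_iff_continuousAt.2 fun ξ => (hb ξ).continuousAt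
  have hac : Continuous a := continuous_iff_continuousAt.2 fun ξ => (ha ξ).continuousAt
  have hNc : Continuous N := continuous_iff_continuousAt.2 fun ξ => (hN ξ).continuousAt
  have hmc : Continuous m := continuous_iff_continuousAt.2 fun ξ => (hm ξ).continuousAt
  have hbic : Continuous fun ξ => (b ξ)⁻¹ := hbc.inv₀ fun ξ => (hbp ξ).ne'
  -- the optical distance and the optical time
  set X : ℝ → ℝ := fun ξ => ∫ y in (0 : ℝ)..ξ, (b y)⁻¹
  have hX : ∀ ξ, HasDerivAt X (b ξ)⁻¹ ξ := fun ξ => hasDerivAt_integral_right hbic 0 ξ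
  obtain ⟨Xi, hXl, hXr, hXm, hXim, hXi⟩ := exists_inverse_of_deriv_ge hX (inv_pos.2 hβ₁)
    (fun ξ => inv_anti₀ (hbp ξ) (hbb ξ).2)
  have hX0 : X 0 = 0 := by simp [X]
  set L := X Real.pi with hLdef
  have hL : 0 < L := by rw [← hX0]; exact hXm hπ
  -- Normalized by θ T = L. Then `hlen` says θ 0 ≤ 0: at t = 0 the whole string lies ahead of the
  -- front θ = x, and the end ξ = π does so up to time T.
  set θ : ℝ → ℝ := fun t => L - (∫ s in (0 : ℝ)..T, a s) + ∫ s in (0 : ℝ)..t, a s with hθdef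
  have hθ : ∀ t, HasDerivAt θ (a t) t := fun t => (hasDerivAt_integral_right hac 0 t).const_add _
  obtain ⟨Ti, hTl, hTr, hθm, hTim, hTi⟩ := exists_inverse_of_deriv_ge hθ hα₀ haa
  have hθT : θ T = L := by simp [hθdef]
  have hθ0 : θ 0 ≤ 0 := by simp only [hθdef, intervalIntegral.integral_same]; linarith
  have hXc : Continuous X := continuous_iff_continuousAt.2 fun ξ => (hX ξ).continuousAt
  have hXic : Continuous Xi := continuous_iff_continuousAt.2 fun ξ => (hXi ξ).continuousAt
  have hθc : Continuous θ := continuous_iff_continuousAt.2 fun ξ => (hθ ξ).continuousAt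
  have hTic : Continuous Ti := continuous_iff_continuousAt.2 fun ξ => (hTi ξ).continuousAt
  have hXi0 : Xi 0 = 0 := by have := hXl 0; rwa [hX0] at this
  have hXiL : Xi L = Real.pi := hXl _
  obtain ⟨ai, hai⟩ : ∃ ai : ℝ → ℝ, ∀ t, ai t = (a t)⁻¹ := ⟨_, fun _ => rfl⟩
  have haic : Continuous ai := by
    rw [funext hai]; exact hac.inv₀ fun t => (hap t).ne'
  simp only [← hai] at hTi
  -- the memory kernel in the optical time
  set ρ : ℝ → ℝ → ℝ := fun τ σ =>
    (-m (Ti τ - Ti σ) + N (Ti τ - Ti σ) * (a₁ (Ti σ) * ai (Ti σ))) / a (Ti τ) with hρdef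
  set ρ₁ : ℝ → ℝ → ℝ := fun τ σ =>
    ((-(m₁ (Ti τ - Ti σ) * ai (Ti τ)) +
      m (Ti τ - Ti σ) * ai (Ti τ) * (a₁ (Ti σ) * ai (Ti σ))) * a (Ti τ) -
      (-m (Ti τ - Ti σ) + N (Ti τ - Ti σ) * (a₁ (Ti σ) * ai (Ti σ))) *
        (a₁ (Ti τ) * ai (Ti τ))) / a (Ti τ) ^ 2
  have hρc : Continuous (uncurry ρ) := by
    exact Continuous.div (by fun_prop) (by fun_prop) fun q => (hap _).ne'
  have hρ₁c : Continuous (uncurry ρ₁) := by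
    refine Continuous.div ?_ (by fun_prop) fun q => (pow_pos (hap _) 2).ne'
    fun_prop
  have hρd : ∀ τ σ, HasDerivAt (fun τ => ρ τ σ) (ρ₁ τ σ) τ := by
    intro τ σ
    have h1 : HasDerivAt (fun τ => Ti τ - Ti σ) (ai (Ti τ)) τ := (hTi τ).sub_const _
    have h2 := (hm (Ti τ - Ti σ)).comp τ h1
    have h3 := (hN (Ti τ - Ti σ)).comp τ h1
    have h4 := (ha (Ti τ)).comp τ (hTi τ)
    exact (h2.neg.add (h3.mul_const (a₁ (Ti σ) * ai (Ti σ)))).div h4 (hap _).ne'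
  obtain ⟨K, Y, hK, hY⟩ := exists_isNormalWave hL (β := fun x => b₁ (Xi x)) (by fun_prop) hρc hρ₁c
    hρd
  -- The physical state is w = y/b and y(L, x) = h(L - x)/2, whence the factor 2b.
  set H : (ℝ → ℝ) → ℝ → ℝ := fun W s => 2 * (b (Xi (L - s)) * W (Xi (L - s))) with hHdef
  have hH : ∀ W, IsProfile Real.pi W → IsProfile L (H W) := by
    intro W hW
    have := hW.cont
    refine ⟨by fun_prop, fun s hs => ?_, fun s hs => ?_⟩
    · have : Real.pi ≤ Xi (L - s) := by
        rw [← hXiL]; exact hXim.monotone (by linarith)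
      simp [hHdef, hW.right _ this]
    · have : Xi (L - s) ≤ 0 := by
        rw [← hXi0]; exact hXim.monotone (by linarith)
      simp [hHdef, hW.left _ this]
  have hXnn : ∀ ξ, 0 ≤ ξ → 0 ≤ X ξ := fun ξ h => by rw [← hX0]; exact hXm.monotone h
  -- The integrand vanishes ahead of the front, so in optical time the lower limit θ 0 may be
  -- replaced by x.
  have hsubst : ∀ (F : ℝ → ℝ), Continuous F → ∀ x, 0 ≤ x → (∀ θ ≤ x, F θ = 0) → ∀ t,
      ∫ s in (0 : ℝ)..t, F (θ s) * a s = ∫ θ in x..θ t, F θ := by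
    intro F hF x hx hFx t
    have h1 := intervalIntegral.integral_comp_mul_deriv (a := 0) (b := t) (fun s _ => hθ s)
      hac.continuousOn hF
    simp only [Function.comp_apply] at h1
    rw [h1, ← intervalIntegral.integral_add_adjacent_intervals (hF.intervalIntegrable _ x)
      (hF.intervalIntegrable x _)]
    have : ∫ θ in (θ 0)..x, F θ = ∫ θ in (θ 0)..x, (0 : ℝ) :=
      intervalIntegral.integral_congr fun σ hσ => by
        rw [uIcc_of_le (hθ0.trans hx)] at hσ
        exact hFx σ hσ.2
    rw [this]; simp
  have hwave : ∀ W, IsProfile Real.pi W →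
      ∃ v, IsStringWave b a N T W (fun t ξ => Y (H W) (θ t) (X ξ) / b ξ) v := by
    intro W hW
    obtain ⟨p, hp⟩ := (hY _ (hH W hW)).1
    have hyc := hp.cont_y
    have hpc := hp.cont_p
    refine ⟨fun t ξ => a t * p (θ t) (X ξ), ?_, by fun_prop, fun ξ hξ => ?_, fun t ht => ?_,
      fun ξ hξ => ?_, fun t ht ξ hξ => ?_, fun t ht ξ hξ => ?_⟩
    · exact Continuous.div (by fun_prop) (by fun_prop) fun q => (hbp _).ne'
    · rw [hp.zero_y _ _ (hθ0.trans (hXnn ξ hξ.1)), zero_div]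
    · rw [hp.zero_y _ _ (by rw [← hLdef, ← hθT]; exact hθm.monotone ht.2), zero_div]
    · have := (hbp ξ).ne'
      rw [hθT, hp.final]
      simp only [hHdef, sub_sub_cancel, hXl]
      field_simp
    · have h1 := (hp.deriv_p (θ t) (X ξ)).comp ξ (hX ξ)
      refine (h1.congr_deriv (by rw [div_eq_mul_inv])).congr_of_eventuallyEq ?_
      filter_upwards [Ioi_mem_nhds hξ.1] with ξ' hξ'
      rw [Function.comp_apply, ← hsubst (fun θ => p θ (X ξ')) (by fun_prop) _ (hXnn ξ' (le_of_lt hξ'))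
        (fun θ hθ => hp.zero_p θ _ hθ)]
      exact intervalIntegral.integral_congr fun s _ => mul_comm _ _
    · set ν : ℝ → ℝ := fun σ => N (t - Ti σ) * a (Ti σ) with hνdef
      set ν' : ℝ → ℝ := fun σ => -m (t - Ti σ) + N (t - Ti σ) * (a₁ (Ti σ) * ai (Ti σ)) with hν'def
      have hν'c : Continuous ν' := by
        fun_prop
      have hνd : ∀ σ, HasDerivAt ν (ν' σ) σ := by
        intro σ
        have h1 : HasDerivAt (fun σ => t - Ti σ) (-ai (Ti σ)) σ := (hTi σ).const_sub _
        have h2 := (hN (t - Ti σ)).comp σ h1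
        have h4 := (ha (Ti σ)).comp σ (hTi σ)
        refine (h2.mul h4).congr_deriv ?_
        have := (hap (Ti σ)).ne'
        simp only [hν'def, Function.comp_apply, hai]
        field_simp
      have h1 := (hp.deriv_y (X ξ) ⟨hXnn ξ hξ.1.le, hXm.monotone hξ.2.le⟩ (θ t)
        (by rw [← hθT]; exact hθm.monotone ht.2) ν ν' (a t) hν'c hνd
        (by simp [hνdef, hTl, hN0]) (fun σ => by
          have := (hap t).ne'
          simp only [hν'def, hρdef, hTl]
          field_simp)).comp ξ (hX ξ)
      -- Dividing by b cancels the term with β, since β is b' taken at the corresponding point.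
      have h2 := h1.div (hb ξ) (hbp ξ).ne'
      refine (h2.congr_deriv ?_).congr_of_eventuallyEq ?_
      · have := (hbp ξ).ne'
        simp only [Function.comp_apply, hXl]
        field_simp
        ring
      · have hνc : Continuous ν := continuous_iff_continuousAt.2 fun σ => (hνd σ).continuousAt
        filter_upwards [Ioi_mem_nhds hξ.1] with ξ' hξ'
        simp only [Pi.div_apply, Function.comp_apply]
        rw [← hsubst (fun θ => ν θ * Y (H W) θ (X ξ')) (by fun_prop) _ (hXnn ξ' (le_of_lt hξ'))
          (fun θ hθ => by simp only [hp.zero_y θ _ hθ, mul_zero]),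
          ← intervalIntegral.integral_div]
        refine intervalIntegral.integral_congr fun s _ => ?_
        simp only [hνdef, hTl]
        ring
  -- bounds
  set K₀ := 2 * (K / β₀) ^ 2
  have hK₀ : 0 ≤ K₀ := by positivity
  set K₁ := K₀ * (β₁ + Real.pi * L) * (4 * β₁)
  set K₂ := K₀ * (α₀⁻¹ + T * L) * (4 * β₁)
  have hK₁ : 0 ≤ K₁ := by positivity
  have hK₂ : 0 ≤ K₂ := by positivity
  refine ⟨K₁ + K₂, fun W t ξ => Y (H W) (θ t) (X ξ) / b ξ, by positivity,
    fun W hW => ⟨hwave W hW, fun W' hW' => ?_⟩⟩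
  have hD := (hH W hW).sub (hH W' hW')
  set D : ℝ → ℝ := fun s => H W s - H W' s with hDdef
  have hDc := hD.cont
  set S := ∫ s in (0 : ℝ)..L, D s ^ 2
  set S' := ∫ ξ in (0 : ℝ)..Real.pi, (W ξ - W' ξ) ^ 2
  have hS0 : 0 ≤ S := intervalIntegral.integral_nonneg hL.le fun _ _ => sq_nonneg _
  have hS'0 : 0 ≤ S' := intervalIntegral.integral_nonneg hπ.le fun _ _ => sq_nonneg _
  have hWc := hW.cont
  have hWc' := hW'.cont
  have hSS' : S ≤ 4 * β₁ * S' := by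
    have e1 : S = ∫ x in (0 : ℝ)..L, 4 * (b (Xi x) * (W (Xi x) - W' (Xi x))) ^ 2 := by
      have := intervalIntegral.integral_comp_sub_left (a := 0) (b := L)
        (fun x => 4 * (b (Xi x) * (W (Xi x) - W' (Xi x))) ^ 2) L
      rw [sub_self, sub_zero] at this
      rw [← this]
      refine intervalIntegral.integral_congr fun s _ => ?_
      simp only [hDdef, hHdef]
      ring
    have e2 : S = ∫ ξ in (0 : ℝ)..Real.pi, 4 * (b ξ * (W ξ - W' ξ)) ^ 2 * (b ξ)⁻¹ := by
      rw [e1]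
      have := intervalIntegral.integral_comp_mul_deriv (a := 0) (b := Real.pi) (fun ξ _ => hX ξ)
        hbic.continuousOn (g := fun x => 4 * (b (Xi x) * (W (Xi x) - W' (Xi x))) ^ 2)
        (by fun_prop)
      rw [hX0] at this
      rw [← this]
      simp only [Function.comp_apply, hXl]
    rw [e2, ← intervalIntegral.integral_const_mul]
    refine intervalIntegral.integral_mono_on hπ.le (Continuous.intervalIntegrable (by fun_prop) _ _)
      (Continuous.intervalIntegrable (by fun_prop) _ _) fun ξ _ => ?_
    have := (hbp ξ).ne'
    have e3 : 4 * (b ξ * (W ξ - W' ξ)) ^ 2 * (b ξ)⁻¹ = 4 * b ξ * (W ξ - W' ξ) ^ 2 := by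
      field_simp
    rw [e3]
    have := (hbb ξ).2
    gcongr
  have hpoint : ∀ t ∈ Icc 0 T, ∀ ξ ∈ Icc 0 Real.pi,
      (Y (H W) (θ t) (X ξ) / b ξ - Y (H W') (θ t) (X ξ) / b ξ) ^ 2 ≤
        K₀ * (D (θ t - X ξ) ^ 2 + L * S) := by
    intro t ht ξ hξ
    have h1 := (hY _ (hH W hW)).2 _ (hH W' hW') (X ξ) ⟨hXnn ξ hξ.1, hXm.monotone hξ.2⟩ (θ t)
      (by rw [← hθT]; exact hθm.monotone ht.2)
    have h2 := sq_integral_abs_le hL hDc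
    set I := ∫ s in (0 : ℝ)..L, |D s|
    have h3 : |Y (H W) (θ t) (X ξ) / b ξ - Y (H W') (θ t) (X ξ) / b ξ| ≤
        K / β₀ * (|D (θ t - X ξ)| + I) := by
      rw [← sub_div, abs_div, abs_of_pos (hbp ξ), div_mul_eq_mul_div]
      have h0 : 0 ≤ K * (|D (θ t - X ξ)| + I) := (abs_nonneg _).trans h1
      exact div_le_div₀ h0 h1 hβ₀ (hbb ξ).1
    calc _ = |Y (H W) (θ t) (X ξ) / b ξ - Y (H W') (θ t) (X ξ) / b ξ| ^ 2 := (sq_abs _).symm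
      _ ≤ (K / β₀ * (|D (θ t - X ξ)| + I)) ^ 2 := by gcongr
      _ = (K / β₀) ^ 2 * (|D (θ t - X ξ)| + I) ^ 2 := by ring
      _ ≤ (K / β₀) ^ 2 * (2 * (|D (θ t - X ξ)| ^ 2 + I ^ 2)) := by
          gcongr; exact add_sq_le
      _ = K₀ * (D (θ t - X ξ) ^ 2 + I ^ 2) := by rw [sq_abs]; ring
      _ ≤ _ := by gcongr
  have hyc : Continuous (uncurry fun t ξ => Y (H W) (θ t) (X ξ) / b ξ) :=
    (hwave W hW).choose_spec.cont_w
  have hyc' : Continuous (uncurry fun t ξ => Y (H W') (θ t) (X ξ) / b ξ) :=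
    (hwave W' hW').choose_spec.cont_w
  have hdc := (hyc.sub hyc').pow 2
  refine ⟨fun t ht => ?_, ?_⟩
  · have h1 : ∫ ξ in (0 : ℝ)..Real.pi, D (θ t - X ξ) ^ 2 ≤ β₁ * S := by
      have e1 := intervalIntegral.integral_comp_mul_deriv (a := 0) (b := Real.pi) (fun ξ _ => hX ξ)
        hbic.continuousOn (g := fun x => D (θ t - x) ^ 2) (by fun_prop)
      rw [intervalIntegral.integral_comp_sub_left (fun x => D x ^ 2), hX0, sub_zero] at e1
      have e2 := hD.integral_sq_le (α := θ t - X Real.pi) (γ := θ t) (by linarith)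
      rw [← e1] at e2
      calc _ ≤ ∫ ξ in (0 : ℝ)..Real.pi, β₁ * (D (θ t - X ξ) ^ 2 * (b ξ)⁻¹) := by
            refine intervalIntegral.integral_mono_on hπ.le
              (Continuous.intervalIntegrable (by fun_prop) _ _)
              (Continuous.intervalIntegrable (by fun_prop) _ _) fun ξ _ => ?_
            have e3 : 1 ≤ β₁ * (b ξ)⁻¹ := by
              rw [← div_eq_mul_inv, one_le_div (hbp ξ)]; exact (hbb ξ).2
            nlinarith [sq_nonneg (D (θ t - X ξ))]
        _ ≤ β₁ * S := by
            rw [intervalIntegral.integral_const_mul]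
            exact mul_le_mul_of_nonneg_left e2 hβ₁.le
    calc _ ≤ ∫ ξ in (0 : ℝ)..Real.pi, K₀ * (D (θ t - X ξ) ^ 2 + L * S) :=
          intervalIntegral.integral_mono_on hπ.le
            ((hdc.comp (continuous_const.prodMk continuous_id)).intervalIntegrable _ _)
            (Continuous.intervalIntegrable (by fun_prop) _ _) fun ξ hξ => hpoint t ht ξ hξ
      _ = K₀ * ((∫ ξ in (0 : ℝ)..Real.pi, D (θ t - X ξ) ^ 2) + Real.pi * (L * S)) := by
          rw [intervalIntegral.integral_const_mul, intervalIntegral.integral_add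
            (Continuous.intervalIntegrable (by fun_prop) _ _)
            (Continuous.intervalIntegrable (by fun_prop) _ _),
            intervalIntegral.integral_const, sub_zero, smul_eq_mul]
      _ ≤ K₀ * (β₁ * S + Real.pi * (L * S)) := by gcongr
      _ = K₀ * (β₁ + Real.pi * L) * S := by ring
      _ ≤ K₀ * (β₁ + Real.pi * L) * (4 * β₁ * S') := by gcongr
      _ = K₁ * S' := by ring
      _ ≤ (K₁ + K₂) * S' := by gcongr; linarith
  · have h1 : ∫ t in (0 : ℝ)..T, D (θ t) ^ 2 ≤ α₀⁻¹ * S := by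
      have e1 := intervalIntegral.integral_comp_mul_deriv (a := 0) (b := T) (fun t _ => hθ t)
        hac.continuousOn (g := fun x => D x ^ 2) (by fun_prop)
      have e2 := hD.integral_sq_le (α := θ 0) (γ := θ T) (hθm.monotone hT.le)
      rw [← e1] at e2
      calc _ ≤ ∫ t in (0 : ℝ)..T, α₀⁻¹ * (D (θ t) ^ 2 * a t) := by
            refine intervalIntegral.integral_mono_on hT.le
              (Continuous.intervalIntegrable (by fun_prop) _ _)
              (Continuous.intervalIntegrable (by fun_prop) _ _) fun t _ => ?_
            have e3 : 1 ≤ α₀⁻¹ * a t := by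
              rw [mul_comm, ← div_eq_mul_inv, one_le_div hα₀]; exact haa t
            nlinarith [sq_nonneg (D (θ t))]
        _ ≤ α₀⁻¹ * S := by
            rw [intervalIntegral.integral_const_mul]
            exact mul_le_mul_of_nonneg_left e2 (inv_pos.2 hα₀).le
    have h0 : (0 : ℝ) ∈ Icc 0 Real.pi := ⟨le_rfl, hπ.le⟩
    calc _ ≤ ∫ t in (0 : ℝ)..T, K₀ * (D (θ t) ^ 2 + L * S) := by
          refine intervalIntegral.integral_mono_on hT.le
            ((hdc.comp (continuous_id.prodMk continuous_const)).intervalIntegrable _ _)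
            (Continuous.intervalIntegrable (by fun_prop) _ _) fun t ht => ?_
          have := hpoint t ht 0 h0
          rw [hX0, sub_zero] at this
          simpa only [hX0] using this
      _ = K₀ * ((∫ t in (0 : ℝ)..T, D (θ t) ^ 2) + T * (L * S)) := by
          rw [intervalIntegral.integral_const_mul, intervalIntegral.integral_add
            (Continuous.intervalIntegrable (by fun_prop) _ _)
            (Continuous.intervalIntegrable (by fun_prop) _ _),
            intervalIntegral.integral_const, sub_zero, smul_eq_mul]
      _ ≤ K₀ * (α₀⁻¹ * S + T * (L * S)) := by gcongr
      _ = K₀ * (α₀⁻¹ + T * L) * S := by ring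
      _ ≤ K₀ * (α₀⁻¹ + T * L) * (4 * β₁ * S') := by gcongr
      _ = K₂ * S' := by ring
      _ ≤ (K₁ + K₂) * S' := by gcongr; linarith

/-! ### The weak formulation and the passage from continuous targets to L². -/

/-- Fubini's theorem for a continuous function times an integrable weight. -/
lemma integral_integral_mul_swap {F : ℝ → ℝ → ℝ} (hF : Continuous (uncurry F)) {g : ℝ → ℝ}
    {t L : ℝ} (ht : 0 ≤ t) (hL : 0 ≤ L) (hg : IntervalIntegrable g volume 0 L) :
    ∫ ξ in (0 : ℝ)..L, (∫ r in (0 : ℝ)..t, F r ξ) * g ξ =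
      ∫ r in (0 : ℝ)..t, ∫ ξ in (0 : ℝ)..L, F r ξ * g ξ := by
  simp_rw [← intervalIntegral.integral_mul_const]
  simp_rw [intervalIntegral.integral_of_le ht, intervalIntegral.integral_of_le hL]
  refine integral_integral_swap ?_
  have hg' : Integrable g (volume.restrict (Ioc 0 L)) := by
    rwa [intervalIntegrable_iff_integrableOn_Ioc_of_le hL] at hg
  have h1 : Integrable (fun q : ℝ × ℝ => g q.1)
      ((volume.restrict (Ioc 0 L)).prod (volume.restrict (Ioc 0 t))) := by
    simpa using hg'.mul_prod (integrable_const (1 : ℝ) (μ := volume.restrict (Ioc 0 t)))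
  obtain ⟨C, hC⟩ := (isCompact_Icc.prod isCompact_Icc :
    IsCompact (Icc 0 t ×ˢ Icc 0 L)).exists_bound_of_continuousOn hF.continuousOn
  refine h1.bdd_mul (c := C) (f := fun q => F q.2 q.1) ?_ ?_
  · exact (hF.comp continuous_swap).aestronglyMeasurable
  · rw [Measure.prod_restrict]
    filter_upwards [ae_restrict_mem (measurableSet_Ioc.prod measurableSet_Ioc)] with q hq
    exact hC (q.2, q.1) ⟨Ioc_subset_Icc_self hq.2, Ioc_subset_Icc_self hq.1⟩

lemma IsPrimOn.of_hasDerivAt {L : ℝ} {f f' : ℝ → ℝ} (hf : Continuous f)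
    (hf' : ContinuousOn f' (Icc 0 L)) (hL : 0 ≤ L) (h : ∀ x ∈ Ioo 0 L, HasDerivAt f (f' x) x) :
    IsPrimOn L f f' := by
  refine ⟨ContinuousOn.intervalIntegrable_of_Icc hL hf', fun x hx => ?_⟩
  rw [intervalIntegral.integral_eq_sub_of_hasDerivAt_of_le hx.1 hf.continuousOn
    (fun y hy => h y ⟨hy.1, hy.2.trans_le hx.2⟩)
    (ContinuousOn.intervalIntegrable_of_Icc hx.1 (hf'.mono (Icc_subset_Icc_right hx.2)))]
  ring

/-- The element of `L²(0,L)` given by a continuous function. -/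
def continuousToL2 (L : ℝ) (f : ℝ → ℝ) (hf : Continuous f) : L2Interval L :=
  (memLp_of_continuousOn (L := L) hf.continuousOn).toLp

section continuousToL2

variable {L : ℝ} {f g : ℝ → ℝ} (hf : Continuous f) (hg : Continuous g)

lemma coeFn_continuousToL2 :
    continuousToL2 L f hf =ᵐ[volume.restrict (Ioo 0 L)] f := MemLp.coeFn_toLp _

lemma norm_sub_continuousToL2_sq (hL : 0 ≤ L) :
    ‖continuousToL2 L f hf - continuousToL2 L g hg‖ ^ 2 = ∫ x in (0 : ℝ)..L, (f x - g x) ^ 2 := by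
  rw [← real_inner_self_eq_norm_sq, L2.inner_def, intervalIntegral.integral_of_le hL,
    integral_Ioc_eq_integral_Ioo]
  refine integral_congr_ae ?_
  filter_upwards [coeFn_continuousToL2 hf, coeFn_continuousToL2 hg,
    Lp.coeFn_sub (continuousToL2 L f hf) (continuousToL2 L g hg)] with x h1 h2 h3
  rw [h3, Pi.sub_apply, h1, h2]
  simp [sq]

lemma continuous_continuousToL2 (hL : 0 ≤ L) {w : ℝ → ℝ → ℝ} (hw : Continuous (uncurry w)) :
    Continuous fun t => continuousToL2 L (w t) (hw.uncurry_left t) := by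
  rw [continuous_iff_continuousAt]
  intro t
  rw [ContinuousAt, tendsto_iff_norm_sub_tendsto_zero]
  have h1 : Continuous fun s => ∫ x in (0 : ℝ)..L, (w s x - w t x) ^ 2 :=
    intervalIntegral.continuous_parametric_intervalIntegral_of_continuous' (by fun_prop) _ _
  have h2 := (h1.sqrt).tendsto t
  simp only [sub_self, ne_eq, OfNat.ofNat_ne_zero, not_false_eq_true, zero_pow,
    intervalIntegral.integral_zero, Real.sqrt_zero] at h2
  refine h2.congr fun s => ?_
  rw [← norm_sub_continuousToL2_sq (hw.uncurry_left s) (hw.uncurry_left t) hL,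
    Real.sqrt_sq (norm_nonneg _)]

lemma integral_continuousToL2_mul (hL : 0 ≤ L) (φ : ℝ → ℝ) :
    ∫ x in (0 : ℝ)..L, continuousToL2 L f hf x * φ x = ∫ x in (0 : ℝ)..L, f x * φ x :=
  integral_congr_ae_Ioo hL (by
    filter_upwards [coeFn_continuousToL2 hf] with x hx
    rw [hx])

end continuousToL2

/-- The weak form of the string equation, integrated twice in time. -/
lemma IsStringWave.integral_mul_eq {b a N W : ℝ → ℝ} {T : ℝ} {w v : ℝ → ℝ → ℝ}
    (h : IsStringWave b a N T W w v) (ha : Continuous a) (hN : Continuous N) {c : ℝ → ℝ}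
    (hc : ContDiffOn ℝ 1 c (Icc 0 Real.pi)) (hbc : ∀ ξ ∈ Icc 0 Real.pi, b ξ ^ 2 = c ξ)
    (hcpos : ∀ ξ ∈ Icc 0 Real.pi, 0 < c ξ) {φ φ₁ φ₂ : ℝ → ℝ} (hφ : IsDomA φ φ₁ φ₂) {t : ℝ}
    (ht : t ∈ Icc 0 T) :
    ∫ ξ in (0 : ℝ)..Real.pi, w t ξ * φ ξ =
      ∫ τ in (0 : ℝ)..t, ∫ s in (0 : ℝ)..τ, N (τ - s) * (a s ^ 2 *
        ((∫ ξ in (0 : ℝ)..Real.pi, w s ξ * opA c φ₁ φ₂ ξ) + c 0 * w s 0 * φ₁ 0)) := by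
  have hπ := Real.pi_pos.le
  have hw := h.cont_w
  have hv := h.cont_v
  have hφ₁ := hφ.isPrimOn.integrable
  -- First integration by parts, through w_t = v_ξ; the boundary terms vanish with φ.
  have h1 : ∫ ξ in (0 : ℝ)..Real.pi, w t ξ * φ ξ =
      ∫ τ in (0 : ℝ)..t, -∫ ξ in (0 : ℝ)..Real.pi, v τ ξ * φ₁ ξ := by
    have hZ : IsPrimOn Real.pi (fun ξ => ∫ s in (0 : ℝ)..t, v s ξ) (w t) :=
      .of_hasDerivAt (intervalIntegral.continuous_parametric_intervalIntegral_of_continuous'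
        (f := fun ξ s => v s ξ) (by fun_prop) _ _) (by fun_prop) hπ (h.deriv_v t ht)
    rw [hZ.integral_deriv_mul hπ hφ.isPrimOn, hφ.left, hφ.right,
      integral_integral_mul_swap hv ht.1 hπ hφ₁, intervalIntegral.integral_neg]
    ring
  rw [h1]
  refine intervalIntegral.integral_congr fun τ hτ => ?_
  rw [uIcc_of_le ht.1] at hτ
  have hτT : τ ∈ Icc 0 T := ⟨hτ.1, hτ.2.trans ht.2⟩
  have hFc : Continuous (uncurry fun s ξ => N (τ - s) * a s ^ 2 * w s ξ) := by fun_prop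
  have hb2 : ContinuousOn (fun ξ => v τ ξ / b ξ ^ 2) (Icc 0 Real.pi) := by
    have : ContinuousOn (fun ξ => v τ ξ / c ξ) (Icc 0 Real.pi) :=
      ContinuousOn.div (by fun_prop) hc.continuousOn fun ξ hξ => (hcpos ξ hξ).ne'
    exact this.congr fun ξ hξ => by simp only [hbc ξ hξ]
  have hΨ : IsPrimOn Real.pi (fun ξ => ∫ s in (0 : ℝ)..τ, N (τ - s) * a s ^ 2 * w s ξ)
      (fun ξ => v τ ξ / b ξ ^ 2) :=
    .of_hasDerivAt (intervalIntegral.continuous_parametric_intervalIntegral_of_continuous'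
        (f := fun ξ s => N (τ - s) * a s ^ 2 * w s ξ) (by fun_prop) _ _) hb2 hπ (h.deriv_w τ hτT)
  have hop := hφ.isPrimOn_flux hc
  -- Second integration by parts, against the flux cφ'. The boundary term at π vanishes with w; the
  -- one at 0 is the control term.
  have h2 := hΨ.integral_deriv_mul hπ hop
  have h3 : ∫ s in (0 : ℝ)..τ, N (τ - s) * a s ^ 2 * w s Real.pi = 0 := by
    have : ∫ s in (0 : ℝ)..τ, N (τ - s) * a s ^ 2 * w s Real.pi = ∫ s in (0 : ℝ)..τ, (0 : ℝ) :=
      intervalIntegral.integral_congr fun s hs => by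
        rw [uIcc_of_le hτ.1] at hs
        simp [h.right s ⟨hs.1, hs.2.trans hτT.2⟩]
    simpa using this
  have h4 : ∫ ξ in (0 : ℝ)..Real.pi, v τ ξ / b ξ ^ 2 * (c ξ * φ₁ ξ) =
      ∫ ξ in (0 : ℝ)..Real.pi, v τ ξ * φ₁ ξ :=
    intervalIntegral.integral_congr fun ξ hξ => by
      rw [uIcc_of_le hπ] at hξ
      have := (hcpos ξ hξ).ne'
      simp only [hbc ξ hξ]
      field_simp
  rw [h4, h3, integral_integral_mul_swap hFc hτ.1 hπ hop.integrable] at h2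
  simp only [h2]
  have hI : IntervalIntegrable (fun s => ∫ ξ in (0 : ℝ)..Real.pi,
      N (τ - s) * a s ^ 2 * w s ξ * opA c φ₁ φ₂ ξ) volume 0 τ := by
    refine Continuous.intervalIntegrable ?_ _ _
    have h5 := continuousOn_integral_mul (continuous_continuousToL2 hπ hFc).continuousOn
      (s := univ) (hφ.memLp_opA hc)
    simpa only [integral_continuousToL2_mul _ hπ, continuousOn_univ] using h5
  rw [zero_mul, zero_sub, neg_sub, sub_neg_eq_add,
    ← intervalIntegral.integral_mul_const, ← intervalIntegral.integral_add hI
      (Continuous.intervalIntegrable (by fun_prop) _ _)]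
  refine intervalIntegral.integral_congr fun s _ => ?_
  simp only [mul_assoc, intervalIntegral.integral_const_mul]
  ring

/-- The elements of `L²(0,L)` with a continuous representative vanishing outside `(0,L)`. -/
def profileSubmodule (L : ℝ) : Submodule ℝ (L2Interval L) where
  carrier := {f | ∃ g, ∃ hg : IsProfile L g, continuousToL2 L g hg.cont = f}
  zero_mem' := ⟨fun _ => 0, ⟨continuous_const, fun _ _ => rfl, fun _ _ => rfl⟩,
    MemLp.toLp_zero _⟩
  add_mem' := by
    rintro _ _ ⟨g, hg, rfl⟩ ⟨g', hg', rfl⟩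
    exact ⟨fun x => g x + g' x, ⟨hg.cont.add hg'.cont,
      fun s hs => by simp [hg.left s hs, hg'.left s hs],
      fun s hs => by simp [hg.right s hs, hg'.right s hs]⟩, MemLp.toLp_add _ _⟩
  smul_mem' := by
    rintro r _ ⟨g, hg, rfl⟩
    exact ⟨fun x => r • g x, ⟨hg.cont.const_smul r, fun s hs => by simp [hg.left s hs],
      fun s hs => by simp [hg.right s hs]⟩, MemLp.toLp_const_smul r (memLp_of_continuousOn hg.cont.continuousOn)⟩

/-- Smooth functions with compact support in (0, L) are profiles, and an element of L² orthogonal to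
all of them is zero. -/
lemma topologicalClosure_profileSubmodule {L : ℝ} (hL : 0 ≤ L) :
    (profileSubmodule L).topologicalClosure = ⊤ := by
  rw [Submodule.topologicalClosure_eq_top_iff, Submodule.eq_bot_iff]
  intro f hf
  have h1 : ∀ᵐ x ∂(volume.restrict (Ioo 0 L)), x ∈ Ioo 0 L → f x = 0 := by
    refine isOpen_Ioo.ae_eq_zero_of_integral_contDiff_smul_eq_zero
      (((Lp.memLp f).integrable (by norm_num)).locallyIntegrable.locallyIntegrableOn _)
      fun g hg _ hgs => ?_
    have hz : ∀ s, s ∉ Ioo 0 L → g s = 0 := fun s hs =>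
      image_eq_zero_of_notMem_tsupport fun h => hs (hgs h)
    have hp : IsProfile L g := ⟨hg.continuous, fun s hs => hz s fun h => absurd h.1 hs.not_gt,
      fun s hs => hz s fun h => absurd h.2 hs.not_gt⟩
    have h2 := (Submodule.mem_orthogonal _ _).1 hf _ ⟨g, hp, rfl⟩
    rw [real_inner_comm, continuousToL2, ← integral_mul_eq_inner hL,
      intervalIntegral.integral_of_le hL, integral_Ioc_eq_integral_Ioo] at h2
    simpa [mul_comm] using h2
  rw [Lp.eq_zero_iff_ae_eq_zero]
  filter_upwards [h1, ae_restrict_mem measurableSet_Ioo] with x hx hx'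
  exact hx hx'

lemma exists_isProfile_tendsto {L : ℝ} (hL : 0 ≤ L) (W : L2Interval L) :
    ∃ (g : ℕ → ℝ → ℝ) (hg : ∀ n, IsProfile L (g n)),
      Tendsto (fun n => continuousToL2 L (g n) (hg n).cont) atTop (𝓝 W) := by
  have h : W ∈ closure (profileSubmodule L : Set (L2Interval L)) := by
    rw [← Submodule.topologicalClosure_coe, topologicalClosure_profileSubmodule hL]
    trivial
  obtain ⟨x, hx, hlim⟩ := mem_closure_iff_seq_limit.1 h
  choose g hg hgx using hx
  exact ⟨g, hg, by simpa only [hgx] using hlim⟩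

lemma integral_abs_le_norm {L : ℝ} (hL : 0 ≤ L) (f : L2Interval L) :
    ∫ x in (0 : ℝ)..L, |f x| ≤ √L * ‖f‖ := by
  have h0 : MemLp (fun _ : ℝ => (1 : ℝ)) 2 (volume.restrict (Ioo 0 L)) := memLp_const 1
  have h1 : ∫ x in (0 : ℝ)..L, |f x| = ∫ x in (0 : ℝ)..L, |f| x * 1 :=
    integral_congr_ae_Ioo hL (by
      filter_upwards [Lp.coeFn_abs f] with x hx
      rw [hx, mul_one])
  have h2 : ‖h0.toLp‖ = √L := by
    rw [Lp.norm_toLp, eLpNorm_const' _ (by norm_num) (by norm_num)]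
    simp [Real.sqrt_eq_rpow, ← ENNReal.toReal_rpow, ENNReal.toReal_ofReal hL]
  rw [h1, integral_mul_eq_inner hL _ h0, ← h2, mul_comm, ← norm_abs_eq_norm f]
  exact real_inner_le_norm _ _

/-- Passage to the limit in a twice integrated identity. -/
lemma hasDerivWithinAt_of_tendsto_convolution {N : ℝ → ℝ} (hN : Continuous N) {T : ℝ}
    (hT : 0 ≤ T) {h : ℕ → ℝ → ℝ} (hh : ∀ n, Continuous (h n)) {h' : ℝ → ℝ}
    (hh' : IntervalIntegrable h' volume 0 T)
    (hlim : Tendsto (fun n => ∫ s in (0 : ℝ)..T, |h n s - h' s|) atTop (𝓝 0)) {G : ℝ → ℝ}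
    (hG : ∀ t ∈ Icc 0 T, Tendsto (fun n => ∫ τ in (0 : ℝ)..t, ∫ s in (0 : ℝ)..τ, N (τ - s) * h n s)
      atTop (𝓝 (G t))) {t : ℝ} (ht : t ∈ Icc 0 T) :
    HasDerivWithinAt G (∫ s in (0 : ℝ)..t, N (t - s) * h' s) (Icc 0 T) t := by
  obtain ⟨B, hB⟩ := (isCompact_Icc (a := 0) (b := T)).exists_bound_of_continuousOn hN.continuousOn
  have hB0 : 0 ≤ B := (norm_nonneg _).trans (hB 0 ⟨le_rfl, hT⟩)
  set F : ℝ → ℝ := fun τ => ∫ s in (0 : ℝ)..τ, N (τ - s) * h' s with hF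
  have hFc : ∀ n, Continuous fun τ => ∫ s in (0 : ℝ)..τ, N (τ - s) * h n s := fun n => by
    have := hh n
    exact intervalIntegral.continuous_parametric_intervalIntegral_of_continuous (by fun_prop)
      continuous_id
  have hint : ∀ τ ∈ Icc 0 T, IntervalIntegrable h' volume 0 τ := fun τ hτ =>
    hh'.mono_set (by rw [uIcc_of_le hτ.1, uIcc_of_le hT]; exact Icc_subset_Icc_right hτ.2)
  have hd : ∀ n, ∀ τ ∈ Icc 0 T, |F τ - ∫ s in (0 : ℝ)..τ, N (τ - s) * h n s| ≤
      B * ∫ s in (0 : ℝ)..T, |h n s - h' s| := by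
    intro n τ hτ
    have hi : ∀ τ ∈ Icc 0 T, IntervalIntegrable (fun s => |h n s - h' s|) volume 0 τ := fun τ hτ =>
      (((hh n).intervalIntegrable _ _).sub (hint τ hτ)).abs
    have hNτ : ContinuousOn (fun s => N (τ - s)) (Icc 0 τ) := by fun_prop
    rw [← intervalIntegral.integral_sub
      (IsPrimOn.integrable_continuousOn_mul hτ.1 (hint τ hτ) hNτ)
      (IsPrimOn.integrable_continuousOn_mul hτ.1 ((hh n).intervalIntegrable _ _) hNτ)]
    calc |∫ s in (0 : ℝ)..τ, (N (τ - s) * h' s - N (τ - s) * h n s)|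
        ≤ ∫ s in (0 : ℝ)..τ, B * |h n s - h' s| := by
          rw [← Real.norm_eq_abs]
          refine intervalIntegral.norm_integral_le_of_norm_le hτ.1
            (Eventually.of_forall fun s hs => ?_) ((hi τ hτ).const_mul B)
          rw [← mul_sub, norm_mul, Real.norm_eq_abs (h' s - _), abs_sub_comm]
          gcongr
          exact hB _ ⟨by linarith [hs.2], by linarith [hs.1, hτ.2]⟩
      _ ≤ B * ∫ s in (0 : ℝ)..T, |h n s - h' s| := by
          rw [intervalIntegral.integral_const_mul]
          gcongr
          exact intervalIntegral.integral_mono_interval le_rfl hτ.1 hτ.2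
            (Eventually.of_forall fun s => abs_nonneg _) (hi T ⟨hT, le_rfl⟩)
  have hlimB : Tendsto (fun n => B * ∫ s in (0 : ℝ)..T, |h n s - h' s|) atTop (𝓝 0) := by
    simpa using hlim.const_mul B
  -- L¹ convergence of the densities makes the convolutions converge uniformly. The limit `F` is
  -- thus continuous, and its primitive `G` is differentiable at every point of [0, T].
  have hunif : TendstoUniformlyOn (fun n τ => ∫ s in (0 : ℝ)..τ, N (τ - s) * h n s) F atTop
      (Icc 0 T) := by
    rw [Metric.tendstoUniformlyOn_iff]
    intro ε hε
    filter_upwards [hlimB.eventually_lt_const hε] with n hn τ hτ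
    exact (hd n τ hτ).trans_lt hn
  have hFcont : ContinuousOn F (Icc 0 T) :=
    hunif.continuousOn (Frequently.of_forall fun n => (hFc n).continuousOn)
  have hGeq : ∀ t ∈ Icc 0 T, G t = ∫ τ in (0 : ℝ)..t, F τ := by
    intro t ht
    refine tendsto_nhds_unique (hG t ht) ?_
    refine TendstoUniformlyOn.tendsto_intervalIntegral_of_continuousOn
      (Eventually.of_forall fun n => (hFc n).continuousOn) (hunif.mono ?_)
    rw [uIcc_of_le ht.1]
    exact Icc_subset_Icc_right ht.2
  have hder := (hasDerivAt_integral_right (hFcont.continuous_comp_clampTo hT) 0 t).hasDerivWithinAt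
    (s := Icc 0 T)
  simp only [clampTo_of_mem ht] at hder
  have hcl : ∀ t ∈ Icc 0 T, G t = ∫ τ in (0 : ℝ)..t, F (clampTo T τ) := fun t ht => by
    rw [hGeq t ht]
    refine intervalIntegral.integral_congr fun τ hτ => ?_
    rw [uIcc_of_le ht.1] at hτ
    simp only [clampTo_of_mem ⟨hτ.1, hτ.2.trans ht.2⟩]
  exact hder.congr hcl (hcl t ht)

/-- Transfer to the limit of a Lipschitz dependence on a convergent sequence. -/
lemma norm_sub_le_of_tendsto {E F : Type*} [NormedAddCommGroup E] [NormedAddCommGroup F]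
    {x : ℕ → E} {x' : E} (hx : Tendsto x atTop (𝓝 x')) {z : ℕ → F} {z' : F}
    (hz : Tendsto z atTop (𝓝 z')) {K : ℝ} (h : ∀ n m, ‖z n - z m‖ ^ 2 ≤ K * ‖x n - x m‖ ^ 2)
    (n : ℕ) : ‖z n - z'‖ ≤ √K * ‖x n - x'‖ := by
  refine le_of_tendsto_of_tendsto' (tendsto_const_nhds.sub hz).norm
    ((tendsto_const_nhds.sub hx).norm.const_mul _) fun m => ?_
  have := Real.sqrt_le_sqrt (h n m)
  rwa [Real.sqrt_sq (norm_nonneg _), Real.sqrt_mul' _ (sq_nonneg _),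
    Real.sqrt_sq (norm_nonneg _)] at this

lemma cauchySeq_of_norm_sub_sq_le {E F : Type*} [NormedAddCommGroup E] [NormedAddCommGroup F]
    {x : ℕ → E} (hx : CauchySeq x) {z : ℕ → F} {K : ℝ}
    (h : ∀ n m, ‖z n - z m‖ ^ 2 ≤ K * ‖x n - x m‖ ^ 2) : CauchySeq z := by
  rw [Metric.cauchySeq_iff'] at hx ⊢
  intro ε hε
  obtain ⟨n₀, hn₀⟩ := hx (ε / (√K + 1)) (by positivity)
  refine ⟨n₀, fun n hn => ?_⟩
  have h1 := Real.sqrt_le_sqrt (h n n₀)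
  rw [Real.sqrt_sq (norm_nonneg _), Real.sqrt_mul' _ (sq_nonneg _),
    Real.sqrt_sq (norm_nonneg _)] at h1
  have h2 := hn₀ n hn
  rw [dist_eq_norm, lt_div_iff₀ (by positivity)] at h2
  rw [dist_eq_norm]
  nlinarith [norm_nonneg (x n - x n₀)]

/-- Existence of weak solutions with a prescribed final state, for coefficients extended to the
line. -/
lemma exists_string_control {b b₁ a a₁ N m m₁ c : ℝ → ℝ} {T β₀ β₁ α₀ : ℝ} (hT : 0 < T)
    (hb : ∀ ξ, HasDerivAt b (b₁ ξ) ξ) (hb₁ : Continuous b₁) (hβ₀ : 0 < β₀)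
    (hbb : ∀ ξ, β₀ ≤ b ξ ∧ b ξ ≤ β₁) (ha : ∀ t, HasDerivAt a (a₁ t) t) (ha₁ : Continuous a₁)
    (hα₀ : 0 < α₀) (haa : ∀ t, α₀ ≤ a t) (hN : ∀ t, HasDerivAt N (m t) t)
    (hm : ∀ t, HasDerivAt m (m₁ t) t) (hm₁ : Continuous m₁) (hN0 : N 0 = 1)
    (hlen : ∫ ξ in (0 : ℝ)..Real.pi, (b ξ)⁻¹ ≤ ∫ t in (0 : ℝ)..T, a t)
    (hc : ContDiffOn ℝ 1 c (Icc 0 Real.pi)) (hbc : ∀ ξ ∈ Icc 0 Real.pi, b ξ ^ 2 = c ξ)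
    (hcpos : ∀ ξ ∈ Icc 0 Real.pi, 0 < c ξ) (W : L2Interval Real.pi) :
    ∃ (y : L2Interval T) (x : ℝ → L2Interval Real.pi), ContinuousOn x (Icc 0 T) ∧ x 0 = 0 ∧
      x T = W ∧ ∀ φ φ₁ φ₂ : ℝ → ℝ, IsDomA φ φ₁ φ₂ → ∀ t ∈ Icc 0 T,
        HasDerivWithinAt (fun τ => ∫ ξ in (0 : ℝ)..Real.pi, x τ ξ * φ ξ)
          (∫ s in (0 : ℝ)..t, N (t - s) * (a s ^ 2 *
            ((∫ ξ in (0 : ℝ)..Real.pi, x s ξ * opA c φ₁ φ₂ ξ) + c 0 * y s * φ₁ 0)))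
          (Icc 0 T) t := by
  have hπ := Real.pi_pos.le
  have hac : Continuous a := continuous_iff_continuousAt.2 fun ξ => (ha ξ).continuousAt
  have hNc : Continuous N := continuous_iff_continuousAt.2 fun ξ => (hN ξ).continuousAt
  obtain ⟨K, Ω, hK, hΩ⟩ := exists_isStringWave hT hb hb₁ hβ₀ hbb ha ha₁ hα₀ haa hN hm hm₁ hN0 hlen
  obtain ⟨g, hg, hgW⟩ := exists_isProfile_tendsto hπ W
  choose v hv using fun n => (hΩ (g n) (hg n)).1
  have hΩc : ∀ n, Continuous (uncurry (Ω (g n))) := fun n => (hv n).cont_w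
  have hΩ0 : ∀ n, Continuous fun t => Ω (g n) t 0 := fun n =>
    (hΩc n).comp (continuous_id.prodMk continuous_const)
  set G : ℕ → L2Interval Real.pi := fun n => continuousToL2 Real.pi (g n) (hg n).cont with hGdef
  set X : ℕ → ℝ → L2Interval Real.pi :=
    fun n t => continuousToL2 Real.pi (Ω (g n) t) ((hΩc n).uncurry_left t) with hXdef
  set Y : ℕ → L2Interval T := fun n => continuousToL2 T (fun t => Ω (g n) t 0) (hΩ0 n) with hYdef
  have hX : ∀ t ∈ Icc 0 T, ∀ n k, ‖X n t - X k t‖ ^ 2 ≤ K * ‖G n - G k‖ ^ 2 := fun t ht n k => by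
    rw [norm_sub_continuousToL2_sq _ _ hπ, norm_sub_continuousToL2_sq _ _ hπ]
    exact ((hΩ _ (hg n)).2 _ (hg k)).1 t ht
  have hY : ∀ n k, ‖Y n - Y k‖ ^ 2 ≤ K * ‖G n - G k‖ ^ 2 := fun n k => by
    rw [norm_sub_continuousToL2_sq _ _ hT.le, norm_sub_continuousToL2_sq _ _ hπ]
    exact ((hΩ _ (hg n)).2 _ (hg k)).2
  obtain ⟨y, hy⟩ := cauchySeq_tendsto_of_complete (cauchySeq_of_norm_sub_sq_le hgW.cauchySeq hY)
  -- The limit is chosen at clamped times so that it is defined for every real t; only [0, T]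
  -- matters.
  choose x hx' using fun t => cauchySeq_tendsto_of_complete
    (cauchySeq_of_norm_sub_sq_le hgW.cauchySeq (hX _ (clampTo_mem hT.le t)))
  have hx : ∀ t ∈ Icc 0 T, Tendsto (fun n => X n t) atTop (𝓝 (x t)) := fun t ht => by
    simpa only [clampTo_of_mem ht] using hx' t
  have hXx : ∀ t ∈ Icc 0 T, ∀ n, ‖X n t - x t‖ ≤ √K * ‖G n - W‖ := fun t ht n =>
    norm_sub_le_of_tendsto hgW (hx t ht) (hX t ht) n
  have hr : Tendsto (fun n => ‖G n - W‖) atTop (𝓝 0) := tendsto_iff_norm_sub_tendsto_zero.1 hgW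
  have hrY : Tendsto (fun n => ‖Y n - y‖) atTop (𝓝 0) := tendsto_iff_norm_sub_tendsto_zero.1 hy
  have hXc : ∀ n, Continuous (X n) := fun n => continuous_continuousToL2 hπ (hΩc n)
  have hxc : ContinuousOn x (Icc 0 T) := by
    have : TendstoUniformlyOn X x atTop (Icc 0 T) := by
      rw [Metric.tendstoUniformlyOn_iff]
      intro ε hε
      have h0 : Tendsto (fun n => √K * ‖G n - W‖) atTop (𝓝 0) := by simpa using hr.const_mul √K
      filter_upwards [h0.eventually_lt_const hε] with n hn t ht
      rw [dist_eq_norm, norm_sub_rev]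
      exact (hXx t ht n).trans_lt hn
    exact this.continuousOn (Frequently.of_forall fun n => (hXc n).continuousOn)
  refine ⟨y, x, hxc, ?_, ?_, fun φ φ₁ φ₂ hφ t ht => ?_⟩
  · refine tendsto_nhds_unique (hx 0 ⟨le_rfl, hT.le⟩) (tendsto_const_nhds.congr fun n => ?_)
    refine ((Lp.eq_zero_iff_ae_eq_zero).2 ?_).symm
    filter_upwards [coeFn_continuousToL2 ((hΩc n).uncurry_left 0),
      ae_restrict_mem measurableSet_Ioo] with ξ h1 h2
    rw [hXdef, h1, (hv n).initial ξ (Ioo_subset_Icc_self h2)]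
    rfl
  · refine tendsto_nhds_unique (hx T ⟨hT.le, le_rfl⟩) (hgW.congr fun n => ?_)
    refine MemLp.toLp_congr _ _ ?_
    filter_upwards [ae_restrict_mem measurableSet_Ioo] with ξ h2
    exact ((hv n).final ξ (Ioo_subset_Icc_self h2)).symm
  have hop := hφ.memLp_opA hc
  set J : ℕ → ℝ → ℝ := fun n s => ∫ ξ in (0 : ℝ)..Real.pi, X n s ξ * opA c φ₁ φ₂ ξ with hJ
  have hJc : ∀ n, Continuous (J n) := fun n =>
    continuousOn_univ.1 (continuousOn_integral_mul (hXc n).continuousOn hop)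
  have hxi := continuousOn_integral_mul hxc hop
  have hyi : IntervalIntegrable (fun s => c 0 * y s * φ₁ 0) volume 0 T :=
    (((Lp.memLp y).intervalIntegrable_zero hT.le).const_mul _).mul_const _
  -- The limit is taken in the twice integrated identity, where L¹ convergence of the integrand is
  -- enough; the derivative form is recovered afterwards.
  refine hasDerivWithinAt_of_tendsto_convolution hNc hT.le
    (h := fun n s => a s ^ 2 * (J n s + c 0 * Ω (g n) s 0 * φ₁ 0)) (fun n => ?_) ?_ ?_ ?_ ht
  · have := hΩ0 n
    have := hJc n
    fun_prop
  · exact IsPrimOn.integrable_continuousOn_mul hT.le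
      ((hxi.intervalIntegrable_of_Icc hT.le).add hyi) (by fun_prop)
  · obtain ⟨A, hA⟩ := (isCompact_Icc (a := 0) (b := T)).exists_bound_of_continuousOn
      (hac.pow 2).continuousOn
    have hA0 : 0 ≤ A := (norm_nonneg _).trans (hA 0 ⟨le_rfl, hT.le⟩)
    set C := ‖hop.toLp‖
    have hbound : ∀ n, ∫ s in (0 : ℝ)..T, |a s ^ 2 * (J n s + c 0 * Ω (g n) s 0 * φ₁ 0) -
        a s ^ 2 * ((∫ ξ in (0 : ℝ)..Real.pi, x s ξ * opA c φ₁ φ₂ ξ) + c 0 * y s * φ₁ 0)| ≤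
        A * (√K * ‖G n - W‖ * C * T + |c 0 * φ₁ 0| * (√T * ‖Y n - y‖)) := by
      intro n
      have hz : IntervalIntegrable (fun s => |(Y n - y) s|) volume 0 T :=
        ((Lp.memLp (Y n - y)).intervalIntegrable_zero hT.le).abs
      calc _ = ∫ s in (0 : ℝ)..T, |a s ^ 2 * ((J n s -
            ∫ ξ in (0 : ℝ)..Real.pi, x s ξ * opA c φ₁ φ₂ ξ) + c 0 * φ₁ 0 * (Y n - y) s)| := by
            refine integral_congr_ae_Ioo hT.le ?_
            filter_upwards [coeFn_continuousToL2 (hΩ0 n), Lp.coeFn_sub (Y n) y] with s h1 h2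
            rw [h2, Pi.sub_apply, hYdef, h1]
            congr 1
            ring
        _ ≤ ∫ s in (0 : ℝ)..T, A * (√K * ‖G n - W‖ * C + |c 0 * φ₁ 0| * |(Y n - y) s|) := by
            refine intervalIntegral.integral_mono_on hT.le (IntervalIntegrable.abs ?_) ?_
              fun s hs => ?_
            · exact IsPrimOn.integrable_continuousOn_mul hT.le
                ((((hJc n).continuousOn.sub hxi).intervalIntegrable_of_Icc hT.le).add
                  (((Lp.memLp (Y n - y)).intervalIntegrable_zero hT.le).const_mul _))
                (by fun_prop)
            · exact (intervalIntegrable_const.add (hz.const_mul _)).const_mul _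
            · rw [abs_mul]
              have h1 : |J n s - ∫ ξ in (0 : ℝ)..Real.pi, x s ξ * opA c φ₁ φ₂ ξ| ≤
                  √K * ‖G n - W‖ * C := by
                simp only [hJ, integral_mul_eq_inner hπ _ hop]
                rw [← inner_sub_left]
                exact (abs_real_inner_le_norm _ _).trans
                  (mul_le_mul_of_nonneg_right (hXx s hs n) (norm_nonneg _))
              have h2 := (abs_add_le (J n s - ∫ ξ in (0 : ℝ)..Real.pi, x s ξ * opA c φ₁ φ₂ ξ)
                (c 0 * φ₁ 0 * (Y n - y) s)).trans (add_le_add h1 (abs_mul _ _).le)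
              exact mul_le_mul (hA s hs) h2 (abs_nonneg _) hA0
        _ = A * (√K * ‖G n - W‖ * C * T + |c 0 * φ₁ 0| * ∫ s in (0 : ℝ)..T, |(Y n - y) s|) := by
            rw [intervalIntegral.integral_const_mul, intervalIntegral.integral_add
              intervalIntegrable_const (hz.const_mul _), intervalIntegral.integral_const, sub_zero,
              smul_eq_mul, mul_comm T, intervalIntegral.integral_const_mul]
        _ ≤ _ := by
            gcongr
            exact integral_abs_le_norm hT.le _
    refine squeeze_zero (fun n => intervalIntegral.integral_nonneg hT.le fun s _ => abs_nonneg _)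
      hbound ?_
    have h1 := ((((hr.const_mul √K).mul_const C).mul_const T).add
      ((hrY.const_mul √T).const_mul |c 0 * φ₁ 0|)).const_mul A
    simpa using h1
  · intro t ht
    have h1 : Tendsto (fun n => ∫ ξ in (0 : ℝ)..Real.pi, X n t ξ * φ ξ) atTop
        (𝓝 (∫ ξ in (0 : ℝ)..Real.pi, x t ξ * φ ξ)) := by
      simp only [integral_mul_eq_inner hπ _ hφ.memLp]
      exact (hx t ht).inner tendsto_const_nhds
    refine h1.congr fun n => ?_
    rw [hXdef, integral_continuousToL2_mul _ hπ,
      (hv n).integral_mul_eq hac hNc hc hbc hcpos hφ ht]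
    simp only [hJ, hXdef, integral_continuousToL2_mul _ hπ]

/-! ### Assembly of the theorem. -/

/-- The square root of a positive `C¹` function on `[0, R]`, extended to the line. -/
lemma exists_sqrt_extension {R : ℝ} (hR : 0 < R) {g : ℝ → ℝ} (hg : ContDiffOn ℝ 1 g (Icc 0 R))
    (hpos : ∀ x ∈ Icc 0 R, 0 < g x) :
    ∃ f f₁ : ℝ → ℝ, ∃ m B : ℝ, 0 < m ∧ Continuous f₁ ∧ (∀ x, HasDerivAt f (f₁ x) x) ∧
      (∀ x ∈ Icc 0 R, f x = √(g x)) ∧ ∀ x, m ≤ f x ∧ f x ≤ B := by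
  obtain ⟨e, e₁, m, B, hm, he₁, he, heg, hb⟩ := exists_pos_C1_extension hR hg hpos
  have hep : ∀ x, 0 < e x := fun x => hm.trans_le (hb x).1
  have hec : Continuous e := continuous_iff_continuousAt.2 fun x => (he x).continuousAt
  refine ⟨fun x => √(e x), fun x => e₁ x / (2 * √(e x)), √m, √B, Real.sqrt_pos.2 hm, ?_,
    fun x => (he x).sqrt (hep x).ne', fun x hx => by simp only [heg hx],
    fun x => ⟨Real.sqrt_le_sqrt (hb x).1, Real.sqrt_le_sqrt (hb x).2⟩⟩
  exact he₁.div (by fun_prop) fun x => by have := Real.sqrt_pos.2 (hep x); positivity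

end

theorem mainTheorem2
    (c : ℝ → ℝ) (hc : ContDiffOn ℝ 1 c (Icc 0 Real.pi))
    (c₀ : ℝ) (hc₀ : 0 < c₀) (hcpos : ∀ ξ ∈ Icc 0 Real.pi, c₀ < c ξ)
    (hlen : (∫ ξ in (0 : ℝ)..Real.pi, (√(c ξ))⁻¹) ≤ Real.pi)
    (P : ℝ → ℝ) (hP : ContDiffOn ℝ 2 P (Ici 0))
    (p₀ : ℝ) (hp₀ : 0 < p₀) (hPpos : ∀ t, 0 ≤ t → p₀ < P t)
    (M : ℝ → ℝ) (hM : IsW22Loc M)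
    (T T₀ : ℝ) (hT₀ : (∫ s in (0 : ℝ)..T₀, √(P (T - s))) = Real.pi) (hT : T₀ ≤ T)
    (W : L2Interval Real.pi) :
    ∃ f : ℝ → ℝ, MemLp f 2 (volume.restrict (Ioo 0 T)) ∧
      ∃ w : ℝ → L2Interval Real.pi,
        IsStringSolution c P M T (fun t => f t / (c 0 * P t)) w ∧
        (∀ w' : ℝ → L2Interval Real.pi,
          IsStringSolution c P M T (fun t => f t / (c 0 * P t)) w' →
            ∀ t ∈ Icc 0 T, w' t = w t) ∧
        w T = W := by
  have hπ := Real.pi_pos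
  have hcp : ∀ ξ ∈ Icc 0 Real.pi, 0 < c ξ := fun ξ hξ => hc₀.trans (hcpos ξ hξ)
  have hPp : ∀ t, 0 ≤ t → 0 < P t := fun t ht => hp₀.trans (hPpos t ht)
  -- For T₀ ≤ 0 the integral in `hT₀` would be nonpositive, hence not π.
  have hT₀p : 0 < T₀ := by
    by_contra! h
    have h1 : 0 ≤ ∫ s in T₀..0, √(P (T - s)) :=
      intervalIntegral.integral_nonneg h fun _ _ => Real.sqrt_nonneg _
    rw [intervalIntegral.integral_symm] at h1
    linarith
  have hTp : 0 < T := hT₀p.trans_le hT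
  have hPT : ContDiffOn ℝ 1 P (Icc 0 T) := (hP.of_le (by norm_num)).mono Icc_subset_Ici_self
  have hPc : ContinuousOn P (Icc 0 T) := hPT.continuousOn
  -- extension of the coefficients
  obtain ⟨b, b₁, β₀, β₁, hβ₀, hb₁, hb, hbc, hbb⟩ := exists_sqrt_extension hπ hc hcp
  obtain ⟨a, a₁, α₀, α₁, hα₀, ha₁, ha, haP, haa⟩ :=
    exists_sqrt_extension hTp hPT fun t ht => hPp t ht.1
  obtain ⟨M₁, M₂, hM⟩ := hM
  have hM₁ : IsPrimOn T M₁ M₂ :=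
    ⟨(hM T hTp).memLp.intervalIntegrable_zero hTp.le, (hM T hTp).deriv_eq_integral⟩
  -- The regularity of M is needed only as continuity of M', that is of N'', which enters the kernel
  -- ρ₁.
  obtain ⟨m, m₁, hm₁, hm, hmM, -⟩ :=
    exists_C1_extension hTp.le (hM₁.continuousOn hTp.le) (hM T hTp).eq_integral
  have hmc : Continuous m := continuous_iff_continuousAt.2 fun x => (hm x).continuousAt
  set N : ℝ → ℝ := fun t => 1 + ∫ s in (0 : ℝ)..t, m s with hNdef
  have hN : ∀ t, HasDerivAt N (m t) t := fun t => (hasDerivAt_integral_right hmc 0 t).const_add _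
  have hNM : ∀ t ∈ Icc 0 T, integratedKernel M t = N t := fun t ht => by
    rw [integratedKernel, hNdef]
    congr 1
    refine intervalIntegral.integral_congr fun s hs => ?_
    rw [uIcc_of_le ht.1] at hs
    exact (hmM ⟨hs.1, hs.2.trans ht.2⟩).symm
  have hNc : ContinuousOn (integratedKernel M) (Icc 0 T) :=
    ContinuousOn.congr (fun t _ => (hN t).continuousAt.continuousWithinAt) hNM
  have ha2 : ∀ t ∈ Icc 0 T, a t ^ 2 = P t := fun t ht => by
    rw [haP t ht, Real.sq_sqrt (hPp t ht.1).le]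
  have hoptical : ∫ ξ in (0 : ℝ)..Real.pi, (b ξ)⁻¹ ≤ ∫ t in (0 : ℝ)..T, a t := by
    have h1 : ∫ ξ in (0 : ℝ)..Real.pi, (b ξ)⁻¹ = ∫ ξ in (0 : ℝ)..Real.pi, (√(c ξ))⁻¹ :=
      intervalIntegral.integral_congr fun ξ hξ => by
        rw [uIcc_of_le hπ.le] at hξ
        simp only [hbc ξ hξ]
    have h2 : ∫ t in (0 : ℝ)..T, a t = ∫ t in (0 : ℝ)..T, √(P t) :=
      intervalIntegral.integral_congr fun t ht => by
        rw [uIcc_of_le hTp.le] at ht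
        exact haP t ht
    -- Reversing time, `hT₀` says that √P has integral π over [T - T₀, T], a subinterval of [0, T].
    rw [intervalIntegral.integral_comp_sub_left (fun t => √(P t)), sub_zero] at hT₀
    rw [h1, h2]
    refine (hlen.trans hT₀.ge).trans (intervalIntegral.integral_mono_interval (by linarith)
      (by linarith) le_rfl (Eventually.of_forall fun t => Real.sqrt_nonneg _) ?_)
    exact ContinuousOn.intervalIntegrable_of_Icc hTp.le hPc.sqrt
  obtain ⟨y, x, hxc, hx0, hxT, hx⟩ := exists_string_control hTp hb hb₁ hβ₀ hbb ha ha₁ hα₀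
    (fun t => (haa t).1) hN hm hm₁ (by simp [hNdef]) hoptical hc
    (fun ξ hξ => by rw [hbc ξ hξ, Real.sq_sqrt (hcp ξ hξ).le]) hcp W
  have hu : ∀ t ∈ Icc 0 T, c 0 * P t * y t / (c 0 * P t) = y t := fun t ht =>
    mul_div_cancel_left₀ _ (mul_pos (hcp 0 ⟨le_rfl, hπ.le⟩) (hPp t ht.1)).ne'
  have hsol : IsStringSolution c P M T (fun t => c 0 * P t * y t / (c 0 * P t)) x := by
    refine ⟨hxc, hx0, fun φ φ₁ φ₂ hφ t ht => (hx φ φ₁ φ₂ hφ t ht).congr_deriv ?_⟩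
    refine intervalIntegral.integral_congr fun s hs => ?_
    rw [uIcc_of_le ht.1] at hs
    have hsT : s ∈ Icc 0 T := ⟨hs.1, hs.2.trans ht.2⟩
    simp only [hu s hsT, hNM (t - s) ⟨by linarith [hs.2], by linarith [hs.1, ht.2]⟩, ha2 s hsT]
    ring
  -- The factor c(0)P(t) undoes the normalization of the boundary condition, so that the boundary
  -- value on [0, T] is the trace `y`.
  refine ⟨fun t => c 0 * P t * y t, memLp_continuousOn_mul (by fun_prop) (Lp.memLp y), x, hsol,
    fun w' hw' => IsStringSolution.unique hc hcp hNc hPc ?_ hsol hw', hxT⟩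
  refine ((Lp.memLp y).intervalIntegrable_zero hTp.le).congr fun t ht => (hu t ?_).symm
  rw [uIoc_of_le hTp.le] at ht
  exact Ioc_subset_Icc_self ht
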